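/- Let $X,U,V$ be real Hilbert spaces, let $A:D(A)\subset X\to X$ generate a $C_0$ semigroup $(e^{tA})_{t\ge 0}$ on $X$, let $B\in L(U,X)$, $C\in L(X,V)$, and let $Q\in L(U,U)$ be positive definite, self-adjoint and boundedly invertible. Let $\Pi>0$, let $y_d\in C([0,+\infty);X)$ and $u_d\in L^2_{loc}([0,+\infty);U)$ be $\Pi$-periodic. Assume that $(A,B)$ is exponentially stabilizable (there is $K\in L(X,U)$ such that $A+BK$ generates an exponentially stable $C_0$ semigroup) and that $(A,C)$ is exponentially detectable ($(A^*,C^*)$ is exponentially stabilizable). Consider the problem $(LQ^\Pi)$ of minimizing $$\frac12\int_0^\Pi\Big(\|C(y(t)-y_d(t))\|_V^2+\|Q^{1/2}(u(t)-u_d(t))\|_U^2\Big)\,dt$$ over all $(y,u)\in C([0,\Pi];X)\times L^2(0,\Pi;U)$ such that $y$ is a mild solution of $\dot y=Ay+Bu$ on $[0,\Pi]$ and $y(0)=y(\Pi)$. An extremal triple of $(LQ^\Pi)$ is a triple $(y,\lambda,u)$ with $y,\lambda\in C([0,\Pi];X)$ satisfying, in the mild sense on $[0,\Pi]$, $$\dot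 y=Ay+BQ^{-1}B^*\lambda+Bu_d,\quad \dot\lambda=C^*Cy-A^*\lambda-C^*Cy_d,\quad y(0)=y(\Pi),\ \lambda(0)=\lambda(\Pi),$$ and $u=u_d+Q^{-1}B^*\lambda$ a.e. on $[0,\Pi]$. Then: 1. The Riccati equation $A^*P+PA-PBQ^{-1}B^*P+C^*C=0$ (on $D(A)$) has a unique nonnegative self-adjoint solution $P\in L(X,X)$; the operator $A-BQ^{-1}B^*P$ generates an exponentially stable $C_0$ semigroup $(S(t))_{t\ge0}$; the operators $I-S(\Pi)$ and $I-S(\Pi)^*$ are boundedly invertible; and the strong integral $E=-\int_0^{+\infty}S(t)BQ^{-1}B^*S(t)^*\,dt$ converges and defines $E\in L(X,X)$. 2. For $t\in[0,\Pi]$ let $$z(t)=S(t)(I-S(\Pi))^{-1}\int_0^\Pi S(\Pi-\tau)\big((I+EP)Bu_d(\tau)-EC^*Cy_d(\tau)\big)\,d\tau+\int_0^tS(t-\tau)\big((I+EP)Bu_d(\tau)-EC^*Cy_d(\tau)\big)\,d\tau,$$ $$q(t)=S(\Pi-t)^*(I-S(\Pi)^*)^{-1}\int_0^\Pi S(\Pi-\tau)^*\big(-PBu_d(\Pi-\tau)+C^*Cy_d(\Pi-\tau)\big)\,d\tau+\int_0^{\Pi-t}S(\Pi-t-\tau)^*\big(-PBu_d(\Pi-\tau)+C^*Cy_d(\Pi-\tau)\big)\,d\tau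 .$$ Then $z(0)=z(\Pi)$ and $q(0)=q(\Pi)$, and the triple $$y^\Pi(t)=z(t)-Eq(t),\qquad \lambda^\Pi(t)=-Pz(t)+(I+PE)q(t),\qquad u^\Pi(t)=u_d(t)+Q^{-1}B^*\lambda^\Pi(t)$$ is an extremal triple of $(LQ^\Pi)$ and the only one, and $(y^\Pi,u^\Pi)$ is the unique optimal pair of $(LQ^\Pi)$ (states and adjoint states being identified everywhere on $[0,\Pi]$, controls almost everywhere). -/

import Mathlib

open MeasureTheory Set Filter Topology

noncomputable section

namespace LQPeriodic

section Semigroups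

variable {X U V : Type*}
  [NormedAddCommGroup X] [InnerProductSpace ℝ X] [CompleteSpace X]
  [NormedAddCommGroup U] [InnerProductSpace ℝ U] [CompleteSpace U]
  [NormedAddCommGroup V] [InnerProductSpace ℝ V] [CompleteSpace V]

/-- `(S t)_{t ≥ 0}` is a strongly continuous (`C₀`) semigroup of bounded operators on `X`.
Only the values at `t ≥ 0` are meaningful. -/
structure IsC0Semigroup (S : ℝ → X →L[ℝ] X) : Prop where
  map_zero : S 0 = 1
  map_add : ∀ s t : ℝ, 0 ≤ s → 0 ≤ t → S (s + t) = S s ∘L S t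
  continuousOn : ∀ x : X, ContinuousOn (fun t => S t x) (Ici 0)

/-- The unbounded operator `A : D(A) ⊆ X → X` is the infinitesimal generator of the
`C₀` semigroup `S`: `x ∈ D(A)` and `A x = y` iff `(S t x - x) / t → y` as `t ↓ 0`. -/
structure IsGeneratorOf (A : X →ₗ.[ℝ] X) (S : ℝ → X →L[ℝ] X) : Prop where
  semigroup : IsC0Semigroup S
  mem_graph_iff : ∀ x y : X,
    (x, y) ∈ A.graph ↔ Tendsto (fun t : ℝ => t⁻¹ • (S t x - x)) (𝓝[>] 0) (𝓝 y)

/-- The family `(S t)_{t ≥ 0}` decays exponentially in operator norm. -/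
def ExpDecay (S : ℝ → X →L[ℝ] X) : Prop :=
  ∃ c ν : ℝ, 0 < c ∧ 0 < ν ∧ ∀ t : ℝ, 0 ≤ t → ‖S t‖ ≤ c * Real.exp (-ν * t)

/-- `A` generates an exponentially stable `C₀` semigroup. -/
def ExpStable (A : X →ₗ.[ℝ] X) : Prop :=
  ∃ S : ℝ → X →L[ℝ] X, IsGeneratorOf A S ∧ ExpDecay S

/-- The operator `A + K`, with domain `D(A)`, for a bounded operator `K`. -/
def boundedPerturbation (A : X →ₗ.[ℝ] X) (K : X →L[ℝ] X) : X →ₗ.[ℝ] X :=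
  (K : X →ₗ[ℝ] X) +ᵥ A

/-- `(A, B)` is exponentially stabilizable: `A + B K` is exponentially stable for some bounded
feedback operator `K`. -/
def ExpStabilizable (A : X →ₗ.[ℝ] X) (B : U →L[ℝ] X) : Prop :=
  ∃ K : X →L[ℝ] U, ExpStable (boundedPerturbation A (B ∘L K))

/-- `(A, C)` is exponentially detectable: `(A^*, C^*)` is exponentially stabilizable. -/
def ExpDetectable (A : X →ₗ.[ℝ] X) (C : X →L[ℝ] V) : Prop :=
  ExpStabilizable A.adjoint (ContinuousLinearMap.adjoint C)

/-- `y` is a mild solution of `y' = A y + f` on `[0, per]`, where `S` is the semigroup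
generated by `A`. -/
def IsMildSolution (S : ℝ → X →L[ℝ] X) (f : ℝ → X) (per : ℝ) (y : ℝ → X) : Prop :=
  ∀ t ∈ Icc 0 per, y t = S t (y 0) + ∫ s in (0 : ℝ)..t, S (t - s) (f s)

/-- `l` is a mild solution of the backward equation `l' = -A l + g` on `[0, per]`, where `S` is
the semigroup generated by `A`. -/
def IsBackwardMildSolution (S : ℝ → X →L[ℝ] X) (g : ℝ → X) (per : ℝ) (l : ℝ → X) : Prop :=
  ∀ t ∈ Icc 0 per, l t = S (per - t) (l per) - ∫ s in t..per, S (s - t) (g s)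

end Semigroups

section Problem

variable {X U V : Type*}
  [NormedAddCommGroup X] [InnerProductSpace ℝ X] [CompleteSpace X]
  [NormedAddCommGroup U] [InnerProductSpace ℝ U] [CompleteSpace U]
  [NormedAddCommGroup V] [InnerProductSpace ℝ V] [CompleteSpace V]

/-- The bounded operator `B Q⁻¹ B^*` (used for invertible `Q`). -/
def BQB (B : U →L[ℝ] X) (Q : U →L[ℝ] U) : X →L[ℝ] X :=
  B ∘L Ring.inverse Q ∘L ContinuousLinearMap.adjoint B

/-- The bounded operator `C^* C`. -/
def CC (C : X →L[ℝ] V) : X →L[ℝ] X :=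
  ContinuousLinearMap.adjoint C ∘L C

/-- Admissible pairs of the periodic problem: `(y, u) ∈ C([0, per]; X) × L²(0, per; U)`, `y` is a
mild solution of `y' = A y + B u` and `y 0 = y per`. Here `T` is the semigroup generated
by `A`. -/
structure IsAdmissible (T : ℝ → X →L[ℝ] X) (B : U →L[ℝ] X) (per : ℝ)
    (y : ℝ → X) (u : ℝ → U) : Prop where
  continuousOn : ContinuousOn y (Icc 0 per)
  memLp : MemLp u 2 (volume.restrict (Ioc 0 per))
  mild : IsMildSolution T (fun s => B (u s)) per y
  periodic : y 0 = y per

/-- The cost `½ ∫₀^per (‖C (y - y_d)‖² + ‖Q^{1/2} (u - u_d)‖²) dt`, where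
`‖Q^{1/2} v‖² = ⟨Q v, v⟩`. -/
def cost (C : X →L[ℝ] V) (Q : U →L[ℝ] U) (yd : ℝ → X) (ud : ℝ → U) (per : ℝ)
    (y : ℝ → X) (u : ℝ → U) : ℝ :=
  (1 / 2) * ∫ t in (0 : ℝ)..per,
    (‖C (y t - yd t)‖ ^ 2 + inner ℝ (Q (u t - ud t)) (u t - ud t))

/-- `(y, u)` is an optimal pair of the periodic optimal control problem. -/
def IsOptimal (T : ℝ → X →L[ℝ] X) (B : U →L[ℝ] X) (C : X →L[ℝ] V) (Q : U →L[ℝ] U)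
    (yd : ℝ → X) (ud : ℝ → U) (per : ℝ) (y : ℝ → X) (u : ℝ → U) : Prop :=
  IsAdmissible T B per y u ∧
    ∀ (y' : ℝ → X) (u' : ℝ → U), IsAdmissible T B per y' u' →
      cost C Q yd ud per y u ≤ cost C Q yd ud per y' u'

/-- `(y, l, u)` is a periodic extremal triple: a solution, in the mild sense on `[0, per]`, of
`y' = A y + B Q⁻¹ B^* l + B u_d`, `l' = C^* C y - A^* l - C^* C y_d`,
`y 0 = y per`, `l 0 = l per`, together with `u = u_d + Q⁻¹ B^* l` a.e.
(`A^*` generates the adjoint semigroup `(T t)^*`). -/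
structure IsExtremal (T : ℝ → X →L[ℝ] X) (B : U →L[ℝ] X) (C : X →L[ℝ] V) (Q : U →L[ℝ] U)
    (yd : ℝ → X) (ud : ℝ → U) (per : ℝ) (y l : ℝ → X) (u : ℝ → U) : Prop where
  state_continuousOn : ContinuousOn y (Icc 0 per)
  costate_continuousOn : ContinuousOn l (Icc 0 per)
  state_mild : IsMildSolution T (fun s => BQB B Q (l s) + B (ud s)) per y
  state_periodic : y 0 = y per
  costate_mild : IsBackwardMildSolution (fun t => ContinuousLinearMap.adjoint (T t))
    (fun s => CC C (y s) - CC C (yd s)) per l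
  costate_periodic : l 0 = l per
  control : ∀ᵐ t ∂(volume.restrict (Icc 0 per)),
    u t = ud t + Ring.inverse Q (ContinuousLinearMap.adjoint B (l t))

/-- `P` is a nonnegative self-adjoint bounded solution of the algebraic Riccati equation
`A^* P + P A - P B Q⁻¹ B^* P + C^* C = 0` on `D(A)`: for `x ∈ D(A)`, one has `P x ∈ D(A^*)` and
the equation holds at `x`. -/
structure IsRiccatiSolution (A : X →ₗ.[ℝ] X) (B : U →L[ℝ] X) (C : X →L[ℝ] V) (Q : U →L[ℝ] U)
    (P : X →L[ℝ] X) : Prop where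
  isPositive : P.IsPositive
  equation : ∀ x : A.domain, ∃ h : P x ∈ A.adjoint.domain,
    A.adjoint ⟨P x, h⟩ + P (A x) - P (BQB B Q (P x)) + CC C x = 0

/-- The closed-loop operator `A - B Q⁻¹ B^* P`, with domain `D(A)`. -/
def closedLoop (A : X →ₗ.[ℝ] X) (B : U →L[ℝ] X) (Q : U →L[ℝ] U) (P : X →L[ℝ] X) :
    X →ₗ.[ℝ] X :=
  boundedPerturbation A (-(BQB B Q ∘L P))

/-- `E = -∫₀^∞ S(t) B Q⁻¹ B^* S(t)^* dt`, as a (convergent) strong operator integral. -/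
def IsLyapunovIntegral (S : ℝ → X →L[ℝ] X) (B : U →L[ℝ] X) (Q : U →L[ℝ] U)
    (E : X →L[ℝ] X) : Prop :=
  ∀ x : X,
    IntegrableOn (fun t => S t (BQB B Q (ContinuousLinearMap.adjoint (S t) x))) (Ioi 0) ∧
    E x = -∫ t in Ioi (0 : ℝ), S t (BQB B Q (ContinuousLinearMap.adjoint (S t) x))

/-- The forcing term `(I + E P) B u_d - E C^* C y_d` of the forward trajectory. -/
def zForcing (B : U →L[ℝ] X) (C : X →L[ℝ] V) (P E : X →L[ℝ] X) (yd : ℝ → X) (ud : ℝ → U)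
    (r : ℝ) : X :=
  (1 + E ∘L P) (B (ud r)) - E (CC C (yd r))

/-- The forcing term `-P B u_d(per - ·) + C^* C y_d(per - ·)` of the backward trajectory. -/
def qForcing (B : U →L[ℝ] X) (C : X →L[ℝ] V) (P : X →L[ℝ] X) (yd : ℝ → X) (ud : ℝ → U)
    (per r : ℝ) : X :=
  -P (B (ud (per - r))) + CC C (yd (per - r))

/-- The explicit trajectory `z`. -/
def zTraj (S : ℝ → X →L[ℝ] X) (B : U →L[ℝ] X) (C : X →L[ℝ] V) (P E : X →L[ℝ] X)
    (yd : ℝ → X) (ud : ℝ → U) (per t : ℝ) : X :=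
  S t (Ring.inverse (1 - S per)
      (∫ r in (0 : ℝ)..per, S (per - r) (zForcing B C P E yd ud r)))
    + ∫ r in (0 : ℝ)..t, S (t - r) (zForcing B C P E yd ud r)

/-- The explicit trajectory `q`. -/
def qTraj (S : ℝ → X →L[ℝ] X) (B : U →L[ℝ] X) (C : X →L[ℝ] V) (P : X →L[ℝ] X)
    (yd : ℝ → X) (ud : ℝ → U) (per t : ℝ) : X :=
  ContinuousLinearMap.adjoint (S (per - t))
      (Ring.inverse (1 - ContinuousLinearMap.adjoint (S per))
        (∫ r in (0 : ℝ)..per,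
          ContinuousLinearMap.adjoint (S (per - r)) (qForcing B C P yd ud per r)))
    + ∫ r in (0 : ℝ)..(per - t),
        ContinuousLinearMap.adjoint (S (per - t - r)) (qForcing B C P yd ud per r)

end Problem

end LQPeriodic

end

open LQPeriodic

/-! Write W for BQ⁻¹B^*. The extremal system couples a forward equation for the state y to a
backward equation for the costate l, and two changes of unknown decouple it. If P solves the Riccati
equation, then q = l + P y obeys a backward equation driven by the adjoint of the closed loop A - W
P, with a source free of y. If E solves the Lyapunov equation of the closed loop, then z = y + E q
obeys a forward equation driven by A - W P, with a source free of q. The closed loop is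
exponentially stable, so 1 - S(per) is invertible and each equation has an explicit periodic
solution; undoing the substitutions gives the extremal triple (`isMildSolution_state`,
`isBackwardMildSolution_costate`).

Existence of P comes from the Newton-Kleinman iteration. Stabilizability supplies a solution of the
Riccati inequality (`exists_riccatiSuper`). Each step solves the Lyapunov equation of the current
closed loop (`exists_kleinman_step`), whose stability follows from detectability and Datko's theorem
(`expDecay_of_detectable`, `expDecay_of_integral_le`). The iterates decrease, hence converge
strongly, and the quadratic residual disappears in the limit. Uniqueness holds because the
difference of two solutions satisfies a homogeneous Sylvester equation between two stable closed
loops (`riccati_unique`).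

For uniqueness of the triple, pair the difference of two states with that of the costates.
Periodicity cancels the boundary terms and leaves B^*l = 0 and C y = 0, so both differences are free
periodic trajectories. Detectability kills one, stabilizability the other
(`eq_zero_of_homogeneous`). Optimality and its uniqueness come from the exact second-order expansion
of the cost around the extremal pair (`IsExtremal.cost_eq`).

Mild solutions need not be differentiable, so every differential identity is used in integrated
form. The common tool is the product rule `IsMildSolution.transport`, proved by Fubini; changing the
semigroup, applying P or E to a trajectory, and duality are three instances of it. Operator
equations are likewise tested weakly on generator domains (`IsSylvester`), which keeps the domain of
A^* out of the computations. -/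

namespace LQPeriodic

/-! ### Strongly continuous families, convolutions and mild solutions -/

section Basics

variable {X Y Z : Type*}
  [NormedAddCommGroup X] [InnerProductSpace ℝ X]
  [NormedAddCommGroup Y] [NormedSpace ℝ Y]
  [NormedAddCommGroup Z] [NormedSpace ℝ Z]

/-- A family of operators that is bounded on compact intervals and strongly continuous is jointly
continuous. -/
theorem continuous_uncurry_of_strong {G : ℝ → X →L[ℝ] Z}
    (hG : ∀ x, Continuous fun t => G t x)
    (hb : ∀ b : ℝ, ∃ M, ∀ t, |t| ≤ b → ‖G t‖ ≤ M) :
    Continuous fun p : ℝ × X => G p.1 p.2 := by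
  rw [continuous_iff_continuousAt]
  rintro ⟨t₀, x₀⟩
  obtain ⟨M, hM⟩ := hb (|t₀| + 1)
  have h1 : Tendsto (fun p : ℝ × X => G p.1 x₀) (𝓝 (t₀, x₀)) (𝓝 (G t₀ x₀)) :=
    ((hG x₀).comp continuous_fst).continuousAt
  have h2 : Tendsto (fun p : ℝ × X => G p.1 (p.2 - x₀)) (𝓝 (t₀, x₀)) (𝓝 0) := by
    have h3 : Tendsto (fun p : ℝ × X => M * ‖p.2 - x₀‖) (𝓝 (t₀, x₀)) (𝓝 0) := by
      have : Continuous fun p : ℝ × X => M * ‖p.2 - x₀‖ := by fun_prop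
      simpa using this.tendsto (t₀, x₀)
    refine squeeze_zero_norm' ?_ h3
    have : ∀ᶠ p : ℝ × X in 𝓝 (t₀, x₀), |p.1| < |t₀| + 1 := by
      have : Continuous fun p : ℝ × X => |p.1| := by fun_prop
      exact this.continuousAt.eventually_lt continuousAt_const (by simp)
    filter_upwards [this] with p hp
    exact (G p.1).le_of_opNorm_le (hM _ hp.le) _
  have := h1.add h2
  simp only [add_zero] at this
  refine this.congr fun p => ?_
  simp [map_sub]

variable [CompleteSpace X]

theorem IsC0Semigroup.exists_bound {T : ℝ → X →L[ℝ] X}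
    (h0 : ∀ x : X, ContinuousOn (fun t => T t x) (Ici 0)) (b : ℝ) :
    ∃ M, 0 < M ∧ ∀ t, 0 ≤ t → t ≤ b → ‖T t‖ ≤ M := by
  have : ∃ C', ∀ i : Icc (0 : ℝ) b, ‖T i‖ ≤ C' := by
    refine banach_steinhaus fun x => ?_
    obtain ⟨C, hC⟩ := isCompact_Icc.exists_bound_of_continuousOn
      ((h0 x).mono (Icc_subset_Ici_self : Icc 0 b ⊆ Ici 0))
    exact ⟨C, fun i => hC i i.2⟩
  obtain ⟨M, hM⟩ := this
  exact ⟨max M 1, by positivity, fun t h1 h2 => (hM ⟨t, h1, h2⟩).trans (le_max_left _ _)⟩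

/-- Extension of a semigroup to negative times by the identity. -/
def ext0 (T : ℝ → X →L[ℝ] X) (t : ℝ) : X →L[ℝ] X := T (max t 0)

omit [CompleteSpace X] in
theorem ext0_of_nonneg {T : ℝ → X →L[ℝ] X} {t : ℝ} (ht : 0 ≤ t) : ext0 T t = T t := by
  simp [ext0, ht]

theorem continuous_ext0 {T : ℝ → X →L[ℝ] X}
    (h0 : ∀ x : X, ContinuousOn (fun t => T t x) (Ici 0)) :
    Continuous fun p : ℝ × X => ext0 T p.1 p.2 := by
  refine continuous_uncurry_of_strong (fun x => ?_) fun b => ?_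
  · exact (h0 x).comp_continuous (by fun_prop) (by simp)
  · obtain ⟨M, -, hM⟩ := IsC0Semigroup.exists_bound h0 (max b 0)
    exact ⟨M, fun t ht => hM _ (by simp) (max_le_max ((le_abs_self t).trans ht) le_rfl)⟩

/-- Joint continuity along continuous curves, for nonnegative times. -/
theorem continuousOn_apply {T : ℝ → X →L[ℝ] X}
    (h0 : ∀ x : X, ContinuousOn (fun t => T t x) (Ici 0)) {α : Type*} [TopologicalSpace α]
    {s : Set α} {a : α → ℝ} {v : α → X} (ha : ContinuousOn a s) (hv : ContinuousOn v s)
    (hpos : ∀ p ∈ s, 0 ≤ a p) : ContinuousOn (fun p => T (a p) (v p)) s := by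
  have := (continuous_ext0 h0).comp_continuousOn (ha.prodMk hv)
  refine this.congr fun p hp => ?_
  simp [ext0_of_nonneg (hpos p hp)]

namespace IsC0Semigroup

variable {T : ℝ → X →L[ℝ] X}

theorem norm_growth (hT : IsC0Semigroup T) :
    ∃ M ω : ℝ, 0 < M ∧ 0 ≤ ω ∧ ∀ t, 0 ≤ t → ‖T t‖ ≤ M * Real.exp (ω * t) := by
  obtain ⟨M₀, -, hM₀⟩ := exists_bound hT.continuousOn 1
  set M := max M₀ 1 with hM
  have hM1 : 1 ≤ M := le_max_right _ _
  have hb : ∀ t, 0 ≤ t → t ≤ 1 → ‖T t‖ ≤ M := fun t h1 h2 => (hM₀ t h1 h2).trans (le_max_left _ _)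
  have key : ∀ n : ℕ, ∀ t : ℝ, 0 ≤ t → t ≤ n + 1 → ‖T t‖ ≤ M ^ (n + 1) := by
    intro n
    induction n with
    | zero => intro t h1 h2; simpa using hb t h1 (by simpa using h2)
    | succ n ih =>
      intro t h1 h2
      push_cast at h2
      rcases le_total t 1 with h | h
      · exact (hb t h1 h).trans (le_self_pow₀ hM1 (by omega))
      · have : T t = T 1 ∘L T (t - 1) := by
          rw [← hT.map_add 1 (t - 1) zero_le_one (by linarith)]; congr 1; ring
        rw [this, pow_succ']
        refine (ContinuousLinearMap.opNorm_comp_le _ _).trans ?_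
        gcongr
        · exact hb 1 zero_le_one le_rfl
        · exact ih _ (by linarith) (by linarith)
  refine ⟨M, Real.log M, by positivity, Real.log_nonneg hM1, fun t ht => ?_⟩
  have h1 := key ⌊t⌋₊ t ht (Nat.lt_floor_add_one t).le
  refine h1.trans ?_
  rw [pow_succ', ← Real.rpow_natCast, ← Real.rpow_def_of_pos (by positivity)]
  gcongr
  · exact Nat.floor_le ht

end IsC0Semigroup

/-- Joint continuity gives measurability even though `f` is only integrable, and the uniform
boundedness principle on the compact set gives the dominating function. -/
theorem integrableOn_apply_family {α : Type*} [TopologicalSpace α] [MeasurableSpace α]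
    [SecondCountableTopology α] [TopologicalSpace.PseudoMetrizableSpace α] [BorelSpace α]
    {μ : Measure α} {K : Set α} (hK : IsCompact K) (hKm : MeasurableSet K) {G : α → X →L[ℝ] Z}
    (hG : Continuous fun p : α × X => G p.1 p.2) {f : α → X} (hf : IntegrableOn f K μ) :
    IntegrableOn (fun a => G a (f a)) K μ := by
  obtain ⟨M, hM⟩ : ∃ C', ∀ i : K, ‖G i‖ ≤ C' := by
    refine banach_steinhaus fun x => ?_
    obtain ⟨C, hC⟩ := hK.exists_bound_of_continuousOn
      (f := fun a => G a x) (hG.comp (by fun_prop : Continuous fun a : α => (a, x))).continuousOn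
    exact ⟨C, fun i => hC i i.2⟩
  refine Integrable.mono' (hf.norm.const_mul M) ?_ ?_
  · exact hG.comp_aestronglyMeasurable (aestronglyMeasurable_id.prodMk hf.aestronglyMeasurable)
  · filter_upwards [ae_restrict_mem hKm] with a ha
    exact (G a).le_of_opNorm_le (hM ⟨a, ha⟩) _

theorem intervalIntegrable_apply_family {G : ℝ → X →L[ℝ] Z}
    (hG : Continuous fun p : ℝ × X => G p.1 p.2) {f : ℝ → X} {a b : ℝ}
    (hf : IntervalIntegrable f volume a b) :
    IntervalIntegrable (fun s => G s (f s)) volume a b := by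
  rw [intervalIntegrable_iff, uIoc, ← integrableOn_Icc_iff_integrableOn_Ioc] at hf ⊢
  exact integrableOn_apply_family isCompact_Icc measurableSet_Icc hG hf

namespace IsC0Semigroup

variable {T : ℝ → X →L[ℝ] X}

theorem continuous_ext0 (hT : IsC0Semigroup T) :
    Continuous fun p : ℝ × X => ext0 T p.1 p.2 := LQPeriodic.continuous_ext0 hT.continuousOn

theorem continuous_ext0_sub (hT : IsC0Semigroup T) (t : ℝ) :
    Continuous fun p : ℝ × X => ext0 T (t - p.1) p.2 :=
  hT.continuous_ext0.comp (by fun_prop : Continuous fun p : ℝ × X => (t - p.1, p.2))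

theorem intervalIntegrable_conv (hT : IsC0Semigroup T) {f : ℝ → X} {a t : ℝ} (hat : a ≤ t)
    (hf : IntervalIntegrable f volume a t) :
    IntervalIntegrable (fun s => T (t - s) (f s)) volume a t := by
  refine (intervalIntegrable_apply_family (G := fun s => ext0 T (t - s)) (hT.continuous_ext0_sub t) hf).congr ?_
  intro s hs
  rw [uIoc_of_le hat] at hs
  simp [ext0_of_nonneg (sub_nonneg.2 hs.2)]

/-- The convolution of a semigroup with an integrable forcing term is continuous. -/
theorem continuousOn_conv (hT : IsC0Semigroup T) {f : ℝ → X} {b : ℝ}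
    (hf : IntervalIntegrable f volume 0 b) :
    ContinuousOn (fun t => ∫ s in (0 : ℝ)..t, T (t - s) (f s)) (Icc 0 b) := by
  intro t₀ ht₀
  have hb : 0 ≤ b := ht₀.1.trans ht₀.2
  rw [intervalIntegrable_iff_integrableOn_Ioc_of_le hb] at hf
  let F : ℝ → ℝ → X := fun t s => (Iic t).indicator (fun s => ext0 T (t - s) (f s)) s
  have hF : ∀ t ∈ Icc 0 b, ∫ s in (0 : ℝ)..t, T (t - s) (f s) = ∫ s in Ioc 0 b, F t s := by
    intro t ht
    rw [intervalIntegral.integral_of_le ht.1, setIntegral_indicator measurableSet_Iic]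
    have : Ioc 0 b ∩ Iic t = Ioc 0 t := by
      ext s; simp only [mem_inter_iff, mem_Ioc, mem_Iic]
      exact ⟨fun h => ⟨h.1.1, h.2⟩, fun h => ⟨⟨h.1, h.2.trans ht.2⟩, h.2⟩⟩
    rw [this]
    refine setIntegral_congr_fun measurableSet_Ioc fun s hs => ?_
    simp [ext0_of_nonneg (sub_nonneg.2 hs.2)]
  refine ContinuousWithinAt.congr (f := fun t => ∫ s in Ioc 0 b, F t s) ?_ hF (hF _ ht₀)
  refine ContinuousAt.continuousWithinAt ?_
  obtain ⟨M, hM0, hM⟩ := exists_bound hT.continuousOn (t₀ + 1)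
  refine continuousAt_of_dominated (bound := fun s => M * ‖f s‖) ?_ ?_ (hf.norm.const_mul M) ?_
  · refine Eventually.of_forall fun t => ?_
    refine AEStronglyMeasurable.indicator ?_ measurableSet_Iic
    exact (hT.continuous_ext0_sub t).comp_aestronglyMeasurable
      (aestronglyMeasurable_id.prodMk hf.aestronglyMeasurable)
  · filter_upwards [gt_mem_nhds (show t₀ < t₀ + 1 by linarith)] with t ht
    filter_upwards [ae_restrict_mem measurableSet_Ioc] with s hs
    refine (norm_indicator_le_norm_self _ _).trans ((ext0 T (t - s)).le_of_opNorm_le ?_ _)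
    exact hM _ (by simp) (max_le (by linarith [hs.1]) (by linarith [ht₀.1]))
  · have : ∀ᵐ s ∂(volume.restrict (Ioc 0 b)), s ≠ t₀ :=
      ae_restrict_of_ae (by simp [ae_iff, measure_singleton])
    filter_upwards [this] with s hs
    have hc : ContinuousAt (fun t => ext0 T (t - s) (f s)) t₀ :=
      (hT.continuous_ext0.comp (by fun_prop : Continuous fun t : ℝ => (t - s, f s))).continuousAt
    rcases lt_or_gt_of_ne hs with h | h
    · refine hc.congr ?_
      filter_upwards [lt_mem_nhds h] with t ht
      simp [F, ht.le]
    · refine (continuousAt_const (y := (0 : X))).congr ?_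
      filter_upwards [gt_mem_nhds h] with t ht
      simp [F, ht]

end IsC0Semigroup

theorem IsMildSolution.continuousOn {T : ℝ → X →L[ℝ] X} (hT : IsC0Semigroup T) {f y : ℝ → X}
    {b : ℝ} (hf : IntervalIntegrable f volume 0 b) (hy : IsMildSolution T f b y) :
    ContinuousOn y (Icc 0 b) := by
  refine ContinuousOn.congr (f := fun t => T t (y 0) + ∫ s in (0 : ℝ)..t, T (t - s) (f s)) ?_ hy
  exact ((hT.continuousOn _).mono Icc_subset_Ici_self).add (hT.continuousOn_conv hf)

/-- Restarting a mild solution at a later time. -/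
theorem IsMildSolution.restart {T : ℝ → X →L[ℝ] X} (hT : IsC0Semigroup T) {f y : ℝ → X}
    {b : ℝ} (hf : IntervalIntegrable f volume 0 b) (hy : IsMildSolution T f b y) {τ : ℝ}
    (h0 : 0 ≤ τ) (hτ : τ ≤ b) :
    IsMildSolution T (fun s => f (τ + s)) (b - τ) (fun s => y (τ + s)) := by
  intro t ht
  have ht2 : τ + t ≤ b := by linarith [ht.2]
  have hsub : ∀ {c d : ℝ}, 0 ≤ c → c ≤ d → d ≤ b → IntervalIntegrable f volume c d := by
    intro c d hc hcd hd
    refine hf.mono_set ?_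
    rw [uIcc_of_le hcd, uIcc_of_le (hc.trans (hcd.trans hd))]
    exact Icc_subset_Icc hc hd
  have hI : IntervalIntegrable (fun s => T (τ + t - s) (f s)) volume 0 (τ + t) :=
    hT.intervalIntegrable_conv (by linarith [ht.1]) (hsub le_rfl (by linarith [ht.1]) ht2)
  have e1 : ∫ s in (0 : ℝ)..t, T (t - s) (f (τ + s)) = ∫ s in τ..(τ + t), T (τ + t - s) (f s) := by
    have := intervalIntegral.integral_comp_add_left (a := 0) (b := t)
      (fun s => T (τ + t - s) (f s)) τ
    simp only [add_zero] at this
    rw [← this]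
    refine intervalIntegral.integral_congr fun s _ => ?_
    congr 2; ring
  have e2 : ∫ s in (0 : ℝ)..τ, T (τ + t - s) (f s) = T t (∫ s in (0 : ℝ)..τ, T (τ - s) (f s)) := by
    rw [← ContinuousLinearMap.intervalIntegral_comp_comm _
      (hT.intervalIntegrable_conv h0 (hsub le_rfl h0 hτ))]
    refine intervalIntegral.integral_congr fun s hs => ?_
    rw [uIcc_of_le h0] at hs
    rw [show τ + t - s = t + (τ - s) by ring, hT.map_add _ _ ht.1 (sub_nonneg.2 hs.2)]
    rfl
  have e3 : ∫ s in (0 : ℝ)..(τ + t), T (τ + t - s) (f s) =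
      (∫ s in (0 : ℝ)..τ, T (τ + t - s) (f s)) + ∫ s in τ..(τ + t), T (τ + t - s) (f s) := by
    rw [intervalIntegral.integral_add_adjacent_intervals]
    · refine hI.mono_set ?_
      rw [uIcc_of_le h0, uIcc_of_le (by linarith [ht.1])]
      exact Icc_subset_Icc le_rfl (by linarith [ht.1])
    · refine hI.mono_set ?_
      rw [uIcc_of_le (by linarith [ht.1]), uIcc_of_le (by linarith [ht.1])]
      exact Icc_subset_Icc h0 le_rfl
  simp only [add_zero]
  rw [hy (τ + t) ⟨by linarith [ht.1], ht2⟩, hy τ ⟨h0, hτ⟩, e1, e3, e2, map_add,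
    add_comm τ t, hT.map_add t τ ht.1 h0, ContinuousLinearMap.comp_apply]
  abel

/-- A product rule for mild solutions, in integrated form. -/
theorem IsMildSolution.transport [CompleteSpace Z] {T : ℝ → X →L[ℝ] X} (hT : IsC0Semigroup T)
    {f y : ℝ → X} {b : ℝ} (hb : 0 ≤ b) (hf : IntervalIntegrable f volume 0 b)
    (hy : IsMildSolution T f b y) {G N : ℝ → X →L[ℝ] Z}
    (hG : Continuous fun p : ℝ × X => G p.1 p.2) (hN : Continuous fun p : ℝ × X => N p.1 p.2)
    (hrel : ∀ s ∈ Icc 0 b, ∀ x, G b (T (b - s) x) = G s x + ∫ r in s..b, N r (T (r - s) x)) :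
    G b (y b) = G 0 (y 0) + ∫ s in (0 : ℝ)..b, (G s (f s) + N s (y s)) := by
  have hfI := (intervalIntegrable_iff_integrableOn_Ioc_of_le hb).1 hf
  have hIc := hT.intervalIntegrable_conv hb hf
  have hGf : IntervalIntegrable (fun s => G s (f s)) volume 0 b :=
    intervalIntegrable_apply_family hG hf
  -- Formally `hrel` says N = G' + G A, so that (G y)' = G f + N y. The rigorous version inserts the
  -- mild formula for y and exchanges the two integrals over the triangle s ≤ r, encoded here by an
  -- indicator on the square.
  let F : ℝ → ℝ → Z := fun s r => (Ici s).indicator (fun r => N r (ext0 T (r - s) (f s))) r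
  -- integrability on the square
  have hsq : Integrable (Function.uncurry F)
      ((volume.restrict (Ioc 0 b)).prod (volume.restrict (Ioc 0 b))) := by
    have h1 : IntegrableOn (fun p : ℝ × ℝ => f p.1) (Icc 0 b ×ˢ Icc 0 b) (volume.prod volume) := by
      rw [IntegrableOn, ← Measure.prod_restrict]
      refine Integrable.comp_fst ?_ _
      exact integrableOn_Icc_iff_integrableOn_Ioc (by simp) |>.2 hfI
    have h2 : IntegrableOn (fun p : ℝ × ℝ => N p.2 (ext0 T (p.2 - p.1) (f p.1)))
        (Icc 0 b ×ˢ Icc 0 b) (volume.prod volume) := by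
      refine integrableOn_apply_family (G := fun p : ℝ × ℝ => N p.2 ∘L ext0 T (p.2 - p.1))
        (isCompact_Icc.prod isCompact_Icc) (measurableSet_Icc.prod measurableSet_Icc) ?_ h1
      have h3 : Continuous fun p : (ℝ × ℝ) × X => ext0 T (p.1.2 - p.1.1) p.2 :=
        hT.continuous_ext0.comp
          (by fun_prop : Continuous fun p : (ℝ × ℝ) × X => (p.1.2 - p.1.1, p.2))
      exact hN.comp ((by fun_prop : Continuous fun p : (ℝ × ℝ) × X => p.1.2).prodMk h3)
    rw [Measure.prod_restrict]
    have h4 := (h2.mono_set (prod_mono Ioc_subset_Icc_self Ioc_subset_Icc_self)).indicator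
      (measurableSet_le measurable_fst measurable_snd)
    refine h4.congr (Eventually.of_forall fun p => ?_)
    by_cases h : p.1 ≤ p.2 <;> simp [F, Function.uncurry, indicator, h]
  have hsw := integral_integral_swap hsq
  have inner1 : ∀ s ∈ Ioc 0 b, ∫ r in Ioc 0 b, F s r = ∫ r in s..b, N r (T (r - s) (f s)) := by
    intro s hs
    rw [intervalIntegral.integral_of_le hs.2, setIntegral_indicator measurableSet_Ici,
      ← integral_Icc_eq_integral_Ioc]
    have : Ioc 0 b ∩ Ici s = Icc s b := by
      ext r; simp only [mem_inter_iff, mem_Ioc, mem_Ici, mem_Icc]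
      exact ⟨fun h => ⟨h.2, h.1.2⟩, fun h => ⟨⟨hs.1.trans_le h.1, h.2⟩, h.1⟩⟩
    rw [this]
    refine setIntegral_congr_fun measurableSet_Icc fun r hr => ?_
    simp [ext0_of_nonneg (sub_nonneg.2 hr.1)]
  have inner2 : ∀ r ∈ Ioc 0 b, ∫ s in Ioc 0 b, F s r =
      N r (∫ s in (0 : ℝ)..r, T (r - s) (f s)) := by
    intro r hr
    have hfr : IntervalIntegrable f volume 0 r := by
      refine hf.mono_set ?_
      rw [uIcc_of_le hr.1.le, uIcc_of_le hb]
      exact Icc_subset_Icc le_rfl hr.2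
    rw [← ContinuousLinearMap.intervalIntegral_comp_comm _
      (hT.intervalIntegrable_conv hr.1.le hfr), intervalIntegral.integral_of_le hr.1.le]
    have h1 : ∀ s, F s r = (Iic r).indicator (fun s => N r (ext0 T (r - s) (f s))) s := by
      intro s; by_cases h : s ≤ r <;> simp [F, indicator, h]
    simp_rw [h1]
    rw [setIntegral_indicator measurableSet_Iic]
    have : Ioc 0 b ∩ Iic r = Ioc 0 r := by
      ext s; simp only [mem_inter_iff, mem_Ioc, mem_Iic]
      exact ⟨fun h => ⟨h.1.1, h.2⟩, fun h => ⟨⟨h.1, h.2.trans hr.2⟩, h.2⟩⟩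
    rw [this]
    refine setIntegral_congr_fun measurableSet_Ioc fun s hs => ?_
    simp [ext0_of_nonneg (sub_nonneg.2 hs.2)]
  rw [setIntegral_congr_fun measurableSet_Ioc inner1,
    setIntegral_congr_fun measurableSet_Ioc inner2, ← intervalIntegral.integral_of_le hb,
    ← intervalIntegral.integral_of_le hb] at hsw
  have hint1 : IntervalIntegrable (fun s => ∫ r in s..b, N r (T (r - s) (f s))) volume 0 b := by
    rw [intervalIntegrable_iff_integrableOn_Ioc_of_le hb]
    exact IntegrableOn.congr_fun hsq.integral_prod_left inner1 measurableSet_Ioc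
  have hyc := hy.continuousOn hT hf
  have hTy : ContinuousOn (fun s => N s (T s (y 0))) (Icc 0 b) :=
    hN.comp_continuousOn (continuousOn_id.prodMk ((hT.continuousOn _).mono Icc_subset_Ici_self))
  have hconv : ContinuousOn (fun r => N r (∫ s in (0 : ℝ)..r, T (r - s) (f s))) (Icc 0 b) :=
    hN.comp_continuousOn (continuousOn_id.prodMk (hT.continuousOn_conv hf))
  have hNy : IntervalIntegrable (fun s => N s (y s)) volume 0 b :=
    ContinuousOn.intervalIntegrable_of_Icc hb (hN.comp_continuousOn (continuousOn_id.prodMk hyc))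
  calc G b (y b) = G b (T b (y 0)) + ∫ s in (0 : ℝ)..b, G b (T (b - s) (f s)) := by
        rw [hy b ⟨hb, le_rfl⟩, map_add, ContinuousLinearMap.intervalIntegral_comp_comm _ hIc]
    _ = (G 0 (y 0) + ∫ r in (0 : ℝ)..b, N r (T r (y 0))) +
        ∫ s in (0 : ℝ)..b, (G s (f s) + ∫ r in s..b, N r (T (r - s) (f s))) := by
        congr 1
        · have := hrel 0 ⟨le_rfl, hb⟩ (y 0)
          simpa using this
        · refine intervalIntegral.integral_congr fun s hs => ?_
          rw [uIcc_of_le hb] at hs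
          exact hrel s hs _
    _ = G 0 (y 0) + ((∫ s in (0 : ℝ)..b, G s (f s)) + ∫ r in (0 : ℝ)..b, N r (y r)) := by
        rw [intervalIntegral.integral_add hGf hint1, hsw]
        have : ∫ r in (0 : ℝ)..b, N r (y r) = (∫ r in (0 : ℝ)..b, N r (T r (y 0))) +
            ∫ r in (0 : ℝ)..b, N r (∫ s in (0 : ℝ)..r, T (r - s) (f s)) := by
          rw [← intervalIntegral.integral_add (hTy.intervalIntegrable_of_Icc hb)
            (hconv.intervalIntegrable_of_Icc hb)]
          refine intervalIntegral.integral_congr fun r hr => ?_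
          rw [uIcc_of_le hb] at hr
          rw [hy r hr, map_add]
        rw [this]; abel
    _ = _ := by rw [intervalIntegral.integral_add hGf hNy]

end Basics

open ContinuousLinearMap (adjoint)
open scoped InnerProductSpace

set_option linter.unusedSectionVars false

/-! ### Generators, adjoint semigroups and the variation of constants formula -/

section Generators

variable {X Y Z : Type*}
  [NormedAddCommGroup X] [InnerProductSpace ℝ X]
  [NormedAddCommGroup Y] [InnerProductSpace ℝ Y]
  [NormedAddCommGroup Z] [NormedSpace ℝ Z]

/-- A strong integral of operators with integrable norms defines a bounded operator. -/
theorem exists_clm_integral {α : Type*} [MeasurableSpace α] {μ : Measure α}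
    {G : α → X →L[ℝ] Z} (hm : ∀ x, AEStronglyMeasurable (fun a => G a x) μ) {g : α → ℝ}
    (hg : Integrable g μ) (hb : ∀ᵐ a ∂μ, ‖G a‖ ≤ g a) :
    ∃ L : X →L[ℝ] Z, (∀ x, Integrable (fun a => G a x) μ) ∧ (∀ x, L x = ∫ a, G a x ∂μ) ∧
      ‖L‖ ≤ ∫ a, g a ∂μ := by
  have hI : ∀ x, Integrable (fun a => G a x) μ := fun x =>
    (hg.mul_const ‖x‖).mono' (hm x) (hb.mono fun a ha => (G a).le_of_opNorm_le ha x)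
  have hg0 : 0 ≤ ∫ a, g a ∂μ :=
    integral_nonneg_of_ae (hb.mono fun a ha => (norm_nonneg _).trans ha)
  let L₀ : X →ₗ[ℝ] Z :=
    { toFun := fun x => ∫ a, G a x ∂μ
      map_add' := fun x y => by simp only [map_add]; exact integral_add (hI x) (hI y)
      map_smul' := fun c x => by simp only [map_smul, RingHom.id_apply]; exact integral_smul c _ }
  have hL : ∀ x, ‖L₀ x‖ ≤ (∫ a, g a ∂μ) * ‖x‖ := by
    intro x
    rw [← integral_mul_const]
    exact norm_integral_le_of_norm_le (hg.mul_const _)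
      (hb.mono fun a ha => (G a).le_of_opNorm_le ha x)
  exact ⟨L₀.mkContinuous _ hL, hI, fun x => rfl, L₀.mkContinuous_norm_le hg0 hL⟩

theorem hasDerivWithinAt_Ioi_iff {f : ℝ → Z} {f' : Z} {t : ℝ} :
    HasDerivWithinAt f f' (Ioi t) t ↔
      Tendsto (fun h : ℝ => h⁻¹ • (f (t + h) - f t)) (𝓝[>] 0) (𝓝 f') := by
  rw [hasDerivWithinAt_iff_tendsto_slope' (by simp)]
  have h1 : 𝓝[>] t = map (fun h => t + h) (𝓝[>] 0) := by simp [map_add_left_nhdsGT]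
  rw [h1, tendsto_map'_iff]
  refine tendsto_congr fun h => ?_
  simp [slope_def_module]

/-- The integrand may vary with the length of the interval; this is needed for the Duhamel term,
whose integrand T(t - s) K S(s) x contains t. -/
theorem tendsto_average_zero [CompleteSpace Z] {g : ℝ → ℝ → Z} {z : Z}
    (hg : ∀ ε > 0, ∃ δ > 0, ∀ h s, 0 ≤ s → s ≤ h → h < δ → ‖g h s - z‖ ≤ ε)
    (hi : ∀ h, 0 ≤ h → IntervalIntegrable (g h) volume 0 h) :
    Tendsto (fun h : ℝ => h⁻¹ • ∫ s in (0 : ℝ)..h, g h s) (𝓝[>] 0) (𝓝 z) := by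
  rw [Metric.tendsto_nhds]
  intro ε hε
  obtain ⟨δ, hδ, H⟩ := hg (ε / 2) (by positivity)
  have : Ioo (0 : ℝ) δ ∈ 𝓝[>] (0 : ℝ) := Ioo_mem_nhdsGT hδ
  filter_upwards [this] with h hh
  have e : h⁻¹ • (∫ s in (0 : ℝ)..h, g h s) - z = h⁻¹ • ∫ s in (0 : ℝ)..h, (g h s - z) := by
    rw [intervalIntegral.integral_sub (hi h hh.1.le) (by simp), smul_sub]
    simp [smul_smul, hh.1.ne']
  rw [dist_eq_norm, e, norm_smul, norm_inv, Real.norm_of_nonneg hh.1.le]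
  have : ‖∫ s in (0 : ℝ)..h, (g h s - z)‖ ≤ ε / 2 * |h - 0| := by
    refine intervalIntegral.norm_integral_le_of_norm_le_const fun s hs => ?_
    rw [uIoc_of_le hh.1.le] at hs
    exact H h s hs.1.le hs.2 hh.2
  rw [sub_zero, abs_of_pos hh.1] at this
  calc h⁻¹ * _ ≤ h⁻¹ * (ε / 2 * h) := by gcongr; exact inv_nonneg.2 hh.1.le
    _ = ε / 2 := by field_simp [hh.1.ne']
    _ < ε := by linarith

theorem tendsto_average [CompleteSpace Z] {g : ℝ → Z} (hg : ContinuousOn g (Ici 0)) :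
    Tendsto (fun h : ℝ => h⁻¹ • ∫ s in (0 : ℝ)..h, g s) (𝓝[>] 0) (𝓝 (g 0)) := by
  refine tendsto_average_zero (g := fun _ => g) (fun ε hε => ?_) fun h hh =>
    (hg.mono Icc_subset_Ici_self).intervalIntegrable_of_Icc hh
  obtain ⟨δ, hδ, H⟩ := Metric.continuousWithinAt_iff.1 (hg 0 self_mem_Ici) ε hε
  refine ⟨δ, hδ, fun h s h0 hs hh => ?_⟩
  rw [← dist_eq_norm]
  refine (H h0 ?_).le
  rw [Real.dist_eq, sub_zero, abs_of_nonneg h0]; exact hs.trans_lt hh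

/-- `x` belongs to the domain of the generator of `T`, which maps it to `y`. -/
def Gen (T : ℝ → X →L[ℝ] X) (x y : X) : Prop :=
  Tendsto (fun t : ℝ => t⁻¹ • (T t x - x)) (𝓝[>] 0) (𝓝 y)

theorem inner_intervalIntegral_left [CompleteSpace X] {f : ℝ → X} {a b : ℝ}
    (hf : IntervalIntegrable f volume a b) (x : X) :
    ⟪∫ s in a..b, f s, x⟫_ℝ = ∫ s in a..b, ⟪f s, x⟫_ℝ := by
  have := (innerSL ℝ x).intervalIntegral_comp_comm hf
  simp only [innerSL_apply_apply] at this
  rw [real_inner_comm, ← this]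
  exact intervalIntegral.integral_congr fun s _ => real_inner_comm _ _

theorem inner_intervalIntegral_right [CompleteSpace X] {f : ℝ → X} {a b : ℝ}
    (hf : IntervalIntegrable f volume a b) (x : X) :
    ⟪x, ∫ s in a..b, f s⟫_ℝ = ∫ s in a..b, ⟪x, f s⟫_ℝ := by
  have := (innerSL ℝ x).intervalIntegral_comp_comm hf
  simpa only [innerSL_apply_apply] using this.symm

variable [CompleteSpace X] [CompleteSpace Y]

namespace IsC0Semigroup

variable {T S : ℝ → X →L[ℝ] X}

theorem zero_apply (hT : IsC0Semigroup T) (x : X) : T 0 x = x := by simp [hT.map_zero]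

theorem add_apply (hT : IsC0Semigroup T) {s t : ℝ} (hs : 0 ≤ s) (ht : 0 ≤ t) (x : X) :
    T (s + t) x = T s (T t x) := by rw [hT.map_add s t hs ht]; rfl

theorem gen_apply (hT : IsC0Semigroup T) {x y : X} (h : Gen T x y) {t : ℝ} (ht : 0 ≤ t) :
    Gen T (T t x) (T t y) := by
  have := ((T t).continuous.tendsto y).comp h
  refine this.congr' ?_
  filter_upwards [self_mem_nhdsWithin] with h hh
  have hh : 0 < h := hh
  simp only [Function.comp, map_smul, map_sub]
  rw [← hT.add_apply ht hh.le, add_comm, hT.add_apply hh.le ht]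

theorem hasDerivWithinAt (hT : IsC0Semigroup T) {x y : X} (h : Gen T x y) {t : ℝ} (ht : 0 ≤ t) :
    HasDerivWithinAt (fun s => T s x) (T t y) (Ioi t) t := by
  rw [hasDerivWithinAt_Ioi_iff]
  refine (hT.gen_apply h ht).congr' ?_
  filter_upwards [self_mem_nhdsWithin] with h hh
  rw [add_comm, hT.add_apply (le_of_lt hh) ht]

/-- Strong integrals of a semigroup over bounded intervals. -/
theorem exists_integral (hT : IsC0Semigroup T) {b : ℝ} (hb : 0 ≤ b) :
    ∃ L : X →L[ℝ] X, ∀ x, L x = ∫ s in (0 : ℝ)..b, T s x := by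
  obtain ⟨M, -, hM⟩ := exists_bound hT.continuousOn b
  obtain ⟨L, -, hL, -⟩ := exists_clm_integral (μ := volume.restrict (Ioc 0 b)) (G := T)
    (g := fun _ => M)
    (fun x => ((hT.continuousOn x).mono fun s hs => hs.1.le).aestronglyMeasurable
      measurableSet_Ioc) (by simp)
    (by filter_upwards [ae_restrict_mem measurableSet_Ioc] with s hs using hM s hs.1.le hs.2)
  exact ⟨L, fun x => by rw [hL, intervalIntegral.integral_of_le hb]⟩

theorem intervalIntegrable (hT : IsC0Semigroup T) (x : X) {a b : ℝ} (ha : 0 ≤ a) (hb : 0 ≤ b) :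
    IntervalIntegrable (fun s => T s x) volume a b := by
  refine ContinuousOn.intervalIntegrable ((hT.continuousOn x).mono ?_)
  intro s hs
  exact (le_min ha hb).trans hs.1

/-- After a shift by t the overlapping parts of the two integrals cancel. What remains are two
windows of length t, so composing ∫₀^h T with T(t) changes it by O(t) in operator norm. -/
theorem integral_apply_sub (hT : IsC0Semigroup T) (x : X) {t h : ℝ} (ht : 0 ≤ t) (hh : 0 ≤ h) :
    (∫ s in (0 : ℝ)..h, T s (T t x)) - ∫ s in (0 : ℝ)..h, T s x =
      (∫ s in h..(h + t), T s x) - ∫ s in (0 : ℝ)..t, T s x := by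
  have e1 : ∫ s in (0 : ℝ)..h, T s (T t x) = ∫ s in t..(h + t), T s x := by
    have := intervalIntegral.integral_comp_add_right (a := 0) (b := h) (fun s => T s x) t
    rw [zero_add] at this
    rw [← this]
    refine intervalIntegral.integral_congr fun s hs => ?_
    rw [uIcc_of_le hh] at hs
    exact (hT.add_apply hs.1 ht x).symm
  have e2 := intervalIntegral.integral_add_adjacent_intervals
    (hT.intervalIntegrable x le_rfl ht) (hT.intervalIntegrable x ht (add_nonneg hh ht))
  have e3 := intervalIntegral.integral_add_adjacent_intervals
    (hT.intervalIntegrable x le_rfl hh) (hT.intervalIntegrable x hh (add_nonneg hh ht))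
  rw [e1]
  rw [sub_eq_sub_iff_add_eq_add]
  exact (add_comm _ _).trans (e2.trans (e3.symm.trans (add_comm _ _)))

theorem gen_integral (hT : IsC0Semigroup T) (x : X) {b : ℝ} (hb : 0 ≤ b) :
    Gen T (∫ s in (0 : ℝ)..b, T s x) (T b x - x) := by
  have h1 : Tendsto (fun t : ℝ => t⁻¹ • ∫ s in (0 : ℝ)..t, T s (T b x)) (𝓝[>] 0) (𝓝 (T b x)) := by
    simpa [hT.zero_apply] using tendsto_average (hT.continuousOn (T b x))
  have h2 : Tendsto (fun t : ℝ => t⁻¹ • ∫ s in (0 : ℝ)..t, T s x) (𝓝[>] 0) (𝓝 x) := by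
    simpa [hT.zero_apply] using tendsto_average (hT.continuousOn x)
  refine (h1.sub h2).congr' ?_
  filter_upwards [self_mem_nhdsWithin] with t ht
  have ht : 0 < t := ht
  have e : T t (∫ s in (0 : ℝ)..b, T s x) = ∫ s in (0 : ℝ)..b, T s (T t x) := by
    rw [← ContinuousLinearMap.intervalIntegral_comp_comm _ (hT.intervalIntegrable x le_rfl hb)]
    refine intervalIntegral.integral_congr fun s hs => ?_
    rw [uIcc_of_le hb] at hs
    rw [← hT.add_apply ht.le hs.1, add_comm, hT.add_apply hs.1 ht.le]
  rw [← smul_sub, e]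
  congr 1
  have h3 := hT.integral_apply_sub x ht.le hb
  have h4 := hT.integral_apply_sub x hb ht.le
  have e2 := intervalIntegral.integral_add_adjacent_intervals
    (hT.intervalIntegrable x le_rfl ht.le) (hT.intervalIntegrable x ht.le (add_nonneg ht.le hb))
  have e3 := intervalIntegral.integral_add_adjacent_intervals
    (hT.intervalIntegrable x le_rfl hb) (hT.intervalIntegrable x hb (add_nonneg ht.le hb))
  rw [h4, h3, add_comm b t]
  rw [sub_eq_sub_iff_add_eq_add]
  exact (add_comm _ _).trans (e2.trans (e3.symm.trans (add_comm _ _)))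

/-- The averages t⁻¹ ∫₀^t T(s) x lie in the domain by `gen_integral` and converge to x. -/
theorem dense_gen (hT : IsC0Semigroup T) : Dense {x | ∃ y, Gen T x y} := by
  intro x
  have h2 : Tendsto (fun t : ℝ => t⁻¹ • ∫ s in (0 : ℝ)..t, T s x) (𝓝[>] 0) (𝓝 x) := by
    simpa [hT.zero_apply] using tendsto_average (hT.continuousOn x)
  refine mem_closure_of_tendsto h2 ?_
  filter_upwards [self_mem_nhdsWithin] with t ht
  have ht : 0 < t := ht
  refine ⟨t⁻¹ • (T t x - x), ?_⟩
  refine ((hT.gen_integral x ht.le).const_smul t⁻¹).congr fun h => ?_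
  rw [map_smul, ← smul_sub, smul_comm]

/-- The adjoint of a `C₀` semigroup on a Hilbert space is a `C₀` semigroup. -/
theorem adjoint (hT : IsC0Semigroup T) :
    IsC0Semigroup fun t => ContinuousLinearMap.adjoint (T t) := by
  have hadd : ∀ s t : ℝ, 0 ≤ s → 0 ≤ t → ContinuousLinearMap.adjoint (T (s + t)) =
      ContinuousLinearMap.adjoint (T s) ∘L ContinuousLinearMap.adjoint (T t) := by
    intro s t hs ht
    rw [add_comm, hT.map_add t s ht hs, ContinuousLinearMap.adjoint_comp]
  have h0 : ContinuousLinearMap.adjoint (T 0) = 1 := by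
    rw [hT.map_zero]; exact ContinuousLinearMap.adjoint_id
  have hright : ∀ x, Tendsto (fun h => ContinuousLinearMap.adjoint (T h) x) (𝓝[≥] 0) (𝓝 x) := by
    obtain ⟨M, hM0, hM⟩ := exists_bound hT.continuousOn 2
    -- `D` is the union of the ranges of the adjoints of L = ∫₀^h T. On it right continuity at 0 is
    -- quantitative, since L T(t) - L has norm at most 2Mt; the bound M is taken on [0, 2] because h
    -- + t ≤ 2. The span of `D` is dense: a vector orthogonal to it satisfies ∫₀^h T(s) y = 0 for
    -- all h in (0, 1], hence is zero. Boundedness of T near 0 then extends continuity to all of X.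
    let D : Set X := {x | ∃ h : ℝ, 0 < h ∧ h ≤ 1 ∧ ∃ L : X →L[ℝ] X,
      (∀ z, L z = ∫ s in (0 : ℝ)..h, T s z) ∧ ∃ v, ContinuousLinearMap.adjoint L v = x}
    have hD : ∀ x ∈ D, Tendsto (fun h => ContinuousLinearMap.adjoint (T h) x) (𝓝[≥] 0) (𝓝 x) := by
      rintro _ ⟨h, hh, hh1, L, hL, v, rfl⟩
      rw [tendsto_iff_norm_sub_tendsto_zero]
      have hlim : Tendsto (fun t : ℝ => 2 * M * t * ‖v‖) (𝓝[≥] 0) (𝓝 0) := by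
        have : Continuous fun t : ℝ => 2 * M * t * ‖v‖ := by fun_prop
        simpa using (this.tendsto 0).mono_left nhdsWithin_le_nhds
      refine squeeze_zero' (Eventually.of_forall fun _ => norm_nonneg _) ?_ hlim
      have : Icc (0 : ℝ) 1 ∈ 𝓝[≥] (0 : ℝ) := Icc_mem_nhdsGE one_pos
      filter_upwards [this] with t ht
      have e : ContinuousLinearMap.adjoint (T t) (ContinuousLinearMap.adjoint L v) -
          ContinuousLinearMap.adjoint L v = ContinuousLinearMap.adjoint (L ∘L T t - L) v := by
        simp [map_sub, ContinuousLinearMap.adjoint_comp]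
      rw [e]
      refine ContinuousLinearMap.le_of_opNorm_le _ ?_ _
      rw [LinearIsometryEquiv.norm_map]
      refine ContinuousLinearMap.opNorm_le_bound _ (by have := ht.1; positivity) fun z => ?_
      rw [sub_apply, ContinuousLinearMap.comp_apply, hL, hL,
        hT.integral_apply_sub z ht.1 hh.le]
      refine (norm_sub_le _ _).trans ?_
      have b1 : ‖∫ s in h..(h + t), T s z‖ ≤ M * ‖z‖ * |h + t - h| := by
        refine intervalIntegral.norm_integral_le_of_norm_le_const fun s hs => ?_
        rw [uIoc_of_le (by linarith [ht.1])] at hs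
        exact (T s).le_of_opNorm_le (hM s (by linarith [hs.1]) (by linarith [hs.2, ht.2])) z
      have b2 : ‖∫ s in (0 : ℝ)..t, T s z‖ ≤ M * ‖z‖ * |t - 0| := by
        refine intervalIntegral.norm_integral_le_of_norm_le_const fun s hs => ?_
        rw [uIoc_of_le ht.1] at hs
        exact (T s).le_of_opNorm_le (hM s (by linarith [hs.1]) (by linarith [hs.2, ht.2])) z
      rw [add_sub_cancel_left, abs_of_nonneg ht.1] at b1
      rw [sub_zero, abs_of_nonneg ht.1] at b2
      linarith
    have hspan : (Submodule.span ℝ D).topologicalClosure = ⊤ := by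
      rw [Submodule.topologicalClosure_eq_top_iff, Submodule.eq_bot_iff]
      intro y hy
      have hz : ∀ h : ℝ, 0 < h → h ≤ 1 → ∫ s in (0 : ℝ)..h, T s y = 0 := by
        intro h hh hh1
        obtain ⟨L, hL⟩ := hT.exists_integral hh.le
        rw [← hL]
        refine ext_inner_left ℝ fun v => ?_
        rw [← ContinuousLinearMap.adjoint_inner_left, inner_zero_right]
        exact hy _ (Submodule.subset_span ⟨h, hh, hh1, L, hL, v, rfl⟩)
      have h2 : Tendsto (fun t : ℝ => t⁻¹ • ∫ s in (0 : ℝ)..t, T s y) (𝓝[>] 0) (𝓝 y) := by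
        simpa [hT.zero_apply] using tendsto_average (hT.continuousOn y)
      have h3 : Tendsto (fun t : ℝ => t⁻¹ • ∫ s in (0 : ℝ)..t, T s y) (𝓝[>] 0) (𝓝 0) := by
        refine tendsto_const_nhds.congr' ?_
        have : Ioc (0 : ℝ) 1 ∈ 𝓝[>] (0 : ℝ) := Ioc_mem_nhdsGT one_pos
        filter_upwards [this] with t ht
        rw [hz t ht.1 ht.2, smul_zero]
      exact tendsto_nhds_unique h2 h3
    have hsp : ∀ x ∈ Submodule.span ℝ D,
        Tendsto (fun h => ContinuousLinearMap.adjoint (T h) x) (𝓝[≥] 0) (𝓝 x) := by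
      intro x hx
      induction hx using Submodule.span_induction with
      | mem x hx => exact hD x hx
      | zero => simp
      | add x y _ _ hx hy => simpa using hx.add hy
      | smul a x _ hx => simpa using hx.const_smul a
    intro x
    have hx : x ∈ closure (Submodule.span ℝ D : Set X) := by
      rw [← Submodule.topologicalClosure_coe, hspan]; trivial
    rw [Metric.tendsto_nhds]
    intro ε hε
    obtain ⟨w, hw, hxw⟩ := Metric.mem_closure_iff.1 hx (ε / (2 * (M + 1))) (by positivity)
    have h1 := Metric.tendsto_nhds.1 (hsp w hw) (ε / 2) (by positivity)
    have : Icc (0 : ℝ) 2 ∈ 𝓝[≥] (0 : ℝ) := Icc_mem_nhdsGE two_pos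
    filter_upwards [h1, this] with t ht ht2
    rw [dist_eq_norm] at *
    have e : ContinuousLinearMap.adjoint (T t) x - x =
        ContinuousLinearMap.adjoint (T t) (x - w) +
          (ContinuousLinearMap.adjoint (T t) w - w) - (x - w) := by
      rw [map_sub]; abel
    have b : ‖ContinuousLinearMap.adjoint (T t) (x - w)‖ ≤ M * ‖x - w‖ := by
      refine ContinuousLinearMap.le_of_opNorm_le _ ?_ _
      rw [LinearIsometryEquiv.norm_map]
      exact hM t ht2.1 ht2.2
    rw [e]
    refine ((norm_sub_le _ _).trans (add_le_add_left (norm_add_le _ _) _)).trans_lt ?_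
    rw [lt_div_iff₀ (by positivity)] at hxw
    linarith
  refine ⟨h0, hadd, fun x t₀ ht₀ => ?_⟩
  have ht₀ : 0 ≤ t₀ := ht₀
  obtain ⟨M, hM0, hM⟩ := exists_bound hT.continuousOn (t₀ + 1)
  have key : ∀ s t, 0 ≤ s → s ≤ t → t ≤ t₀ + 1 → ‖ContinuousLinearMap.adjoint (T t) x -
      ContinuousLinearMap.adjoint (T s) x‖ ≤
        M * ‖ContinuousLinearMap.adjoint (T (t - s)) x - x‖ := by
    intro s t hs hst ht
    have : ContinuousLinearMap.adjoint (T t) x = ContinuousLinearMap.adjoint (T s)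
        (ContinuousLinearMap.adjoint (T (t - s)) x) := by
      rw [← ContinuousLinearMap.comp_apply, ← hadd _ _ hs (sub_nonneg.2 hst)]; simp
    rw [this, ← map_sub]
    refine ContinuousLinearMap.le_of_opNorm_le _ ?_ _
    rw [LinearIsometryEquiv.norm_map]
    exact hM s hs (hst.trans ht)
  rw [ContinuousWithinAt, tendsto_iff_norm_sub_tendsto_zero]
  have hlim : Tendsto (fun t : ℝ => M * ‖ContinuousLinearMap.adjoint (T |t - t₀|) x - x‖)
      (𝓝[Ici 0] t₀) (𝓝 0) := by
    have h1 : Tendsto (fun t : ℝ => |t - t₀|) (𝓝[Ici 0] t₀) (𝓝[≥] 0) := by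
      refine tendsto_nhdsWithin_iff.2 ⟨?_, Eventually.of_forall fun t => mem_Ici.2 (abs_nonneg _)⟩
      have : Continuous fun t : ℝ => |t - t₀| := by fun_prop
      simpa using (this.tendsto t₀).mono_left nhdsWithin_le_nhds
    have h2 := ((tendsto_iff_norm_sub_tendsto_zero.1 (hright x)).comp h1).const_mul M
    simpa using h2
  refine squeeze_zero' (Eventually.of_forall fun _ => norm_nonneg _) ?_ hlim
  have : Iio (t₀ + 1) ∈ 𝓝[Ici 0] t₀ := mem_nhdsWithin_of_mem_nhds (Iio_mem_nhds (by linarith))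
  filter_upwards [this, self_mem_nhdsWithin] with t ht ht2
  have ht2 : 0 ≤ t := ht2
  rcases le_total t t₀ with h | h
  · rw [abs_sub_comm, norm_sub_rev, abs_of_nonneg (sub_nonneg.2 h)]
    exact key t t₀ ht2 h (by linarith)
  · rw [abs_of_nonneg (sub_nonneg.2 h)]
    exact key t₀ t ht₀ h (le_of_lt ht)

theorem integral_gen (hT : IsC0Semigroup T) {x y : X} (h : Gen T x y) {t : ℝ} (ht : 0 ≤ t) :
    ∫ s in (0 : ℝ)..t, T s y = T t x - x := by
  rw [intervalIntegral.integral_eq_sub_of_hasDeriv_right_of_le ht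
    ((hT.continuousOn x).mono Icc_subset_Ici_self)
    (fun s hs => hT.hasDerivWithinAt h hs.1.le) (hT.intervalIntegrable y le_rfl ht),
    hT.zero_apply]

/-- Elements of the domain of the adjoint of the generator are in the domain of the generator of
the adjoint semigroup. -/
theorem gen_adjoint (hT : IsC0Semigroup T) {x z : X}
    (h : ∀ x' y', Gen T x' y' → ⟪z, x'⟫_ℝ = ⟪x, y'⟫_ℝ) :
    Gen (fun t => ContinuousLinearMap.adjoint (T t)) x z := by
  -- The increment is identified by testing against the dense domain of the generator; dividing by t
  -- then gives the derivative at 0.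
  have key : ∀ t, 0 ≤ t → ContinuousLinearMap.adjoint (T t) x - x =
      ∫ s in (0 : ℝ)..t, ContinuousLinearMap.adjoint (T s) z := by
    intro t ht
    refine Dense.eq_of_inner_left (𝕜 := ℝ) (S := {x | ∃ y, Gen T x y}) hT.dense_gen ?_
    rintro x' ⟨y', hg⟩
    rw [inner_intervalIntegral_left (hT.adjoint.intervalIntegrable z le_rfl ht), inner_sub_left,
      ContinuousLinearMap.adjoint_inner_left, ← inner_sub_right, ← hT.integral_gen hg ht,
      inner_intervalIntegral_right (hT.intervalIntegrable y' le_rfl ht)]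
    refine intervalIntegral.integral_congr fun s hs => ?_
    rw [uIcc_of_le ht] at hs
    rw [ContinuousLinearMap.adjoint_inner_left, h _ _ (hT.gen_apply hg hs.1)]
  have h2 := tendsto_average (hT.adjoint.continuousOn z)
  simp only [hT.adjoint.zero_apply] at h2
  refine h2.congr' ?_
  filter_upwards [self_mem_nhdsWithin] with t ht
  rw [key t (le_of_lt ht)]

end IsC0Semigroup

/-- The variation of constants formula relating a semigroup `T` and its perturbation `S` by the
bounded operator `K`. -/
def IsDuhamel (T : ℝ → X →L[ℝ] X) (K : X →L[ℝ] X) (S : ℝ → X →L[ℝ] X) : Prop :=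
  ∀ t, 0 ≤ t → ∀ x, S t x = T t x + ∫ s in (0 : ℝ)..t, T (t - s) (K (S s x))

variable {T S : ℝ → X →L[ℝ] X} {K : X →L[ℝ] X}

theorem continuousOn_duhamel (hT : IsC0Semigroup T) (hS : IsC0Semigroup S) (N : X →L[ℝ] X)
    (t : ℝ) (x : X) : ContinuousOn (fun s => T (t - s) (N (S s x))) (Icc 0 t) :=
  continuousOn_apply hT.continuousOn (by fun_prop)
    (N.continuous.comp_continuousOn ((hS.continuousOn x).mono Icc_subset_Ici_self))
    fun _ hs => sub_nonneg.2 hs.2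

/-- One inclusion of generators suffices. For x in the domain of the generator of S, the curve s ↦
T(t - s) S(s) x has right derivative T(t - s) K S(s) x; integrate over [0, t]. The resulting
identity is between bounded operators, so it extends by density. -/
theorem isDuhamel_of_gen (hT : IsC0Semigroup T) (hS : IsC0Semigroup S)
    (h : ∀ x y, Gen S x y → Gen T x (y - K x)) : IsDuhamel T K S := by
  intro t ht
  have hcont : ∀ x, ContinuousOn (fun s => T (t - s) (K (S s x))) (Icc 0 t) :=
    continuousOn_duhamel hT hS K t
  obtain ⟨M, hM0, hM⟩ := IsC0Semigroup.exists_bound hT.continuousOn t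
  obtain ⟨M', hM0', hM'⟩ := IsC0Semigroup.exists_bound hS.continuousOn t
  obtain ⟨L, -, hL, -⟩ := exists_clm_integral (μ := volume.restrict (Ioc 0 t))
    (G := fun s => T (t - s) ∘L K ∘L S s) (g := fun _ => M * (‖K‖ * M'))
    (fun x => ((hcont x).mono Ioc_subset_Icc_self).aestronglyMeasurable measurableSet_Ioc)
    (integrable_const _) (by
      filter_upwards [ae_restrict_mem measurableSet_Ioc] with s hs
      refine (ContinuousLinearMap.opNorm_comp_le _ _).trans ?_
      gcongr
      · exact hM _ (sub_nonneg.2 hs.2) (by linarith [hs.1])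
      refine (ContinuousLinearMap.opNorm_comp_le _ _).trans ?_
      gcongr
      exact hM' _ hs.1.le hs.2)
  have hL' : ∀ x, L x = ∫ s in (0 : ℝ)..t, T (t - s) (K (S s x)) := fun x => by
    rw [hL, intervalIntegral.integral_of_le ht]; rfl
  have : S t = T t + L := by
    refine ContinuousLinearMap.coeFn_injective ?_
    refine Continuous.ext_on hS.dense_gen (S t).continuous (T t + L).continuous ?_
    rintro x ⟨y, hg⟩
    have hc : ContinuousOn (fun s => T (t - s) (S s x)) (Icc 0 t) :=
      continuousOn_duhamel hT hS 1 t x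
    have hd : ∀ s ∈ Ioo 0 t, HasDerivWithinAt (fun s => T (t - s) (S s x))
        (T (t - s) (K (S s x))) (Ioi s) s := by
      intro s hs
      rw [hasDerivWithinAt_Ioi_iff]
      have g1 : Tendsto (fun r : ℝ => r⁻¹ • (S (s + r) x - S s x)) (𝓝[>] 0) (𝓝 (S s y)) :=
        hasDerivWithinAt_Ioi_iff.1 (hS.hasDerivWithinAt hg hs.1.le)
      have g2 : Gen T (S s x) (S s y - K (S s x)) := h _ _ (hS.gen_apply hg hs.1.le)
      have g3 := g1.sub g2
      rw [sub_sub_cancel] at g3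
      have a1 : Tendsto (fun r : ℝ => t - s - r) (𝓝[>] 0) (𝓝 (t - s)) := by
        have : Continuous fun r : ℝ => t - s - r := by fun_prop
        simpa using (this.tendsto 0).mono_left nhdsWithin_le_nhds
      have g4 := (hT.continuous_ext0.tendsto (t - s, K (S s x))).comp (a1.prodMk_nhds g3)
      rw [ext0_of_nonneg (sub_nonneg.2 hs.2.le)] at g4
      refine g4.congr' ?_
      filter_upwards [Ioo_mem_nhdsGT (sub_pos.2 hs.2)] with r hr
      have e : T (t - s) (S s x) = T (t - s - r) (T r (S s x)) := by
        rw [← hT.add_apply (sub_nonneg.2 hr.2.le) hr.1.le, sub_add_cancel]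
      simp only [Function.comp, ext0_of_nonneg (sub_nonneg.2 hr.2.le)]
      rw [e, ← smul_sub, map_smul, map_sub, map_sub, map_sub, sub_sub t s r]
      congr 1
      abel
    have := intervalIntegral.integral_eq_sub_of_hasDeriv_right_of_le ht hc hd
      ((hcont x).intervalIntegrable_of_Icc ht)
    rw [add_apply, hL', this, sub_self, sub_zero, hT.zero_apply, hS.zero_apply]
    abel
  intro x
  rw [this, add_apply, hL']

/-- Divided by t, the Duhamel integral tends to K x for every x, so the two difference quotients
converge together. This recovers equality of the domains. -/
theorem IsDuhamel.gen_iff (hT : IsC0Semigroup T) (hS : IsC0Semigroup S) (h : IsDuhamel T K S)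
    {x y : X} : Gen S x y ↔ Gen T x (y - K x) := by
  have h1 : Tendsto (fun t : ℝ => t⁻¹ • ∫ s in (0 : ℝ)..t, T (t - s) (K (S s x))) (𝓝[>] 0)
      (𝓝 (K x)) := by
    refine tendsto_average_zero (g := fun t s => T (t - s) (K (S s x))) (fun ε hε => ?_)
      fun t ht => (continuousOn_duhamel hT hS K t x).intervalIntegrable_of_Icc ht
    have hc : Continuous fun p : ℝ × ℝ => ext0 T p.1 (K (ext0 S p.2 x)) :=
      hT.continuous_ext0.comp (continuous_fst.prodMk (K.continuous.comp
        (hS.continuous_ext0.comp (continuous_snd.prodMk continuous_const))))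
    obtain ⟨δ, hδ, H⟩ := Metric.continuous_iff.1 hc (0, 0) ε hε
    refine ⟨δ, hδ, fun t s h0 hs ht => ?_⟩
    have := H (t - s, s) (by
      simp only [Prod.dist_eq, Real.dist_eq, sub_zero]
      rw [abs_of_nonneg h0, abs_of_nonneg (sub_nonneg.2 hs)]
      exact max_lt (by linarith) (by linarith))
    simp only [ext0_of_nonneg (sub_nonneg.2 hs), ext0_of_nonneg h0, ext0_of_nonneg le_rfl,
      hT.zero_apply, hS.zero_apply, dist_eq_norm] at this
    exact this.le
  have h2 : ∀ᶠ t : ℝ in 𝓝[>] 0, t⁻¹ • (S t x - x) =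
      t⁻¹ • (T t x - x) + t⁻¹ • ∫ s in (0 : ℝ)..t, T (t - s) (K (S s x)) := by
    filter_upwards [self_mem_nhdsWithin] with t ht
    rw [h t (le_of_lt ht), ← smul_add]
    congr 1; abel
  constructor
  · intro hg
    refine (Tendsto.sub hg h1).congr' ?_
    filter_upwards [h2] with t ht
    rw [ht, add_sub_cancel_right]
  · intro hg
    have := (Tendsto.add hg h1)
    rw [sub_add_cancel] at this
    refine this.congr' ?_
    filter_upwards [h2] with t ht
    rw [ht]

/-- The variation of constants formula for the inverse perturbation. -/
theorem IsDuhamel.symm (hT : IsC0Semigroup T) (hS : IsC0Semigroup S) (h : IsDuhamel T K S) :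
    IsDuhamel S (-K) T :=
  isDuhamel_of_gen hS hT fun x y hg => (h.gen_iff hT hS).2 (by simpa using hg)

/-- The variation of constants formula for the adjoint semigroups. -/
theorem IsDuhamel.adjoint (hT : IsC0Semigroup T) (hS : IsC0Semigroup S) (h : IsDuhamel T K S) :
    IsDuhamel (fun t => ContinuousLinearMap.adjoint (T t)) (ContinuousLinearMap.adjoint K)
      (fun t => ContinuousLinearMap.adjoint (S t)) := by
  intro t ht x
  refine ext_inner_right ℝ fun v => ?_
  -- Taking adjoints reverses the order of the factors: the formula wanted has T^* outside and S^*
  -- inside, so on the primal side S must be outside and T inside. The substitution s ↦ t - s then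
  -- matches the integrands.
  have e := h.symm hT hS t ht v
  have hc := continuousOn_duhamel hT.adjoint hS.adjoint (ContinuousLinearMap.adjoint K) t x
  rw [inner_add_left, inner_intervalIntegral_left (hc.intervalIntegrable_of_Icc ht),
    ContinuousLinearMap.adjoint_inner_left, ContinuousLinearMap.adjoint_inner_left, e,
    inner_add_right, inner_intervalIntegral_right
      ((continuousOn_duhamel hS hT (-K) t v).intervalIntegrable_of_Icc ht)]
  have e2 := intervalIntegral.integral_comp_sub_left (a := 0) (b := t)
    (fun s => ⟪ContinuousLinearMap.adjoint (T (t - s)) (ContinuousLinearMap.adjoint K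
      (ContinuousLinearMap.adjoint (S s) x)), v⟫_ℝ) t
  rw [sub_self, sub_zero] at e2
  rw [← e2, add_assoc, ← intervalIntegral.integral_add]
  · simp [ContinuousLinearMap.adjoint_inner_left]
  · exact (continuousOn_const.inner (continuousOn_duhamel hS hT (-K) t v)).intervalIntegrable_of_Icc
      ht
  · have h3 : ContinuousOn (fun s => ⟪ContinuousLinearMap.adjoint (S (t - s)) x, K (T s v)⟫_ℝ)
        (Icc 0 t) := by
      refine ContinuousOn.inner ?_ ?_
      · exact (hS.adjoint.continuousOn x).comp (by fun_prop) fun s hs => sub_nonneg.2 hs.2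
      · exact K.continuous.comp_continuousOn ((hT.continuousOn v).mono Icc_subset_Ici_self)
    refine (h3.congr fun s hs => ?_).intervalIntegrable_of_Icc ht
    simp [ContinuousLinearMap.adjoint_inner_left]

end Generators

/-! ### Bounded perturbation of a semigroup by a Neumann series -/

section Perturbation
open scoped BoundedContinuousFunction

variable {X : Type*} [NormedAddCommGroup X] [InnerProductSpace ℝ X] [CompleteSpace X]
variable {T S : ℝ → X →L[ℝ] X} {K : X →L[ℝ] X}

theorem continuousOn_Ici_of_Icc {Z : Type*} [TopologicalSpace Z] {f : ℝ → Z}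
    (h : ∀ b, 0 ≤ b → ContinuousOn f (Icc 0 b)) : ContinuousOn f (Ici 0) := by
  intro t ht
  have ht : 0 ≤ t := ht
  refine (h (t + 1) (by linarith) t ⟨ht, by linarith⟩).mono_of_mem_nhdsWithin ?_
  rw [← Ici_inter_Iic]
  exact inter_mem self_mem_nhdsWithin (mem_nhdsWithin_of_mem_nhds (Iic_mem_nhds (by linarith)))

theorem integral_exp_neg_mul_sub {ν : ℝ} (hν : 0 < ν) (t : ℝ) :
    ∫ s in (0 : ℝ)..t, Real.exp (-ν * (t - s)) = (1 - Real.exp (-ν * t)) / ν := by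
  have hd : ∀ s ∈ uIcc 0 t, HasDerivAt (fun s => Real.exp (-ν * (t - s)) / ν)
      (Real.exp (-ν * (t - s))) s := by
    intro s _
    have h1 : HasDerivAt (fun s => -ν * (t - s)) ν s := by
      simpa using ((hasDerivAt_id s).const_sub t).const_mul (-ν)
    have h2 := h1.exp.div_const ν
    rwa [mul_div_assoc, div_self hν.ne', mul_one] at h2
  rw [intervalIntegral.integral_eq_sub_of_hasDerivAt hd
    (Continuous.intervalIntegrable (by fun_prop) _ _)]
  simp [sub_div]

theorem IsC0Semigroup.rescale (hT : IsC0Semigroup T) (a : ℝ) :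
    IsC0Semigroup fun t => Real.exp (a * t) • T t := by
  refine ⟨by simp [hT.map_zero], fun s t hs ht => ?_, fun x => ?_⟩
  · ext x
    simp [hT.map_add s t hs ht, mul_add, Real.exp_add, smul_smul, mul_comm]
  · exact ContinuousOn.smul (by fun_prop) (hT.continuousOn x)

/-- The Volterra operator of the variation of constants formula, on bounded continuous functions. -/
theorem exists_volterra (hT : IsC0Semigroup T) {M ν : ℝ} (hM : 0 < M) (hν : 0 < ν)
    (hb : ∀ t, 0 ≤ t → ‖T t‖ ≤ M * Real.exp (-ν * t)) (hK : M * ‖K‖ ≤ ν / 2) :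
    ∃ Γ : (ℝ →ᵇ X) →L[ℝ] (ℝ →ᵇ X), ‖Γ‖ ≤ 1 / 2 ∧
      ∀ v t, Γ v t = ∫ s in (0 : ℝ)..(max t 0), T (max t 0 - s) (K (v s)) := by
  have hint : ∀ (v : ℝ →ᵇ X) (t : ℝ), IntervalIntegrable (fun s => K (v s)) volume 0 t :=
    fun v t => (K.continuous.comp v.continuous).intervalIntegrable _ _
  -- Clamping time at 0 keeps the functions defined on all of ℝ, so the fixed point problem lives in
  -- one Banach space of bounded continuous functions.
  have hcont : ∀ v : ℝ →ᵇ X, Continuous fun t : ℝ =>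
      ∫ s in (0 : ℝ)..(max t 0), T (max t 0 - s) (K (v s)) := by
    intro v
    have : ContinuousOn (fun t => ∫ s in (0 : ℝ)..t, T (t - s) (K (v s))) (Ici 0) :=
      continuousOn_Ici_of_Icc fun b _ => hT.continuousOn_conv (hint v b)
    exact this.comp_continuous (f := fun t : ℝ => max t 0) (by fun_prop) (by simp)
  have hbound : ∀ (v : ℝ →ᵇ X) (t : ℝ),
      ‖∫ s in (0 : ℝ)..(max t 0), T (max t 0 - s) (K (v s))‖ ≤ 1 / 2 * ‖v‖ := by
    intro v t
    set r := max t 0 with hr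
    have hr0 : 0 ≤ r := le_max_right _ _
    have h1 : ‖∫ s in (0 : ℝ)..r, T (r - s) (K (v s))‖ ≤
        ∫ s in (0 : ℝ)..r, M * ‖K‖ * ‖v‖ * Real.exp (-ν * (r - s)) := by
      refine intervalIntegral.norm_integral_le_of_norm_le hr0 ?_
        (Continuous.intervalIntegrable (by fun_prop) _ _)
      refine Eventually.of_forall fun s hs => ?_
      calc ‖T (r - s) (K (v s))‖ ≤ (M * Real.exp (-ν * (r - s))) * ‖K (v s)‖ :=
            ContinuousLinearMap.le_of_opNorm_le _ (hb _ (sub_nonneg.2 hs.2)) _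
        _ ≤ (M * Real.exp (-ν * (r - s))) * (‖K‖ * ‖v‖) := by
            gcongr
            exact K.le_opNorm_of_le (v.norm_coe_le_norm s)
        _ = _ := by ring
    refine h1.trans ?_
    rw [intervalIntegral.integral_const_mul, integral_exp_neg_mul_sub hν]
    have h2 : (1 - Real.exp (-ν * r)) / ν ≤ 1 / ν := by
      gcongr; linarith [Real.exp_pos (-ν * r)]
    calc M * ‖K‖ * ‖v‖ * ((1 - Real.exp (-ν * r)) / ν) ≤ (ν / 2) * ‖v‖ * (1 / ν) := by
          gcongr
          rw [div_nonneg_iff]; left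
          exact ⟨by rw [sub_nonneg, Real.exp_le_one_iff]; nlinarith, hν.le⟩
      _ = 1 / 2 * ‖v‖ := by field_simp
  let Γ₀ : (ℝ →ᵇ X) →ₗ[ℝ] (ℝ →ᵇ X) :=
    { toFun := fun v => BoundedContinuousFunction.ofNormedAddCommGroup _ (hcont v) _ (hbound v)
      map_add' := fun v w => by
        ext t
        simp only [BoundedContinuousFunction.coe_ofNormedAddCommGroup,
          BoundedContinuousFunction.coe_add, Pi.add_apply, map_add]
        exact intervalIntegral.integral_add (hT.intervalIntegrable_conv (by simp) (hint v _))
          (hT.intervalIntegrable_conv (by simp) (hint w _))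
      map_smul' := fun c v => by
        ext t
        simp }
  refine ⟨Γ₀.mkContinuous (1 / 2) fun v => ?_,
    LinearMap.mkContinuous_norm_le _ (by norm_num) _, fun v t => rfl⟩
  exact BoundedContinuousFunction.norm_ofNormedAddCommGroup_le _ (by positivity) (hbound v)

/-- The smallness condition makes the Volterra operator Γ a contraction, so 1 - Γ is invertible and
the Duhamel equation has exactly one bounded continuous solution for each initial value. The
semigroup law is a consequence of this uniqueness. -/
theorem exists_perturbation_of_decay (hT : IsC0Semigroup T) {M ν : ℝ} (hM : 0 < M) (hν : 0 < ν)
    (hb : ∀ t, 0 ≤ t → ‖T t‖ ≤ M * Real.exp (-ν * t)) (hK : M * ‖K‖ ≤ ν / 2) :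
    ∃ S, IsC0Semigroup S ∧ IsDuhamel T K S := by
  obtain ⟨Γ, hΓ, hΓv⟩ := exists_volterra hT hM hν hb hK
  have hVb : ∀ (x : X) (t : ℝ), ‖T (max t 0) x‖ ≤ M * ‖x‖ := fun x t => by
    refine ContinuousLinearMap.le_of_opNorm_le _ ((hb _ (le_max_right _ _)).trans ?_) _
    refine mul_le_of_le_one_right hM.le ?_
    rw [Real.exp_le_one_iff]
    nlinarith [le_max_right t 0]
  have hVc : ∀ x : X, Continuous fun t : ℝ => T (max t 0) x := fun x =>
    (hT.continuousOn x).comp_continuous (f := fun t : ℝ => max t 0) (by fun_prop) (by simp)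
  let V₀ : X →ₗ[ℝ] (ℝ →ᵇ X) :=
    { toFun := fun x => BoundedContinuousFunction.ofNormedAddCommGroup _ (hVc x) _ (hVb x)
      map_add' := fun x y => by ext t; simp
      map_smul' := fun c x => by ext t; simp }
  let V : X →L[ℝ] (ℝ →ᵇ X) := V₀.mkContinuous M fun x =>
    BoundedContinuousFunction.norm_ofNormedAddCommGroup_le _ (by positivity) (hVb x)
  have hVx : ∀ x t, V x t = T (max t 0) x := fun x t => rfl
  obtain ⟨u, hu⟩ := isUnit_one_sub_of_norm_lt_one (x := Γ) (by linarith)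
  let R : (ℝ →ᵇ X) →L[ℝ] (ℝ →ᵇ X) := ↑u⁻¹
  have hR1 : ∀ w, R w - Γ (R w) = w := fun w => by
    have : (u : (ℝ →ᵇ X) →L[ℝ] (ℝ →ᵇ X)) * R = 1 := u.mul_inv
    rw [hu] at this
    simpa using DFunLike.congr_fun this w
  have hR2 : ∀ w w', w - Γ w = w' → w = R w' := fun w w' h => by
    have : R * (u : (ℝ →ᵇ X) →L[ℝ] (ℝ →ᵇ X)) = 1 := u.inv_mul
    rw [hu] at this
    rw [← h]
    simpa using (DFunLike.congr_fun this w).symm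
  have hv : ∀ x t, 0 ≤ t → R (V x) t =
      T t x + ∫ s in (0 : ℝ)..t, T (t - s) (K (R (V x) s)) := by
    intro x t ht
    have := DFunLike.congr_fun (hR1 (V x)) t
    rw [BoundedContinuousFunction.coe_sub, Pi.sub_apply, hΓv, hVx, max_eq_left ht] at this
    rw [← this]; abel
  have hv0 : ∀ x, R (V x) 0 = x := fun x => by rw [hv x 0 le_rfl]; simp [hT.map_zero]
  refine ⟨fun t => BoundedContinuousFunction.evalCLM ℝ t ∘L R ∘L V,
    ⟨?_, fun s t hs ht => ?_, fun x => ?_⟩, fun t ht x => hv x t ht⟩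
  · ext x
    exact hv0 x
  · ext x
    change R (V x) (s + t) = R (V (R (V x) t)) s
    -- `w` is the trajectory of x restarted at time t. It solves the fixed point equation with
    -- initial value its position at time t, so it is the trajectory of that point.
    let w : ℝ →ᵇ X := (R (V x)).compContinuous ⟨fun r : ℝ => t + max r 0, by fun_prop⟩
    have hw : w = R (V (R (V x) t)) := by
      refine hR2 _ _ ?_
      ext r
      rw [BoundedContinuousFunction.coe_sub, Pi.sub_apply, hΓv, hVx]
      have hr0 : 0 ≤ max r 0 := le_max_right _ _
      have hmild : IsMildSolution T (fun r => K (R (V x) r)) (t + max r 0) (R (V x)) := by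
        intro r hr
        rw [hv0]
        exact hv x r hr.1
      have h1 := hmild.restart hT
        ((K.continuous.comp (R (V x)).continuous).intervalIntegrable _ _) ht
        (by linarith) (max r 0) ⟨hr0, by linarith⟩
      have h2 : ∫ q in (0 : ℝ)..(max r 0), T (max r 0 - q) (K (w q)) =
          ∫ q in (0 : ℝ)..(max r 0), T (max r 0 - q) (K (R (V x) (t + q))) := by
        refine intervalIntegral.integral_congr fun q hq => ?_
        rw [uIcc_of_le hr0] at hq
        simp [w, hq.1]
      rw [h2]
      simp only [add_zero] at h1
      change R (V x) (t + max r 0) - _ = _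
      rw [h1]
      exact add_sub_cancel_right _ _
    rw [← hw]
    simp [w, hs, add_comm]
  · exact (R (V x)).continuous.continuousOn

/-- The bounded perturbation theorem for `C₀` semigroups. -/
theorem exists_perturbation (hT : IsC0Semigroup T) (K : X →L[ℝ] X) :
    ∃ S, IsC0Semigroup S ∧ IsDuhamel T K S := by
  obtain ⟨M, ω, hM, -, hb⟩ := hT.norm_growth
  -- Multiplying T by exp(-(ω + ν)t) leaves decay at rate ν, and this ν meets M‖K‖ ≤ ν/2; the
  -- summand 1 keeps it positive when K = 0. The rescaling is undone at the end.
  set ν : ℝ := 2 * (M * ‖K‖) + 1 with hν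
  have hν0 : 0 < ν := by positivity
  set μ : ℝ := ω + ν with hμ
  obtain ⟨S, hS, hd⟩ := exists_perturbation_of_decay (K := K) (hT.rescale (-μ)) hM hν0
    (fun t ht => by
      rw [norm_smul, Real.norm_of_nonneg (Real.exp_pos _).le]
      calc _ ≤ Real.exp (-μ * t) * (M * Real.exp (ω * t)) := by gcongr; exact hb t ht
        _ = M * (Real.exp (-μ * t) * Real.exp (ω * t)) := by ring
        _ = _ := by rw [← Real.exp_add]; congr 2; rw [hμ]; ring) (by rw [hν]; linarith)
  refine ⟨_, hS.rescale μ, fun t ht x => ?_⟩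
  have h1 := hd t ht x
  simp only [smul_apply] at h1 ⊢
  rw [h1, smul_add, smul_smul, ← Real.exp_add, ← intervalIntegral.integral_smul]
  congr 1
  · rw [show μ * t + -μ * t = 0 by ring]; simp
  · refine intervalIntegral.integral_congr fun s _ => ?_
    rw [smul_smul, ← Real.exp_add, map_smul, map_smul]
    congr 2; ring

end Perturbation

/-! ### Sylvester equations in weak and integrated form -/

section Sylvester

variable {X : Type*} [NormedAddCommGroup X] [InnerProductSpace ℝ X] [CompleteSpace X]
variable {T T₁ T₂ S : ℝ → X →L[ℝ] X} {P N : X →L[ℝ] X}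

/-- The Sylvester equation `A₂^* P + P A₁ + N = 0`, where `Aᵢ` is the generator of `Tᵢ`. -/
def IsSylvester (T₁ T₂ : ℝ → X →L[ℝ] X) (P N : X →L[ℝ] X) : Prop :=
  ∀ x y x' y', Gen T₁ x y → Gen T₂ x' y' → ⟪P y, x'⟫_ℝ + ⟪P x, y'⟫_ℝ + ⟪N x, x'⟫_ℝ = 0

theorem hasDerivWithinAt_inner (h₁ : IsC0Semigroup T₁) (h₂ : IsC0Semigroup T₂)
    (P : X →L[ℝ] X) {x y x' y' : X} (hg : Gen T₁ x y) (hg' : Gen T₂ x' y') {t : ℝ} (ht : 0 ≤ t) :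
    HasDerivWithinAt (fun s => ⟪P (T₁ s x), T₂ s x'⟫_ℝ)
      (⟪P (T₁ t x), T₂ t y'⟫_ℝ + ⟪P (T₁ t y), T₂ t x'⟫_ℝ) (Ioi t) t :=
  HasDerivWithinAt.inner ℝ
    (P.hasFDerivAt.comp_hasDerivWithinAt t (h₁.hasDerivWithinAt hg ht))
    (h₂.hasDerivWithinAt hg' ht)

theorem continuousOn_inner (h₁ : IsC0Semigroup T₁) (h₂ : IsC0Semigroup T₂)
    (P : X →L[ℝ] X) (x x' : X) : ContinuousOn (fun s => ⟪P (T₁ s x), T₂ s x'⟫_ℝ) (Ici 0) :=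
  (P.continuous.comp_continuousOn (h₁.continuousOn x)).inner (h₂.continuousOn x')

theorem continuousOn_sandwich (h₁ : IsC0Semigroup T₁) (h₂ : IsC0Semigroup T₂)
    (N : X →L[ℝ] X) (x : X) : ContinuousOn (fun s => adjoint (T₂ s) (N (T₁ s x))) (Ici 0) :=
  continuousOn_apply h₂.adjoint.continuousOn continuousOn_id
    (N.continuous.comp_continuousOn (h₁.continuousOn x)) fun _ hs => hs

/-- The integrated form of the Sylvester equation. -/
theorem IsSylvester.apply_eq (h₁ : IsC0Semigroup T₁) (h₂ : IsC0Semigroup T₂)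
    (h : IsSylvester T₁ T₂ P N) {t : ℝ} (ht : 0 ≤ t) (x : X) :
    P x = adjoint (T₂ t) (P (T₁ t x)) + ∫ s in (0 : ℝ)..t, adjoint (T₂ s) (N (T₁ s x)) := by
  obtain ⟨M₁, hM₁0, hM₁⟩ := IsC0Semigroup.exists_bound h₁.continuousOn t
  obtain ⟨M₂, hM₂0, hM₂⟩ := IsC0Semigroup.exists_bound h₂.continuousOn t
  obtain ⟨L, -, hL, -⟩ := exists_clm_integral (μ := volume.restrict (Ioc 0 t))
    (G := fun s => adjoint (T₂ s) ∘L N ∘L T₁ s) (g := fun _ => M₂ * (‖N‖ * M₁))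
    (fun x => ((continuousOn_sandwich h₁ h₂ N x).mono fun s hs => hs.1.le).aestronglyMeasurable
      measurableSet_Ioc)
    (integrable_const _) (by
      filter_upwards [ae_restrict_mem measurableSet_Ioc] with s hs
      refine (ContinuousLinearMap.opNorm_comp_le _ _).trans ?_
      rw [LinearIsometryEquiv.norm_map]
      gcongr
      · exact hM₂ _ hs.1.le hs.2
      refine (ContinuousLinearMap.opNorm_comp_le _ _).trans ?_
      gcongr
      exact hM₁ _ hs.1.le hs.2)
  have hL' : ∀ x, L x = ∫ s in (0 : ℝ)..t, adjoint (T₂ s) (N (T₁ s x)) := fun x => by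
    rw [hL, intervalIntegral.integral_of_le ht]; rfl
  -- Both sides are bounded, so it suffices to pair vectors of the two dense domains, where s ↦ ⟪P
  -- T₁(s) x, T₂(s) x'⟫ has right derivative -⟪N T₁(s) x, T₂(s) x'⟫ by the weak equation.
  have : P = adjoint (T₂ t) ∘L P ∘L T₁ t + L := by
    refine ContinuousLinearMap.coeFn_injective ?_
    refine Continuous.ext_on h₁.dense_gen P.continuous (ContinuousLinearMap.continuous _) ?_
    rintro x ⟨y, hg⟩
    refine Dense.eq_of_inner_left (𝕜 := ℝ) (S := {x | ∃ y, Gen T₂ x y}) h₂.dense_gen ?_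
    rintro x' ⟨y', hg'⟩
    have hI := ((continuousOn_inner h₁ h₂ N x x').mono
      (Icc_subset_Ici_self : Icc 0 t ⊆ Ici 0)).intervalIntegrable_of_Icc (μ := volume) ht
    have h3 := intervalIntegral.integral_eq_sub_of_hasDeriv_right_of_le ht
      ((continuousOn_inner h₁ h₂ P x x').mono Icc_subset_Ici_self)
      (f' := fun s => -⟪N (T₁ s x), T₂ s x'⟫_ℝ) (fun s hs => by
        have h4 := hasDerivWithinAt_inner h₁ h₂ P hg hg' hs.1.le
        have h5 := h _ _ _ _ (h₁.gen_apply hg hs.1.le) (h₂.gen_apply hg' hs.1.le)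
        have e : -⟪N (T₁ s x), T₂ s x'⟫_ℝ =
            ⟪P (T₁ s x), T₂ s y'⟫_ℝ + ⟪P (T₁ s y), T₂ s x'⟫_ℝ := by linarith
        rw [e]
        exact h4) hI.neg
    rw [intervalIntegral.integral_neg, h₁.zero_apply, h₂.zero_apply] at h3
    rw [add_apply, inner_add_left, hL', inner_intervalIntegral_left
      (((continuousOn_sandwich h₁ h₂ N x).mono Icc_subset_Ici_self).intervalIntegrable_of_Icc ht)]
    simp only [ContinuousLinearMap.comp_apply, ContinuousLinearMap.adjoint_inner_left]
    linarith
  have h6 := DFunLike.congr_fun this x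
  rwa [add_apply, hL'] at h6

theorem IsSylvester.inner_eq (h₁ : IsC0Semigroup T₁) (h₂ : IsC0Semigroup T₂)
    (h : IsSylvester T₁ T₂ P N) {t : ℝ} (ht : 0 ≤ t) (x x' : X) :
    ⟪P (T₁ t x), T₂ t x'⟫_ℝ + ∫ s in (0 : ℝ)..t, ⟪N (T₁ s x), T₂ s x'⟫_ℝ = ⟪P x, x'⟫_ℝ := by
  rw [h.apply_eq h₁ h₂ ht x, inner_add_left, inner_intervalIntegral_left
    (((continuousOn_sandwich h₁ h₂ N x).mono Icc_subset_Ici_self).intervalIntegrable_of_Icc ht)]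
  simp only [ContinuousLinearMap.adjoint_inner_left]

/-- Right differentiation of the integrated identity at t = 0. -/
theorem IsSylvester.of_inner_eq (h₁ : IsC0Semigroup T₁) (h₂ : IsC0Semigroup T₂)
    (h : ∀ t, 0 ≤ t → ∀ x x', ⟪P (T₁ t x), T₂ t x'⟫_ℝ +
      ∫ s in (0 : ℝ)..t, ⟪N (T₁ s x), T₂ s x'⟫_ℝ = ⟪P x, x'⟫_ℝ) : IsSylvester T₁ T₂ P N := by
  intro x y x' y' hg hg'
  have h3 := hasDerivWithinAt_Ioi_iff.1 (hasDerivWithinAt_inner h₁ h₂ P hg hg' le_rfl)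
  simp only [zero_add, h₁.zero_apply, h₂.zero_apply] at h3
  have h4 := (tendsto_average (continuousOn_inner h₁ h₂ N x x')).neg
  simp only [h₁.zero_apply, h₂.zero_apply] at h4
  have h5 := tendsto_nhds_unique (h3.congr' ?_) h4
  · linarith
  · filter_upwards [self_mem_nhdsWithin] with t ht
    rw [← h t (le_of_lt ht) x x', ← smul_neg]
    congr 1; ring

end Sylvester

/-! ### Exponential decay, Lyapunov integrals and Datko's theorem -/

section Stability

variable {X : Type*} [NormedAddCommGroup X] [InnerProductSpace ℝ X] [CompleteSpace X]
variable {T S : ℝ → X →L[ℝ] X} {P N : X →L[ℝ] X}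

theorem ExpDecay.adjoint (h : ExpDecay S) :
    ExpDecay fun t => ContinuousLinearMap.adjoint (S t) := by
  obtain ⟨c, ν, hc, hν, hb⟩ := h
  exact ⟨c, ν, hc, hν, fun t ht => by rw [LinearIsometryEquiv.norm_map]; exact hb t ht⟩

theorem ExpDecay.tendsto (h : ExpDecay S) : Tendsto (fun t => ‖S t‖) atTop (𝓝 0) := by
  obtain ⟨c, ν, hc, hν, hb⟩ := h
  refine squeeze_zero' (Eventually.of_forall fun _ => norm_nonneg _)
    ((eventually_ge_atTop 0).mono hb) ?_
  rw [← mul_zero c]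
  refine Tendsto.const_mul c (Real.tendsto_exp_atBot.comp ?_)
  exact tendsto_id.const_mul_atTop_of_neg (neg_neg_iff_pos.2 hν)

theorem ExpDecay.tendsto_apply (h : ExpDecay S) (x : X) : Tendsto (fun t => S t x) atTop (𝓝 0) := by
  refine squeeze_zero_norm (fun t => (S t).le_opNorm x) ?_
  simpa using h.tendsto.mul_const ‖x‖

/-- The observability type operator `∫₀^∞ S(t)^* N S(t) dt`. -/
theorem exists_lyapunov (hS : IsC0Semigroup S) (hd : ExpDecay S) (N : X →L[ℝ] X) :
    ∃ P : X →L[ℝ] X, ∀ x,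
      IntegrableOn (fun t => ContinuousLinearMap.adjoint (S t) (N (S t x))) (Ioi 0) ∧
      P x = ∫ t in Ioi (0 : ℝ), ContinuousLinearMap.adjoint (S t) (N (S t x)) := by
  obtain ⟨c, ν, hc, hν, hb⟩ := hd
  obtain ⟨L, h1, h2, -⟩ := exists_clm_integral (μ := volume.restrict (Ioi 0))
    (G := fun s => ContinuousLinearMap.adjoint (S s) ∘L N ∘L S s)
    (g := fun s => c * c * ‖N‖ * Real.exp (-(2 * ν) * s))
    (fun x => ((continuousOn_sandwich hS hS N x).mono Ioi_subset_Ici_self).aestronglyMeasurable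
      measurableSet_Ioi)
    ((exp_neg_integrableOn_Ioi 0 (by positivity)).const_mul _) (by
      filter_upwards [ae_restrict_mem measurableSet_Ioi] with s hs
      have hs : 0 ≤ s := le_of_lt hs
      refine (ContinuousLinearMap.opNorm_comp_le _ _).trans ?_
      rw [LinearIsometryEquiv.norm_map]
      calc ‖S s‖ * ‖N ∘L S s‖ ≤ (c * Real.exp (-ν * s)) * (‖N‖ * (c * Real.exp (-ν * s))) := by
            gcongr
            · exact hb s hs
            · refine (ContinuousLinearMap.opNorm_comp_le _ _).trans ?_
              gcongr
              exact hb s hs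
        _ = c * c * ‖N‖ * (Real.exp (-ν * s) * Real.exp (-ν * s)) := by ring
        _ = _ := by rw [← Real.exp_add]; congr 2; ring)
  exact ⟨L, fun x => ⟨h1 x, h2 x⟩⟩

/-- `P = ∫₀^∞ S(t)^* N S(t) dt`, as a convergent strong integral. -/
def IsLyapunov (S : ℝ → X →L[ℝ] X) (N P : X →L[ℝ] X) : Prop :=
  ∀ x, IntegrableOn (fun t => ContinuousLinearMap.adjoint (S t) (N (S t x))) (Ioi 0) ∧
      P x = ∫ t in Ioi (0 : ℝ), ContinuousLinearMap.adjoint (S t) (N (S t x))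

theorem IsLyapunov.tendsto (hS : IsC0Semigroup S) (h : IsLyapunov S N P) (x x' : X) :
    Tendsto (fun t => ∫ s in (0 : ℝ)..t, ⟪N (S s x), S s x'⟫_ℝ) atTop (𝓝 ⟪P x, x'⟫_ℝ) := by
  have h1 := Filter.Tendsto.inner (𝕜 := ℝ)
    (intervalIntegral_tendsto_integral_Ioi 0 (h x).1 tendsto_id) (tendsto_const_nhds (x := x'))
  rw [← (h x).2] at h1
  refine h1.congr' ?_
  filter_upwards [eventually_ge_atTop 0] with t ht
  rw [id, inner_intervalIntegral_left
    (((continuousOn_sandwich hS hS N x).mono Icc_subset_Ici_self).intervalIntegrable_of_Icc ht)]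
  simp only [ContinuousLinearMap.adjoint_inner_left]

/-- Split the integral over [0, ∞) at t; by the semigroup law its tail is the same form evaluated at
S(t)x and S(t)x'. -/
theorem IsLyapunov.inner_eq (hS : IsC0Semigroup S) (h : IsLyapunov S N P) {t : ℝ} (ht : 0 ≤ t)
    (x x' : X) :
    ⟪P (S t x), S t x'⟫_ℝ + ∫ s in (0 : ℝ)..t, ⟪N (S s x), S s x'⟫_ℝ = ⟪P x, x'⟫_ℝ := by
  have h1 := (h.tendsto hS (S t x) (S t x')).add_const (∫ s in (0 : ℝ)..t, ⟪N (S s x), S s x'⟫_ℝ)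
  have h2 := (h.tendsto hS x x').comp (tendsto_atTop_add_const_right atTop t tendsto_id)
  refine tendsto_nhds_unique (h1.congr' ?_) h2
  filter_upwards [eventually_ge_atTop 0] with b hb
  have hI : ∀ {c d : ℝ}, 0 ≤ c → c ≤ d →
      IntervalIntegrable (fun s => ⟪N (S s x), S s x'⟫_ℝ) volume c d := fun hc hcd =>
    ((continuousOn_inner hS hS N x x').mono
      fun s hs => hc.trans hs.1).intervalIntegrable_of_Icc hcd
  have h3 := intervalIntegral.integral_comp_add_right (a := 0) (b := b)
    (fun s => ⟪N (S s x), S s x'⟫_ℝ) t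
  have h4 : ∫ s in (0 : ℝ)..b, ⟪N (S s (S t x)), S s (S t x')⟫_ℝ =
      ∫ s in (0 : ℝ)..b, ⟪N (S (s + t) x), S (s + t) x'⟫_ℝ := by
    refine intervalIntegral.integral_congr fun s hs => ?_
    rw [uIcc_of_le hb] at hs
    rw [hS.add_apply hs.1 ht, hS.add_apply hs.1 ht]
  simp only [Function.comp, id]
  rw [h4, h3, zero_add, add_comm, intervalIntegral.integral_add_adjacent_intervals
    (hI le_rfl ht) (hI ht (by linarith))]

theorem IsLyapunov.isSylvester (hS : IsC0Semigroup S) (h : IsLyapunov S N P) :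
    IsSylvester S S P N :=
  IsSylvester.of_inner_eq hS hS fun _ ht => h.inner_eq hS ht

theorem IsLyapunov.isPositive (hS : IsC0Semigroup S) (h : IsLyapunov S N P) (hN : N.IsPositive) :
    P.IsPositive := by
  rw [ContinuousLinearMap.isPositive_iff]
  constructor
  · intro x x'
    refine tendsto_nhds_unique (h.tendsto hS x x') ?_
    rw [real_inner_comm]
    refine (h.tendsto hS x' x).congr fun t => intervalIntegral.integral_congr fun s _ => ?_
    rw [hN.inner_left_eq_inner_right, real_inner_comm]
  · intro x
    refine ge_of_tendsto (h.tendsto hS x x) ?_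
    filter_upwards [eventually_ge_atTop 0] with t ht
    exact intervalIntegral.integral_nonneg ht fun s _ => hN.inner_nonneg_left _

/-- Datko's theorem: square integrability of all trajectories implies exponential stability. -/
theorem expDecay_of_integral_le (hS : IsC0Semigroup S) {c : ℝ} (hc : 0 ≤ c)
    (h : ∀ x t, 0 ≤ t → ∫ s in (0 : ℝ)..t, ‖S s x‖ ^ 2 ≤ c * ‖x‖ ^ 2) : ExpDecay S := by
  obtain ⟨M, hM0, hM⟩ := IsC0Semigroup.exists_bound hS.continuousOn 1
  have hcont : ∀ x, ContinuousOn (fun s => ‖S s x‖ ^ 2) (Ici 0) := fun x =>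
    (hS.continuousOn x).norm.pow 2
  have hI : ∀ x {a b : ℝ}, 0 ≤ a → a ≤ b →
      IntervalIntegrable (fun s => ‖S s x‖ ^ 2) volume a b := fun x a b ha hab =>
    ((hcont x).mono fun s hs => ha.trans hs.1).intervalIntegrable_of_Icc hab
  -- Write S(t) = S(t - s) S(s) and integrate over s in [a, t]. A window of length 1 yields a
  -- uniform bound for t ≥ 1; the full window [0, t] then yields decay.
  have key : ∀ (a t m : ℝ), 0 ≤ a → a ≤ t → 0 < m → (∀ r, 0 ≤ r → r ≤ t - a → ‖S r‖ ≤ m) →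
      ∀ x, (t - a) * ‖S t x‖ ^ 2 ≤ m ^ 2 * (c * ‖x‖ ^ 2) := by
    intro a t m ha hat hm hr x
    have h1 : ∫ s in a..t, ‖S t x‖ ^ 2 ≤ ∫ s in a..t, m ^ 2 * ‖S s x‖ ^ 2 := by
      refine intervalIntegral.integral_mono_on hat (by simp) ((hI x ha hat).const_mul _) ?_
      intro s hs
      have : S t x = S (t - s) (S s x) := by
        rw [← hS.add_apply (sub_nonneg.2 hs.2) (ha.trans hs.1), sub_add_cancel]
      rw [this, ← mul_pow]
      gcongr
      exact (S (t - s)).le_of_opNorm_le (hr _ (sub_nonneg.2 hs.2) (by linarith [hs.1])) _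
    rw [intervalIntegral.integral_const, intervalIntegral.integral_const_mul, smul_eq_mul] at h1
    refine h1.trans ?_
    gcongr
    refine le_trans ?_ (h x t (ha.trans hat))
    rw [← intervalIntegral.integral_add_adjacent_intervals (hI x le_rfl ha) (hI x ha hat)]
    have : 0 ≤ ∫ s in (0 : ℝ)..a, ‖S s x‖ ^ 2 :=
      intervalIntegral.integral_nonneg ha fun s _ => by positivity
    linarith
  have hbd : ∃ M', 0 < M' ∧ ∀ t, 0 ≤ t → ‖S t‖ ≤ M' := by
    refine ⟨M + M * Real.sqrt c, by positivity, fun t ht => ?_⟩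
    rcases le_total t 1 with h1 | h1
    · exact (hM t ht h1).trans (by have := Real.sqrt_nonneg c; nlinarith)
    · refine (ContinuousLinearMap.opNorm_le_bound _ (by positivity) fun x => ?_).trans
        (le_add_of_nonneg_left hM0.le)
      have h2 := key (t - 1) t M (by linarith) (by linarith) hM0
        (fun r h0 h1 => hM r h0 (by linarith)) x
      rw [sub_sub_cancel, one_mul] at h2
      refine abs_le_of_sq_le_sq' ?_ (by positivity) |>.2
      refine h2.trans (le_of_eq ?_)
      rw [mul_pow, mul_pow, Real.sq_sqrt hc]; ring
  obtain ⟨M', hM'0, hM'⟩ := hbd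
  -- Chosen so that M'²c ≤ τ/4, which turns `key` into ‖S τ‖ ≤ 1/2; the summand 1 makes τ positive
  -- when c = 0.
  set τ : ℝ := 4 * (M' ^ 2 * c) + 1 with hτ
  have hτ0 : 0 < τ := by positivity
  have hhalf : ‖S τ‖ ≤ 1 / 2 := by
    refine ContinuousLinearMap.opNorm_le_bound _ (by norm_num) fun x => ?_
    have h2 := key 0 τ M' le_rfl hτ0.le hM'0 (fun r h0 _ => hM' r h0) x
    rw [sub_zero] at h2
    refine abs_le_of_sq_le_sq' ?_ (by positivity) |>.2
    have h3 : M' ^ 2 * (c * ‖x‖ ^ 2) ≤ τ * (1 / 2 * ‖x‖) ^ 2 := by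
      rw [hτ]; nlinarith [sq_nonneg ‖x‖]
    exact le_of_mul_le_mul_left (h2.trans h3) hτ0
  have hpow : ∀ (n : ℕ) (r : ℝ), 0 ≤ r → ‖S (n * τ + r)‖ ≤ (1 / 2) ^ n * M' := by
    intro n
    induction n with
    | zero => intro r hr; simpa using hM' r hr
    | succ n ih =>
      intro r hr
      have : S ((n + 1 : ℕ) * τ + r) = S τ ∘L S (n * τ + r) := by
        rw [← hS.map_add _ _ hτ0.le (by positivity)]
        congr 1; push_cast; ring
      rw [this, pow_succ', mul_assoc]
      refine (ContinuousLinearMap.opNorm_comp_le _ _).trans ?_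
      gcongr
      exact ih r hr
  -- Halving in each period τ gives the rate log 2 / τ; the factor 2 pays for replacing t/τ by its
  -- integer part.
  refine ⟨2 * M', Real.log 2 / τ, by positivity, by positivity, fun t ht => ?_⟩
  set n := ⌊t / τ⌋₊ with hn
  have h1 : (n : ℝ) * τ ≤ t := by
    rw [← le_div_iff₀ hτ0]; exact Nat.floor_le (by positivity)
  have h2 := hpow n (t - n * τ) (sub_nonneg.2 h1)
  rw [add_sub_cancel] at h2
  refine h2.trans ?_
  have h3 : t / τ ≤ n + 1 := (Nat.lt_floor_add_one _).le
  have h4 : ((1 : ℝ) / 2) ^ n = Real.exp (-Real.log 2 * n) := by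
    rw [mul_comm, Real.exp_nat_mul, Real.exp_neg, Real.exp_log two_pos, one_div]
  have h5 : Real.exp (-Real.log 2 * n) ≤ 2 * Real.exp (-(Real.log 2 / τ) * t) := by
    have : 2 * Real.exp (-(Real.log 2 / τ) * t) = Real.exp (Real.log 2 + -(Real.log 2 / τ) * t) := by
      rw [Real.exp_add, Real.exp_log two_pos]
    rw [this, Real.exp_le_exp]
    have h6 : Real.log 2 / τ * t = Real.log 2 * (t / τ) := by ring
    have := Real.log_pos one_lt_two
    nlinarith
  rw [h4]
  calc _ ≤ (2 * Real.exp (-(Real.log 2 / τ) * t)) * M' := by gcongr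
    _ = _ := by ring

end Stability

/-! ### Positive operators and monotone strong limits -/

section Positive

variable {X Y : Type*} [NormedAddCommGroup X] [InnerProductSpace ℝ X] [CompleteSpace X]
  [NormedAddCommGroup Y] [InnerProductSpace ℝ Y] [CompleteSpace Y]

/-- Evaluate the quadratic form of D at x - M⁻¹ D x, where it is nonnegative. This turns control of
the form into control of the vector D x. -/
theorem norm_sq_apply_le_of_isPositive {D : X →L[ℝ] X} (hD : D.IsPositive) {M : ℝ} (hM : 0 < M)
    (hb : ∀ v, ⟪D v, v⟫_ℝ ≤ M * ‖v‖ ^ 2) (x : X) : ‖D x‖ ^ 2 ≤ M * ⟪D x, x⟫_ℝ := by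
  have h1 := hD.inner_nonneg_left (x - M⁻¹ • D x)
  have h2 := hb (D x)
  have h3 : ⟪D (D x), x⟫_ℝ = ‖D x‖ ^ 2 := by
    rw [hD.inner_left_eq_inner_right, real_inner_self_eq_norm_sq]
  simp only [map_sub, map_smul, inner_sub_left, inner_sub_right, inner_smul_left,
    inner_smul_right, real_inner_self_eq_norm_sq, h3, conj_trivial] at h1
  have h4 : M⁻¹ * (M⁻¹ * ⟪D (D x), D x⟫_ℝ) ≤ M⁻¹ * ‖D x‖ ^ 2 := by
    calc _ ≤ M⁻¹ * (M⁻¹ * (M * ‖D x‖ ^ 2)) := by gcongr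
      _ = _ := by field_simp
  have h5 : M⁻¹ * ‖D x‖ ^ 2 ≤ ⟪D x, x⟫_ℝ := by linarith
  rwa [inv_mul_le_iff₀ hM] at h5

theorem norm_sq_apply_le {D : X →L[ℝ] X} (hD : D.IsPositive) (x : X) :
    ‖D x‖ ^ 2 ≤ (‖D‖ + 1) * ⟪D x, x⟫_ℝ := by
  refine norm_sq_apply_le_of_isPositive hD (by positivity) (fun v => ?_) x
  calc ⟪D v, v⟫_ℝ ≤ ‖D v‖ * ‖v‖ := real_inner_le_norm _ _
    _ ≤ ((‖D‖ + 1) * ‖v‖) * ‖v‖ := by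
        gcongr
        exact D.le_of_opNorm_le (by linarith) v
    _ = _ := by ring

/-- A decreasing sequence of positive operators converges strongly. -/
theorem exists_strong_limit {P : ℕ → X →L[ℝ] X} (hP : ∀ n, (P n).IsPositive)
    (hdec : ∀ n x, ⟪P (n + 1) x, x⟫_ℝ ≤ ⟪P n x, x⟫_ℝ) :
    ∃ L : X →L[ℝ] X, L.IsPositive ∧ ∀ x, Tendsto (fun n => P n x) atTop (𝓝 (L x)) := by
  have hanti : ∀ x, Antitone fun n => ⟪P n x, x⟫_ℝ := fun x =>
    antitone_nat_of_succ_le fun n => hdec n x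
  -- The difference P m - P n is positive and dominated as a form by P 0, so convergence of the
  -- decreasing real sequence ⟪P n x, x⟫ makes P n x a Cauchy sequence.
  have hD : ∀ m n, m ≤ n → ∀ x, ‖P m x - P n x‖ ^ 2 ≤
      (‖P 0‖ + 1) * (⟪P m x, x⟫_ℝ - ⟪P n x, x⟫_ℝ) := by
    intro m n hmn x
    have hpos : (P m - P n).IsPositive := by
      rw [ContinuousLinearMap.isPositive_iff]
      refine ⟨(hP m).isSymmetric.sub (hP n).isSymmetric, fun x => ?_⟩
      rw [sub_apply, inner_sub_left, sub_nonneg]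
      exact hanti x hmn
    have := norm_sq_apply_le_of_isPositive hpos (M := ‖P 0‖ + 1) (by positivity) (fun v => ?_) x
    · simpa [inner_sub_left] using this
    · rw [sub_apply, inner_sub_left]
      have h1 := hanti v (Nat.zero_le m)
      have h2 := (hP n).inner_nonneg_left v
      have h3 : ⟪P 0 v, v⟫_ℝ ≤ ‖P 0‖ * ‖v‖ * ‖v‖ :=
        (real_inner_le_norm _ _).trans (by gcongr; exact (P 0).le_opNorm v)
      simp only at h1
      nlinarith [sq_nonneg ‖v‖]
  have hlim : ∀ x, ∃ y, Tendsto (fun n => P n x) atTop (𝓝 y) := by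
    intro x
    have hbdd : BddBelow (range fun n => ⟪P n x, x⟫_ℝ) :=
      ⟨0, by rintro _ ⟨n, rfl⟩; exact (hP n).inner_nonneg_left x⟩
    have hc := (tendsto_atTop_ciInf (hanti x) hbdd).cauchySeq
    refine cauchySeq_tendsto_of_complete (Metric.cauchySeq_iff'.2 fun ε hε => ?_)
    obtain ⟨n₀, hn₀⟩ := Metric.cauchySeq_iff'.1 hc (ε ^ 2 / (‖P 0‖ + 1)) (by positivity)
    refine ⟨n₀, fun n hn => ?_⟩
    have h1 := hD n₀ n hn x
    have h2 := hn₀ n hn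
    rw [Real.dist_eq, abs_sub_comm, lt_div_iff₀ (by positivity)] at h2
    rw [dist_comm, dist_eq_norm]
    refine lt_of_pow_lt_pow_left₀ 2 hε.le (h1.trans_lt ?_)
    nlinarith [le_abs_self (⟪P n₀ x, x⟫_ℝ - ⟪P n x, x⟫_ℝ), norm_nonneg (P 0)]
  choose f hf using hlim
  let L := continuousLinearMapOfTendsto (fun n => P n) (tendsto_pi_nhds.2 hf)
  have hL : ∀ x, Tendsto (fun n => P n x) atTop (𝓝 (L x)) := hf
  refine ⟨L, ?_, hL⟩
  rw [ContinuousLinearMap.isPositive_iff]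
  constructor
  · intro x y
    refine tendsto_nhds_unique ((hL x).inner (𝕜 := ℝ) (tendsto_const_nhds (x := y))) ?_
    refine ((tendsto_const_nhds (x := x)).inner (𝕜 := ℝ) (hL y)).congr fun n => ?_
    exact ((hP n).inner_left_eq_inner_right x y).symm
  · intro x
    exact ge_of_tendsto ((hL x).inner (𝕜 := ℝ) (tendsto_const_nhds (x := x)))
      (Eventually.of_forall fun n => (hP n).inner_nonneg_left x)

theorem isPositive_inverse {Q : X →L[ℝ] X} (hQ : Q.IsPositive) (hu : IsUnit Q) :
    (Ring.inverse Q).IsPositive := by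
  have h1 : ∀ x, Q (Ring.inverse Q x) = x := fun x =>
    DFunLike.congr_fun (Ring.mul_inverse_cancel Q hu) x
  rw [ContinuousLinearMap.isPositive_iff]
  constructor
  · intro x y
    change ⟪Ring.inverse Q x, y⟫_ℝ = ⟪x, Ring.inverse Q y⟫_ℝ
    conv_lhs => rw [← h1 y]
    conv_rhs => rw [← h1 x]
    rw [hQ.inner_left_eq_inner_right]
  · intro x
    have := hQ.inner_nonneg_right (Ring.inverse Q x)
    rwa [h1] at this

theorem isPositive_BQB {B : X →L[ℝ] Y} {Q : X →L[ℝ] X} (hQ : Q.IsPositive) (hu : IsUnit Q) :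
    (BQB B Q).IsPositive :=
  (isPositive_inverse hQ hu).conj_adjoint B

theorem isPositive_CC (C : X →L[ℝ] Y) : (CC C).IsPositive := by
  rw [ContinuousLinearMap.isPositive_iff]
  constructor
  · intro x y
    change ⟪adjoint C (C x), y⟫_ℝ = ⟪x, adjoint C (C y)⟫_ℝ
    rw [ContinuousLinearMap.adjoint_inner_left, ContinuousLinearMap.adjoint_inner_right]
  · intro x
    change 0 ≤ ⟪adjoint C (C x), x⟫_ℝ
    rw [ContinuousLinearMap.adjoint_inner_left]
    exact real_inner_self_nonneg

theorem inner_CC (C : X →L[ℝ] Y) (x y : X) : ⟪CC C x, y⟫_ℝ = ⟪C x, C y⟫_ℝ := by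
  change ⟪adjoint C (C x), y⟫_ℝ = _
  rw [ContinuousLinearMap.adjoint_inner_left]

theorem isPositive_sandwich {P W : X →L[ℝ] X} (hP : P.IsPositive)
    (hW : W.IsPositive) : (P ∘L W ∘L P).IsPositive := by
  have := hW.conj_adjoint P
  rwa [hP.isSelfAdjoint.adjoint_eq] at this

end Positive

/-! ### From unbounded operators to semigroup identities -/

section Bridge

variable {X U V : Type*}
  [NormedAddCommGroup X] [InnerProductSpace ℝ X] [CompleteSpace X]
  [NormedAddCommGroup U] [InnerProductSpace ℝ U] [CompleteSpace U]
  [NormedAddCommGroup V] [InnerProductSpace ℝ V] [CompleteSpace V]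
  {A : X →ₗ.[ℝ] X} {T S : ℝ → X →L[ℝ] X} {B : U →L[ℝ] X} {C : X →L[ℝ] V} {Q : U →L[ℝ] U}

theorem mem_graph_boundedPerturbation {K : X →L[ℝ] X} {x y : X} :
    (x, y) ∈ (boundedPerturbation A K).graph ↔ (x, y - K x) ∈ A.graph := by
  simp only [LinearPMap.mem_graph_iff, boundedPerturbation]
  constructor
  · rintro ⟨z, rfl, h⟩
    exact ⟨z, rfl, by rw [← h, LinearPMap.vadd_apply]; simp⟩
  · rintro ⟨z, rfl, h⟩
    exact ⟨z, rfl, by rw [LinearPMap.vadd_apply]; simp [h]⟩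

theorem IsGeneratorOf.dense_domain (hT : IsGeneratorOf A T) : Dense (A.domain : Set X) := by
  refine hT.semigroup.dense_gen.mono ?_
  rintro x ⟨y, hg⟩
  exact LinearPMap.mem_domain_of_mem_graph ((hT.mem_graph_iff x y).2 hg)

theorem isGeneratorOf_boundedPerturbation {K : X →L[ℝ] X} (hT : IsGeneratorOf A T)
    (hS : IsC0Semigroup S) (h : IsDuhamel T K S) :
    IsGeneratorOf (boundedPerturbation A K) S :=
  ⟨hS, fun x y => by
    rw [mem_graph_boundedPerturbation, hT.mem_graph_iff]
    exact (h.gen_iff hT.semigroup hS).symm⟩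

theorem ExpStabilizable.exists_duhamel (hT : IsGeneratorOf A T) (h : ExpStabilizable A B) :
    ∃ (K : X →L[ℝ] U) (F : ℝ → X →L[ℝ] X), IsC0Semigroup F ∧ ExpDecay F ∧
      IsDuhamel T (B ∘L K) F := by
  obtain ⟨K, F, hF, hd⟩ := h
  refine ⟨K, F, hF.semigroup, hd, isDuhamel_of_gen hT.semigroup hF.semigroup fun x y hg => ?_⟩
  rw [Gen, ← hT.mem_graph_iff, ← mem_graph_boundedPerturbation, hF.mem_graph_iff]
  exact hg

/-- The hypothesis provides a stable semigroup R for A^* + C^*K. By `gen_adjoint` it is a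
perturbation of the adjoint semigroup of T; taking adjoints once more gives a stable perturbation of
T itself with output injection H = K^*. -/
theorem ExpDetectable.exists_duhamel (hT : IsGeneratorOf A T) (h : ExpDetectable A C) :
    ∃ (H : V →L[ℝ] X) (F : ℝ → X →L[ℝ] X), IsC0Semigroup F ∧ ExpDecay F ∧
      IsDuhamel T (H ∘L C) F := by
  obtain ⟨K, R, hR, hd⟩ := h
  have h1 : IsDuhamel (fun t => adjoint (T t)) (adjoint C ∘L K) R := by
    refine isDuhamel_of_gen hT.semigroup.adjoint hR.semigroup fun x y hg => ?_
    refine hT.semigroup.gen_adjoint fun x' y' hg' => ?_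
    have h2 := (hR.mem_graph_iff x y).2 hg
    rw [mem_graph_boundedPerturbation, LinearPMap.mem_graph_iff] at h2
    obtain ⟨z, hz, hz'⟩ := h2
    have h3 := (hT.mem_graph_iff x' y').2 hg'
    rw [LinearPMap.mem_graph_iff] at h3
    obtain ⟨w, hw, hw'⟩ := h3
    have h4 := LinearPMap.adjoint_isFormalAdjoint hT.dense_domain z w
    rw [hw', hz', hz, hw] at h4
    exact h4
  have h2 := h1.adjoint hT.semigroup.adjoint hR.semigroup
  refine ⟨adjoint K, _, hR.semigroup.adjoint, hd.adjoint, ?_⟩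
  simpa [ContinuousLinearMap.adjoint_comp] using h2

/-- The weak form carries the domain condition: it expresses w ↦ ⟪P z, A w⟫ as the pairing of w with
a fixed vector, which puts P z in the domain of A^* and computes its image. -/
theorem isRiccatiSolution_iff (hT : IsGeneratorOf A T) {P : X →L[ℝ] X} :
    IsRiccatiSolution A B C Q P ↔
      P.IsPositive ∧ IsSylvester T T P (CC C - P ∘L BQB B Q ∘L P) := by
  constructor
  · rintro ⟨hP, he⟩
    refine ⟨hP, fun x y x' y' hg hg' => ?_⟩
    obtain ⟨z, rfl, rfl⟩ := (LinearPMap.mem_graph_iff _).1 ((hT.mem_graph_iff _ _).2 hg)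
    obtain ⟨w, rfl, rfl⟩ := (LinearPMap.mem_graph_iff _).1 ((hT.mem_graph_iff _ _).2 hg')
    obtain ⟨hz, e⟩ := he z
    have h4 := LinearPMap.adjoint_isFormalAdjoint hT.dense_domain ⟨P z, hz⟩ w
    have h5 := congrArg (fun v => ⟪v, (w : X)⟫_ℝ) e
    simp only [inner_add_left, inner_sub_left, inner_zero_left] at h5
    simp only [sub_apply, ContinuousLinearMap.comp_apply, inner_sub_left]
    rw [h4] at h5
    simp only at h5
    linarith
  · rintro ⟨hP, he⟩
    refine ⟨hP, fun z => ?_⟩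
    set v : X := -(P (A z) - P (BQB B Q (P z)) + CC C z) with hv
    have key : ∀ w : A.domain, ⟪v, (w : X)⟫_ℝ = ⟪P z, A w⟫_ℝ := by
      intro w
      have h := he z (A z) w (A w) ((hT.mem_graph_iff _ _).1 (A.mem_graph z))
        ((hT.mem_graph_iff _ _).1 (A.mem_graph w))
      simp only [sub_apply, ContinuousLinearMap.comp_apply, inner_sub_left] at h
      simp only [hv, inner_neg_left, inner_add_left, inner_sub_left]
      linarith
    have hm : P z ∈ A.adjoint.domain := LinearPMap.mem_adjoint_domain_of_exists _ ⟨v, key⟩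
    refine ⟨hm, ?_⟩
    rw [LinearPMap.adjoint_apply_eq hT.dense_domain ⟨P z, hm⟩ key, hv]
    abel

end Bridge

/-! ### The algebraic Riccati equation -/

section Riccati

variable {X U V : Type*}
  [NormedAddCommGroup X] [InnerProductSpace ℝ X] [CompleteSpace X]
  [NormedAddCommGroup U] [InnerProductSpace ℝ U] [CompleteSpace U]
  [NormedAddCommGroup V] [InnerProductSpace ℝ V] [CompleteSpace V]
  {T T₁ T₂ S S₁ S₂ F : ℝ → X →L[ℝ] X} {B : U →L[ℝ] X} {C : X →L[ℝ] V} {Q : U →L[ℝ] U}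
  {P N N' K K₁ K₂ W : X →L[ℝ] X}

theorem IsSylvester.congr (h : IsSylvester T₁ T₂ P N) (hN : ∀ x x', ⟪N x, x'⟫_ℝ = ⟪N' x, x'⟫_ℝ) :
    IsSylvester T₁ T₂ P N' := fun x y x' y' hg hg' => by
  rw [← hN]; exact h x y x' y' hg hg'

/-- Bounded perturbations keep the domains, so only the source term changes. Every passage between
the open loop and a closed loop is an application of this rule. -/
theorem IsSylvester.perturb (hT₁ : IsC0Semigroup T₁) (hT₂ : IsC0Semigroup T₂)
    (hS₁ : IsC0Semigroup S₁) (hS₂ : IsC0Semigroup S₂) (h : IsSylvester T₁ T₂ P N)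
    (h₁ : IsDuhamel T₁ K₁ S₁) (h₂ : IsDuhamel T₂ K₂ S₂) :
    IsSylvester S₁ S₂ P (N - P ∘L K₁ - adjoint K₂ ∘L P) := by
  intro x y x' y' hg hg'
  have := h _ _ _ _ ((h₁.gen_iff hT₁ hS₁).1 hg) ((h₂.gen_iff hT₂ hS₂).1 hg')
  simp only [map_sub, inner_sub_left, inner_sub_right] at this
  simp only [sub_apply, inner_sub_left, ContinuousLinearMap.comp_apply,
    ContinuousLinearMap.adjoint_inner_left]
  linarith

/-- Detectability: a feedback semigroup with finite cost is exponentially stable. -/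
theorem expDecay_of_detectable (hT : IsC0Semigroup T) (hF : IsC0Semigroup F) (hFd : ExpDecay F)
    {H : V →L[ℝ] X} (hFH : IsDuhamel T (H ∘L C) F) (hS : IsC0Semigroup S)
    (hW : W.IsPositive) (hSP : IsDuhamel T (-(W ∘L P)) S) {c : ℝ} (hc : 0 ≤ c)
    (hcost : ∀ x t, 0 ≤ t →
      ∫ s in (0 : ℝ)..t, (⟪C (S s x), C (S s x)⟫_ℝ + ⟪W (P (S s x)), P (S s x)⟫_ℝ) ≤
        c * ‖x‖ ^ 2) : ExpDecay S := by
  -- With Z = ∫ F^*F, use v ↦ ⟪Z v, v⟫ as a Lyapunov function for S, regarded as the perturbation of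
  -- F by L. Its derivative along S is -‖v‖² + 2⟪Z v, L v⟫, and L v involves v only through W P v
  -- and C v, which the cost controls.
  obtain ⟨Z, hZ⟩ := exists_lyapunov hF hFd 1
  have hZ : IsLyapunov F 1 Z := hZ
  have hZpos := hZ.isPositive hF ContinuousLinearMap.isPositive_one
  set L : X →L[ℝ] X := -(W ∘L P) - H ∘L C with hL
  have hFS : IsDuhamel F L S := by
    refine isDuhamel_of_gen hF hS fun x y hg => ?_
    rw [hFH.gen_iff hT hF]
    have := (hSP.gen_iff hT hS).1 hg
    convert this using 1
    simp [hL]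
    abel
  have hSyl := (hZ.isSylvester hF).perturb hF hF hS hS hFS hFS
  -- The cross term satisfies 2⟪Z v, L v⟫ ≤ ‖v‖²/2 + 2‖Z‖²‖L v‖². The first part is absorbed; in the
  -- second, ‖L v‖² is at most twice ‖H‖²‖C v‖² + (‖W‖ + 1)⟪W P v, P v⟫.
  set k : ℝ := 4 * ‖Z‖ ^ 2 * (‖H‖ ^ 2 + (‖W‖ + 1)) with hk
  have hk0 : 0 ≤ k := by positivity
  have hpt : ∀ v, 1 / 2 * ‖v‖ ^ 2 ≤ ⟪((1 : X →L[ℝ] X) - Z ∘L L - adjoint L ∘L Z) v, v⟫_ℝ +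
      k * (⟪C v, C v⟫_ℝ + ⟪W (P v), P v⟫_ℝ) := by
    intro v
    have e1 : ⟪((1 : X →L[ℝ] X) - Z ∘L L - adjoint L ∘L Z) v, v⟫_ℝ =
        ‖v‖ ^ 2 - 2 * ⟪Z v, L v⟫_ℝ := by
      simp only [sub_apply, inner_sub_left, ContinuousLinearMap.comp_apply,
        ContinuousLinearMap.adjoint_inner_left, one_apply_eq_self,
        real_inner_self_eq_norm_sq]
      rw [hZpos.inner_left_eq_inner_right, real_inner_comm]
      ring
    have b1 : ⟪Z v, L v⟫_ℝ ≤ (‖Z‖ * ‖v‖) * ‖L v‖ :=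
      (real_inner_le_norm _ _).trans (by gcongr; exact Z.le_opNorm v)
    have b2 : ‖L v‖ ≤ ‖W (P v)‖ + ‖H‖ * ‖C v‖ := by
      have : L v = -(W (P v)) - H (C v) := by simp [hL]
      rw [this]
      refine (norm_sub_le _ _).trans ?_
      rw [norm_neg]
      gcongr
      exact H.le_opNorm _
    have b3 := norm_sq_apply_le hW (P v)
    have b4 : ‖L v‖ ^ 2 ≤ 2 * ‖W (P v)‖ ^ 2 + 2 * (‖H‖ ^ 2 * ‖C v‖ ^ 2) := by
      have : ‖L v‖ ^ 2 ≤ (‖W (P v)‖ + ‖H‖ * ‖C v‖) ^ 2 := by gcongr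
      nlinarith [sq_nonneg (‖W (P v)‖ - ‖H‖ * ‖C v‖)]
    have b5 : 2 * ((‖Z‖ * ‖v‖) * ‖L v‖) ≤ 1 / 2 * ‖v‖ ^ 2 + 2 * ‖Z‖ ^ 2 * ‖L v‖ ^ 2 := by
      nlinarith [sq_nonneg (1 / 2 * ‖v‖ - ‖Z‖ * ‖L v‖)]
    have b6 : 2 * ‖Z‖ ^ 2 * ‖L v‖ ^ 2 ≤ k * (‖C v‖ ^ 2 + ⟪W (P v), P v⟫_ℝ) := by
      have hw := hW.inner_nonneg_left (P v)
      calc 2 * ‖Z‖ ^ 2 * ‖L v‖ ^ 2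
          ≤ 2 * ‖Z‖ ^ 2 * (2 * ((‖W‖ + 1) * ⟪W (P v), P v⟫_ℝ) +
              2 * (‖H‖ ^ 2 * ‖C v‖ ^ 2)) := by gcongr; linarith
        _ = 4 * ‖Z‖ ^ 2 * ((‖W‖ + 1) * ⟪W (P v), P v⟫_ℝ + ‖H‖ ^ 2 * ‖C v‖ ^ 2) := by ring
        _ ≤ 4 * ‖Z‖ ^ 2 * ((‖H‖ ^ 2 + (‖W‖ + 1)) * ⟪W (P v), P v⟫_ℝ +
              (‖H‖ ^ 2 + (‖W‖ + 1)) * ‖C v‖ ^ 2) := by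
            have h0 := norm_nonneg W
            have h1 := sq_nonneg ‖H‖
            refine mul_le_mul_of_nonneg_left (add_le_add (mul_le_mul_of_nonneg_right ?_ hw)
              (mul_le_mul_of_nonneg_right ?_ (sq_nonneg _))) (by positivity) <;> linarith
        _ = _ := by rw [hk]; ring
    rw [e1, real_inner_self_eq_norm_sq]
    linarith
  refine expDecay_of_integral_le hS (c := 2 * (‖Z‖ + k * c)) (by positivity) fun x t ht => ?_
  have hI1 := ((continuousOn_inner hS hS ((1 : X →L[ℝ] X) - Z ∘L L - adjoint L ∘L Z) x x).mono
    (Icc_subset_Ici_self : Icc 0 t ⊆ Ici 0)).intervalIntegrable_of_Icc (μ := volume) ht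
  have hSx : ContinuousOn (fun s => S s x) (Icc 0 t) :=
    (hS.continuousOn x).mono Icc_subset_Ici_self
  have hI2 : IntervalIntegrable (fun s => ⟪C (S s x), C (S s x)⟫_ℝ + ⟪W (P (S s x)), P (S s x)⟫_ℝ)
      volume 0 t := by
    refine ContinuousOn.intervalIntegrable_of_Icc ht ?_
    have h1 := C.continuous.comp_continuousOn hSx
    have h2 := P.continuous.comp_continuousOn hSx
    exact (h1.inner h1).add ((W.continuous.comp_continuousOn h2).inner h2)
  have h1 : ∫ s in (0 : ℝ)..t, 1 / 2 * ‖S s x‖ ^ 2 ≤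
      (∫ s in (0 : ℝ)..t, ⟪((1 : X →L[ℝ] X) - Z ∘L L - adjoint L ∘L Z) (S s x), S s x⟫_ℝ) +
      k * ∫ s in (0 : ℝ)..t, (⟪C (S s x), C (S s x)⟫_ℝ + ⟪W (P (S s x)), P (S s x)⟫_ℝ) := by
    rw [← intervalIntegral.integral_const_mul, ← intervalIntegral.integral_add hI1
      (hI2.const_mul k)]
    refine intervalIntegral.integral_mono_on ht ?_ (hI1.add (hI2.const_mul k)) fun s _ => hpt _
    exact ((hSx.norm.pow 2).intervalIntegrable_of_Icc ht).const_mul _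
  rw [intervalIntegral.integral_const_mul] at h1
  have h2 := hSyl.inner_eq hS hS ht x x
  have h3 := hZpos.inner_nonneg_left (S t x)
  have h4 : ⟪Z x, x⟫_ℝ ≤ ‖Z‖ * ‖x‖ ^ 2 := by
    refine (real_inner_le_norm _ _).trans ?_
    rw [pow_two, ← mul_assoc]
    gcongr
    exact Z.le_opNorm x
  have h5 := mul_le_mul_of_nonneg_left (hcost x t ht) hk0
  linarith

/-- A nonnegative solution of the Riccati inequality. -/
def IsRiccatiSuper (T : ℝ → X →L[ℝ] X) (W N P : X →L[ℝ] X) : Prop :=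
  P.IsPositive ∧ ∃ R : X →L[ℝ] X, R.IsPositive ∧ IsSylvester T T P (N - P ∘L W ∘L P + R)

/-- The closed-loop Lyapunov equation of a solution of the Riccati inequality. -/
theorem isSylvester_closedLoop (hT : IsC0Semigroup T) (hS : IsC0Semigroup S)
    (hW : W.IsPositive) (hP : P.IsPositive) {R : X →L[ℝ] X}
    (h : IsSylvester T T P (N - P ∘L W ∘L P + R)) (hSP : IsDuhamel T (-(W ∘L P)) S) :
    IsSylvester S S P (N + P ∘L W ∘L P + R) := by
  refine (h.perturb hT hT hS hS hSP hSP).congr fun x x' => ?_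
  simp only [sub_apply, add_apply, neg_apply, inner_sub_left, inner_add_left, inner_neg_left,
    ContinuousLinearMap.comp_apply, ContinuousLinearMap.adjoint_inner_left,
    map_neg]
  rw [hP.inner_left_eq_inner_right (W (P x)), hW.inner_left_eq_inner_right]
  ring

/-- The form ⟪P x, x⟫ decreases along the closed loop at least as fast as cost accumulates, so it
bounds the total cost; finite cost and detectability give decay. -/
theorem expDecay_closedLoop (hT : IsC0Semigroup T) (hF : IsC0Semigroup F) (hFd : ExpDecay F)
    {H : V →L[ℝ] X} (hFH : IsDuhamel T (H ∘L C) F) (hS : IsC0Semigroup S)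
    (hW : W.IsPositive) (hP : IsRiccatiSuper T W (CC C) P) (hSP : IsDuhamel T (-(W ∘L P)) S) :
    ExpDecay S ∧ ∀ x t, 0 ≤ t →
      ∫ s in (0 : ℝ)..t, ⟪(CC C + P ∘L W ∘L P) (S s x), S s x⟫_ℝ ≤ ⟪P x, x⟫_ℝ := by
  obtain ⟨hPp, R, hR, hSyl⟩ := hP
  have hcl := isSylvester_closedLoop hT hS hW hPp hSyl hSP
  have hle : ∀ x t, 0 ≤ t →
      ∫ s in (0 : ℝ)..t, ⟪(CC C + P ∘L W ∘L P) (S s x), S s x⟫_ℝ ≤ ⟪P x, x⟫_ℝ := by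
    intro x t ht
    rw [← hcl.inner_eq hS hS ht x x]
    have h1 : ∫ s in (0 : ℝ)..t, ⟪(CC C + P ∘L W ∘L P) (S s x), S s x⟫_ℝ ≤
        ∫ s in (0 : ℝ)..t, ⟪(CC C + P ∘L W ∘L P + R) (S s x), S s x⟫_ℝ := by
      refine intervalIntegral.integral_mono_on ht
        (((continuousOn_inner hS hS _ x x).mono Icc_subset_Ici_self).intervalIntegrable_of_Icc ht)
        (((continuousOn_inner hS hS _ x x).mono Icc_subset_Ici_self).intervalIntegrable_of_Icc ht)
        fun s _ => ?_
      rw [add_apply (CC C + P ∘L W ∘L P) R, inner_add_left]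
      exact le_add_of_nonneg_right (hR.inner_nonneg_left _)
    exact h1.trans (le_add_of_nonneg_left (hPp.inner_nonneg_left _))
  refine ⟨?_, hle⟩
  refine expDecay_of_detectable hT hF hFd hFH hS hW hSP (norm_nonneg P) fun x t ht => ?_
  have e : ∀ v, ⟪C v, C v⟫_ℝ + ⟪W (P v), P v⟫_ℝ = ⟪(CC C + P ∘L W ∘L P) v, v⟫_ℝ := by
    intro v
    rw [add_apply, inner_add_left, inner_CC]
    simp only [ContinuousLinearMap.comp_apply]
    rw [hPp.inner_left_eq_inner_right]
  simp only [e]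
  refine (hle x t ht).trans ((real_inner_le_norm _ _).trans ?_)
  rw [pow_two, ← mul_assoc]
  gcongr
  exact P.le_opNorm x

/-- One step of the Newton-Kleinman iteration. -/
theorem exists_kleinman_step (hT : IsC0Semigroup T) (hF : IsC0Semigroup F) (hFd : ExpDecay F)
    {H : V →L[ℝ] X} (hFH : IsDuhamel T (H ∘L C) F) (hW : W.IsPositive)
    (hP : IsRiccatiSuper T W (CC C) P) :
    ∃ P' : X →L[ℝ] X, IsRiccatiSuper T W (CC C) P' ∧ (∀ x, ⟪P' x, x⟫_ℝ ≤ ⟪P x, x⟫_ℝ) ∧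
      IsSylvester T T P' (CC C - P' ∘L W ∘L P' + (P - P') ∘L W ∘L (P - P')) := by
  obtain ⟨S, hS, hSP⟩ := exists_perturbation hT (-(W ∘L P))
  obtain ⟨hSd, hle⟩ := expDecay_closedLoop hT hF hFd hFH hS hW hP hSP
  obtain ⟨P', hP'⟩ := exists_lyapunov hS hSd (CC C + P ∘L W ∘L P)
  have hP' : IsLyapunov S (CC C + P ∘L W ∘L P) P' := hP'
  have hPp := hP.1
  have hpos := hP'.isPositive hS ((isPositive_CC C).add (isPositive_sandwich hPp hW))
  have hdiff : ∀ x y, ⟪(P - P') x, y⟫_ℝ = ⟪x, (P - P') y⟫_ℝ := by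
    intro x y
    simp only [sub_apply, inner_sub_left, inner_sub_right, hPp.inner_left_eq_inner_right,
      hpos.inner_left_eq_inner_right]
  have hdp : ((P - P') ∘L W ∘L (P - P')).IsPositive := by
    rw [ContinuousLinearMap.isPositive_iff]
    constructor
    · intro x y
      change ⟪(P - P') (W ((P - P') x)), y⟫_ℝ = ⟪x, (P - P') (W ((P - P') y))⟫_ℝ
      rw [hdiff, hW.inner_left_eq_inner_right, hdiff]
    · intro x
      change 0 ≤ ⟪(P - P') (W ((P - P') x)), x⟫_ℝ
      rw [hdiff]
      exact hW.inner_nonneg_left _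
  -- Returning to the open loop subtracts P'WP + PWP' from the source, and completing the square
  -- with PWP leaves a nonnegative residual. Hence P' again satisfies the Riccati inequality.
  have hsyl : IsSylvester T T P' (CC C - P' ∘L W ∘L P' + (P - P') ∘L W ∘L (P - P')) := by
    have hd := hSP.symm hT hS
    refine ((hP'.isSylvester hS).perturb hS hS hT hT hd hd).congr fun x x' => ?_
    simp only [neg_neg]
    simp only [sub_apply, add_apply, inner_sub_left, inner_add_left,
      ContinuousLinearMap.comp_apply, ContinuousLinearMap.adjoint_inner_left, map_sub]
    simp only [hPp.inner_left_eq_inner_right, hpos.inner_left_eq_inner_right,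
      hW.inner_left_eq_inner_right]
    ring
  refine ⟨P', ⟨hpos, _, hdp, hsyl⟩, fun x => ?_, hsyl⟩
  refine le_of_tendsto (hP'.tendsto hS x x) ?_
  filter_upwards [eventually_ge_atTop 0] with t ht using hle x t ht

/-- A stabilizing feedback provides a solution of the Riccati inequality. -/
theorem exists_riccatiSuper (hT : IsC0Semigroup T) (hF : IsC0Semigroup F) (hFd : ExpDecay F)
    {K : X →L[ℝ] U} (hFK : IsDuhamel T (B ∘L K) F) (hQ : Q.IsPositive) (hu : IsUnit Q) :
    ∃ P, IsRiccatiSuper T (BQB B Q) (CC C) P := by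
  obtain ⟨P, hP⟩ := exists_lyapunov hF hFd (CC C + adjoint K ∘L Q ∘L K)
  have hP : IsLyapunov F (CC C + adjoint K ∘L Q ∘L K) P := hP
  have hpos := hP.isPositive hF ((isPositive_CC C).add (hQ.adjoint_conj K))
  have hd := hFK.symm hT hF
  -- `D` is the gap between the given feedback K and the feedback -Q⁻¹B^*P attached to P. Completing
  -- the square in the Lyapunov equation of A + BK gives the residual D^*QD.
  set D : X →L[ℝ] U := K + Ring.inverse Q ∘L adjoint B ∘L P with hD
  refine ⟨P, hpos, adjoint D ∘L Q ∘L D, hQ.adjoint_conj D, ?_⟩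
  refine ((hP.isSylvester hF).perturb hF hF hT hT hd hd).congr fun x x' => ?_
  have h1 : ∀ x, Q (Ring.inverse Q x) = x := fun x =>
    DFunLike.congr_fun (Ring.mul_inverse_cancel Q hu) x
  simp only [sub_apply, add_apply, neg_apply, inner_sub_left, inner_add_left,
    ContinuousLinearMap.comp_apply, ContinuousLinearMap.adjoint_inner_left, map_neg, map_add,
    inner_neg_left, hD, h1, BQB]
  have e1 : ⟪Q (K x), Ring.inverse Q (adjoint B (P x'))⟫_ℝ = ⟪P (B (K x)), x'⟫_ℝ := by
    rw [hQ.inner_left_eq_inner_right, h1, ContinuousLinearMap.adjoint_inner_right,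
      hpos.inner_left_eq_inner_right]
  have e2 : ⟪P x, B (Ring.inverse Q (adjoint B (P x')))⟫_ℝ =
      ⟪P (B (Ring.inverse Q (adjoint B (P x)))), x'⟫_ℝ := by
    rw [hpos.inner_left_eq_inner_right _ x']
    exact ((isPositive_BQB (B := B) hQ hu).inner_left_eq_inner_right (P x) (P x')).symm
  rw [e1, e2]
  ring

/-- Existence of a nonnegative solution of the algebraic Riccati equation. -/
theorem exists_riccati {F' : ℝ → X →L[ℝ] X} (hT : IsC0Semigroup T)
    (hF : IsC0Semigroup F) (hFd : ExpDecay F) {H : V →L[ℝ] X} (hFH : IsDuhamel T (H ∘L C) F)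
    (hF' : IsC0Semigroup F') (hFd' : ExpDecay F') {K : X →L[ℝ] U} (hFK : IsDuhamel T (B ∘L K) F')
    (hQ : Q.IsPositive) (hu : IsUnit Q) :
    ∃ P : X →L[ℝ] X, P.IsPositive ∧ IsSylvester T T P (CC C - P ∘L BQB B Q ∘L P) := by
  have hW := isPositive_BQB (B := B) hQ hu
  set W := BQB B Q
  obtain ⟨P₀, hP₀⟩ := exists_riccatiSuper (C := C) hT hF' hFd' hFK hQ hu
  choose! next hnext using fun (P : X →L[ℝ] X) (hP : IsRiccatiSuper T W (CC C) P) =>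
    exists_kleinman_step hT hF hFd hFH hW hP
  let p : ℕ → X →L[ℝ] X := fun n => next^[n] P₀
  have hps : ∀ n, p (n + 1) = next (p n) := fun n => Function.iterate_succ_apply' next n P₀
  have hp : ∀ n, IsRiccatiSuper T W (CC C) (p n) := by
    intro n
    induction n with
    | zero => exact hP₀
    | succ n ih => rw [hps]; exact (hnext _ ih).1
  obtain ⟨P, hP, hlim⟩ := exists_strong_limit (fun n => (hp n).1)
    (fun n x => by rw [hps]; exact (hnext _ (hp n)).2.1 x)
  refine ⟨P, hP, fun x y x' y' hg hg' => ?_⟩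
  have hlim1 : ∀ x, Tendsto (fun n => p (n + 1) x) atTop (𝓝 (P x)) := fun x =>
    (hlim x).comp (tendsto_add_atTop_nat 1)
  have hI : ∀ {u v : ℕ → X} {a b : X}, Tendsto u atTop (𝓝 a) → Tendsto v atTop (𝓝 b) →
      Tendsto (fun n => ⟪u n, v n⟫_ℝ) atTop (𝓝 ⟪a, b⟫_ℝ) := fun h1 h2 => h1.inner h2
  have hWt : ∀ {u : ℕ → X} {a : X}, Tendsto u atTop (𝓝 a) →
      Tendsto (fun n => W (u n)) atTop (𝓝 (W a)) := fun h => (W.continuous.tendsto _).comp h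
  have hd : ∀ x, Tendsto (fun n => p n x - p (n + 1) x) atTop (𝓝 0) := fun x => by
    simpa using (hlim x).sub (hlim1 x)
  have h1 := hI (hlim1 y) (tendsto_const_nhds (x := x'))
  have h2 := hI (hlim1 x) (tendsto_const_nhds (x := y'))
  have h3 := hI (hWt (hlim1 x)) (hlim1 x')
  have h4 := hI (hWt (hd x)) (hd x')
  have h5 := (h1.add h2).add ((tendsto_const_nhds (x := ⟪CC C x, x'⟫_ℝ)).sub h3 |>.add h4)
  -- Strong convergence suffices, because symmetry moves the outer factor of each quadratic term
  -- onto x'. The Newton residual tends to ⟪W 0, 0⟫ since consecutive iterates have the same limit.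
  have h6 : ⟪P y, x'⟫_ℝ + ⟪P x, y'⟫_ℝ + (⟪CC C x, x'⟫_ℝ - ⟪W (P x), P x'⟫_ℝ +
      ⟪W 0, (0 : X)⟫_ℝ) = 0 := by
    refine tendsto_nhds_unique h5 (tendsto_const_nhds.congr fun n => ?_)
    have h7 := (hnext _ (hp n)).2.2 x y x' y' hg hg'
    rw [← hps] at h7
    have hsym : ∀ u v, ⟪p n u, v⟫_ℝ = ⟪u, p n v⟫_ℝ := (hp n).1.inner_left_eq_inner_right
    have hsym' : ∀ u v, ⟪p (n + 1) u, v⟫_ℝ = ⟪u, p (n + 1) v⟫_ℝ :=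
      (hp (n + 1)).1.inner_left_eq_inner_right
    simp only [sub_apply, add_apply, inner_sub_left, inner_add_left,
      ContinuousLinearMap.comp_apply] at h7
    rw [hsym (W _), hsym' (W (p (n + 1) x)), hsym' (W _)] at h7
    rw [inner_sub_right]
    linarith
  simp only [sub_apply, inner_sub_left, ContinuousLinearMap.comp_apply]
  rw [hP.inner_left_eq_inner_right (W (P x))]
  simp only [inner_zero_right, add_zero] at h6
  linarith

/-- Uniqueness of the stabilizing solution of the algebraic Riccati equation. -/
theorem riccati_unique {P' : X →L[ℝ] X} {S' : ℝ → X →L[ℝ] X} (hT : IsC0Semigroup T)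
    (hW : W.IsPositive) (hP : P.IsPositive) (hP' : P'.IsPositive)
    (h : IsSylvester T T P (N - P ∘L W ∘L P)) (h' : IsSylvester T T P' (N - P' ∘L W ∘L P'))
    (hS : IsC0Semigroup S) (hSP : IsDuhamel T (-(W ∘L P)) S) (hSd : ExpDecay S)
    (hS' : IsC0Semigroup S') (hSP' : IsDuhamel T (-(W ∘L P')) S') (hSd' : ExpDecay S') :
    P' = P := by
  have h0 : IsSylvester T T (P - P') (P' ∘L W ∘L P' - P ∘L W ∘L P) := by
    intro x y x' y' hg hg'
    have h1 := h x y x' y' hg hg'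
    have h2 := h' x y x' y' hg hg'
    simp only [sub_apply, inner_sub_left] at h1 h2 ⊢
    linarith
  -- The two sides use different closed loops: S for P and S' for P'. With this choice all quadratic
  -- terms cancel, so ⟪(P - P') S(t)x, S'(t)x'⟫ is constant in t and tends to 0.
  have h1 : IsSylvester S S' (P - P') 0 := by
    refine (h0.perturb hT hT hS hS' hSP hSP').congr fun x x' => ?_
    simp only [sub_apply, neg_apply, inner_sub_left, inner_neg_left,
      ContinuousLinearMap.comp_apply, ContinuousLinearMap.adjoint_inner_left, map_neg, zero_apply,
      inner_zero_left]
    simp only [hP.inner_left_eq_inner_right, hP'.inner_left_eq_inner_right,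
      hW.inner_left_eq_inner_right]
    ring
  have h2 : ∀ x x', ⟪(P - P') x, x'⟫_ℝ = 0 := by
    intro x x'
    have h3 : Tendsto (fun t => ⟪(P - P') (S t x), S' t x'⟫_ℝ) atTop (𝓝 ⟪(P - P') 0, (0 : X)⟫_ℝ) :=
      (((P - P').continuous.tendsto 0).comp (hSd.tendsto_apply x)).inner (hSd'.tendsto_apply x')
    rw [inner_zero_right] at h3
    refine tendsto_nhds_unique (tendsto_const_nhds.congr' ?_) h3
    filter_upwards [eventually_ge_atTop 0] with t ht
    have := h1.inner_eq hS hS' ht x x'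
    simpa using this.symm
  ext x
  have := h2 x ((P - P') x)
  rw [inner_self_eq_zero, sub_apply, sub_eq_zero] at this
  exact this.symm

end Riccati

/-! ### Transformations of mild solutions, and duality -/

section Mild

variable {X Y Z : Type*}
  [NormedAddCommGroup X] [InnerProductSpace ℝ X] [CompleteSpace X]
  [NormedAddCommGroup Y] [InnerProductSpace ℝ Y] [CompleteSpace Y]
  [NormedAddCommGroup Z] [InnerProductSpace ℝ Z] [CompleteSpace Z]
  {T R S : ℝ → X →L[ℝ] X} {K L N : X →L[ℝ] X} {f g y l : ℝ → X} {b : ℝ}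

theorem _root_.IntervalIntegrable.clm_apply {f : ℝ → Y} {a b : ℝ}
    (hf : IntervalIntegrable f volume a b) (L : Y →L[ℝ] Z) :
    IntervalIntegrable (fun s => L (f s)) volume a b :=
  ⟨L.integrable_comp hf.1, L.integrable_comp hf.2⟩

theorem intervalIntegrable_reverse {f : ℝ → Y} (hf : IntervalIntegrable f volume 0 b) :
    IntervalIntegrable (fun s => f (b - s)) volume 0 b := by
  simpa using (hf.comp_sub_left b).symm

theorem IsMildSolution.mono (hy : IsMildSolution T f b y) {t : ℝ} (ht : t ≤ b) :
    IsMildSolution T f t y := fun s hs => hy s ⟨hs.1, hs.2.trans ht⟩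

theorem intervalIntegrable_of_le {f : ℝ → Y} (hf : IntervalIntegrable f volume 0 b) {a t : ℝ}
    (ha : 0 ≤ a) (hat : a ≤ t) (ht : t ≤ b) : IntervalIntegrable f volume a t := by
  refine hf.mono_set ?_
  rw [uIcc_of_le hat, uIcc_of_le (ha.trans (hat.trans ht))]
  exact Icc_subset_Icc ha ht

theorem IsMildSolution.add {f₁ f₂ y₁ y₂ : ℝ → X} (hT : IsC0Semigroup T)
    (hf₁ : IntervalIntegrable f₁ volume 0 b) (hf₂ : IntervalIntegrable f₂ volume 0 b)
    (h₁ : IsMildSolution T f₁ b y₁) (h₂ : IsMildSolution T f₂ b y₂) :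
    IsMildSolution T (fun s => f₁ s + f₂ s) b (fun s => y₁ s + y₂ s) := by
  intro t ht
  simp only [map_add]
  rw [intervalIntegral.integral_add
    (hT.intervalIntegrable_conv ht.1 (intervalIntegrable_of_le hf₁ le_rfl ht.1 ht.2))
    (hT.intervalIntegrable_conv ht.1 (intervalIntegrable_of_le hf₂ le_rfl ht.1 ht.2)),
    h₁ t ht, h₂ t ht]
  abel

theorem IsMildSolution.neg (h : IsMildSolution T f b y) :
    IsMildSolution T (fun s => -f s) b (fun s => -y s) := by
  intro t ht
  simp only [map_neg]
  rw [intervalIntegral.integral_neg, h t ht]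
  abel

theorem IsMildSolution.sub {f₁ f₂ y₁ y₂ : ℝ → X} (hT : IsC0Semigroup T)
    (hf₁ : IntervalIntegrable f₁ volume 0 b) (hf₂ : IntervalIntegrable f₂ volume 0 b)
    (h₁ : IsMildSolution T f₁ b y₁) (h₂ : IsMildSolution T f₂ b y₂) :
    IsMildSolution T (fun s => f₁ s - f₂ s) b (fun s => y₁ s - y₂ s) := by
  simp only [sub_eq_add_neg]
  exact h₁.add hT hf₁ hf₂.neg h₂.neg

/-- Time reversal of backward mild solutions. -/
theorem isBackwardMildSolution_iff :
    IsBackwardMildSolution R g b l ↔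
      IsMildSolution R (fun s => -g (b - s)) b (fun t => l (b - t)) := by
  have key : ∀ t, ∫ s in (b - t)..b, R (s - (b - t)) (g s) =
      ∫ s in (0 : ℝ)..t, R (t - s) (g (b - s)) := by
    intro t
    have := intervalIntegral.integral_comp_sub_left (a := 0) (b := t)
      (fun s => R (s - (b - t)) (g s)) b
    rw [sub_zero] at this
    rw [← this]
    refine intervalIntegral.integral_congr fun s _ => ?_
    congr 2; ring
  constructor
  · intro h t ht
    have h1 := h (b - t) ⟨by linarith [ht.2], by linarith [ht.1]⟩
    rw [key, sub_sub_cancel] at h1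
    simp only [map_neg, intervalIntegral.integral_neg, sub_zero]
    rw [h1, sub_eq_add_neg]
  · intro h t ht
    have h1 := h (b - t) ⟨by linarith [ht.2], by linarith [ht.1]⟩
    simp only [map_neg, intervalIntegral.integral_neg, sub_zero] at h1
    rw [← key, sub_sub_cancel] at h1
    rw [h1]
    exact (sub_eq_add_neg _ _).symm

/-- A mild solution for the perturbed semigroup is a mild solution for the original one. -/
theorem IsMildSolution.of_perturbation (hT : IsC0Semigroup T) (hS : IsC0Semigroup S)
    (hd : IsDuhamel T K S) (hf : IntervalIntegrable f volume 0 b) (hy : IsMildSolution S f b y) :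
    IsMildSolution T (fun s => f s + K (y s)) b y := by
  intro t ht
  have hG := hT.continuous_ext0_sub t
  have hN : Continuous fun p : ℝ × X => (ext0 T (t - p.1) ∘L K) p.2 :=
    hG.comp (continuous_fst.prodMk (K.continuous.comp continuous_snd))
  -- Product rule for s ↦ T(t - s) y(s): the generators of S and T differ by K, which leaves T(t -
  -- s) K as the extra term. The required relation is the Duhamel formula on an interval of length t
  -- - s, shifted by s.
  have h1 := (hy.mono ht.2).transport hS ht.1 (intervalIntegrable_of_le hf le_rfl ht.1 ht.2)
    (G := fun s => ext0 T (t - s)) (N := fun s => ext0 T (t - s) ∘L K) hG hN ?_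
  · simp only [sub_self, sub_zero, ext0_of_nonneg le_rfl, hT.zero_apply, ext0_of_nonneg ht.1] at h1
    rw [h1]
    congr 1
    refine intervalIntegral.integral_congr fun s hs => ?_
    rw [uIcc_of_le ht.1] at hs
    simp [ext0_of_nonneg (sub_nonneg.2 hs.2)]
  · intro s hs x
    simp only [sub_self, ext0_of_nonneg le_rfl, hT.zero_apply]
    rw [hd _ (sub_nonneg.2 hs.2), ext0_of_nonneg (sub_nonneg.2 hs.2)]
    congr 1
    have := intervalIntegral.integral_comp_sub_right (a := s) (b := t)
      (fun r => T (t - s - r) (K (S r x))) s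
    rw [sub_self] at this
    rw [← this]
    refine intervalIntegral.integral_congr fun r hr => ?_
    rw [uIcc_of_le hs.2] at hr
    simp [ext0_of_nonneg (sub_nonneg.2 hr.2)]

/-- An operator intertwining `S` with the backward dynamics of `R` maps mild solutions to backward
mild solutions. -/
theorem IsMildSolution.intertwine (hS : IsC0Semigroup S) (hR : IsC0Semigroup R)
    (hL : ∀ t, 0 ≤ t → ∀ x, L x = R t (L (S t x)) + ∫ s in (0 : ℝ)..t, R s (N (S s x)))
    (hf : IntervalIntegrable f volume 0 b) (hy : IsMildSolution S f b y) :
    IsBackwardMildSolution R (fun s => L (f s) - N (y s)) b (fun s => L (y s)) := by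
  intro τ hτ
  have hG : Continuous fun p : ℝ × X => (ext0 R p.1 ∘L L) p.2 :=
    hR.continuous_ext0.comp (continuous_fst.prodMk (L.continuous.comp continuous_snd))
  have hN : Continuous fun p : ℝ × X => (-(ext0 R p.1 ∘L N)) p.2 :=
    (hR.continuous_ext0.comp (continuous_fst.prodMk (N.continuous.comp continuous_snd))).neg
  have hfτ : IntervalIntegrable (fun s => f (τ + s)) volume 0 (b - τ) := by
    have := (intervalIntegrable_of_le hf hτ.1 hτ.2 le_rfl).comp_add_left τ
    simpa using this
  -- Product rule for s ↦ R(s) L y(τ + s). Applying R(s) to `hL` at time b - τ - s gives the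
  -- required relation, with -R(s) N as the extra term.
  have h1 := (hy.restart hS hf hτ.1 hτ.2).transport hS (sub_nonneg.2 hτ.2) hfτ
    (G := fun s => ext0 R s ∘L L) (N := fun s => -(ext0 R s ∘L N)) hG hN ?_
  · simp only [ContinuousLinearMap.comp_apply, ext0_of_nonneg le_rfl, hR.zero_apply,
      ext0_of_nonneg (sub_nonneg.2 hτ.2), add_sub_cancel, add_zero] at h1
    rw [h1, eq_sub_iff_add_eq]
    congr 1
    have := intervalIntegral.integral_comp_add_left (a := 0) (b := b - τ)
      (fun s => R (s - τ) (L (f s) - N (y s))) τ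
    rw [add_zero, add_sub_cancel] at this
    rw [← this]
    refine intervalIntegral.integral_congr fun s hs => ?_
    rw [uIcc_of_le (sub_nonneg.2 hτ.2)] at hs
    simp [ext0_of_nonneg hs.1, sub_eq_add_neg]
  · intro s hs x
    have h2 := hL (b - τ - s) (sub_nonneg.2 hs.2) x
    have hc : ContinuousOn (fun r => R r (N (S r x))) (Icc 0 (b - τ - s)) :=
      (continuousOn_apply hR.continuousOn continuousOn_id
        (N.continuous.comp_continuousOn (hS.continuousOn x)) fun _ hs => hs).mono
        Icc_subset_Ici_self
    have h3 : R s (R (b - τ - s) (L (S (b - τ - s) x))) = R s (L x) -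
        ∫ r in (0 : ℝ)..(b - τ - s), R s (R r (N (S r x))) := by
      rw [ContinuousLinearMap.intervalIntegral_comp_comm _
        (hc.intervalIntegrable_of_Icc (sub_nonneg.2 hs.2)), h2, map_add, add_sub_cancel_right]
    simp only [ContinuousLinearMap.comp_apply, ext0_of_nonneg hs.1,
      ext0_of_nonneg (sub_nonneg.2 hτ.2), neg_apply, intervalIntegral.integral_neg]
    rw [← hR.add_apply hs.1 (sub_nonneg.2 hs.2), add_sub_cancel] at h3
    rw [h3, sub_eq_add_neg]
    congr 2
    have := intervalIntegral.integral_comp_sub_right (a := s) (b := b - τ)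
      (fun r => R s (R r (N (S r x)))) s
    rw [sub_self] at this
    rw [← this]
    refine intervalIntegral.integral_congr fun r hr => ?_
    rw [uIcc_of_le hs.2] at hr
    rw [ext0_of_nonneg (hs.1.trans hr.1), ← hR.add_apply hs.1 (sub_nonneg.2 hr.1), add_sub_cancel]

/-- Duality between forward and backward mild solutions. -/
theorem IsMildSolution.duality (hT : IsC0Semigroup T) (hb : 0 ≤ b)
    (hf : IntervalIntegrable f volume 0 b) (hy : IsMildSolution T f b y)
    (hlc : ContinuousOn l (Icc 0 b)) (hgc : ContinuousOn g (Icc 0 b))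
    (hl : IsBackwardMildSolution (fun t => adjoint (T t)) g b l) :
    ⟪l b, y b⟫_ℝ = ⟪l 0, y 0⟫_ℝ + ∫ s in (0 : ℝ)..b, (⟪l s, f s⟫_ℝ + ⟪g s, y s⟫_ℝ) := by
  -- `transport` asks for families continuous on all of ℝ; projecting time onto [0, b] extends l and
  -- g, which are continuous only there.
  have hproj : ∀ s ∈ Icc 0 b, ((projIcc 0 b hb s : Icc 0 b) : ℝ) = s := fun s hs => by
    rw [projIcc_of_mem hb hs]
  have hcont : ∀ h : ℝ → X, ContinuousOn h (Icc 0 b) →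
      Continuous fun p : ℝ × X => (innerSL ℝ (h (projIcc 0 b hb p.1))) p.2 := by
    intro h hh
    have h1 : Continuous fun s : ℝ => h (projIcc 0 b hb s) :=
      hh.comp_continuous (by fun_prop) fun s => (projIcc 0 b hb s).2
    simp only [innerSL_apply_apply]
    exact (h1.comp continuous_fst).inner continuous_snd
  have h1 := hy.transport hT hb hf (G := fun s => innerSL ℝ (l (projIcc 0 b hb s)))
    (N := fun s => innerSL ℝ (g (projIcc 0 b hb s))) (hcont l hlc) (hcont g hgc) ?_
  · simp only [innerSL_apply_apply, hproj b ⟨hb, le_rfl⟩, hproj 0 ⟨le_rfl, hb⟩] at h1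
    rw [h1]
    congr 1
    refine intervalIntegral.integral_congr fun s hs => ?_
    rw [uIcc_of_le hb] at hs
    simp only [hproj s hs]
  · intro s hs x
    simp only [innerSL_apply_apply, hproj b ⟨hb, le_rfl⟩, hproj s hs]
    have hc : ContinuousOn (fun r => adjoint (T (r - s)) (g r)) (Icc s b) :=
      continuousOn_apply hT.adjoint.continuousOn (by fun_prop)
        (hgc.mono (Icc_subset_Icc hs.1 le_rfl)) fun r hr => sub_nonneg.2 hr.1
    rw [hl s hs, inner_sub_left, ContinuousLinearMap.adjoint_inner_left,
      inner_intervalIntegral_left (hc.intervalIntegrable_of_Icc hs.2)]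
    have : ∫ r in s..b, ⟪adjoint (T (r - s)) (g r), x⟫_ℝ =
        ∫ r in s..b, ⟪g (projIcc 0 b hb r), T (r - s) x⟫_ℝ := by
      refine intervalIntegral.integral_congr fun r hr => ?_
      rw [uIcc_of_le hs.2] at hr
      rw [hproj r ⟨hs.1.trans hr.1, hr.2⟩, ContinuousLinearMap.adjoint_inner_left]
    rw [this, sub_add_cancel]

/-- A periodic free trajectory that is not observed vanishes, if the observation makes the system
exponentially detectable. -/
theorem eq_zero_of_periodic {F : ℝ → X →L[ℝ] X} {H : Y →L[ℝ] X} {C : X →L[ℝ] Y}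
    (hT : IsC0Semigroup T) (hF : IsC0Semigroup F) (hFd : ExpDecay F)
    (hd : IsDuhamel T (H ∘L C) F) (hb : 0 < b) {x : X} (hx : T b x = x)
    (hC : ∀ s ∈ Icc 0 b, C (T s x) = 0) : x = 0 := by
  have h1 : F b x = x := by
    have h2 := hd.symm hT hF b hb.le x
    have h3 : ∫ s in (0 : ℝ)..b, F (b - s) ((-(H ∘L C)) (T s x)) = 0 := by
      rw [← intervalIntegral.integral_zero (a := 0) (b := b) (μ := volume) (E := X)]
      refine intervalIntegral.integral_congr fun s hs => ?_
      rw [uIcc_of_le hb.le] at hs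
      simp [hC s hs]
    rw [h3, add_zero, hx] at h2
    exact h2.symm
  have h2 : ∀ n : ℕ, F (n * b) x = x := by
    intro n
    induction n with
    | zero => simp [hF.zero_apply]
    | succ n ih =>
      rw [show ((n + 1 : ℕ) : ℝ) * b = n * b + b by push_cast; ring,
        hF.add_apply (by positivity) hb.le, h1, ih]
  have h3 := (hFd.tendsto_apply x).comp
    (tendsto_natCast_atTop_atTop.atTop_mul_const hb : Tendsto (fun n : ℕ => (n : ℝ) * b) atTop atTop)
  exact tendsto_nhds_unique (tendsto_const_nhds.congr fun n => (h2 n).symm) h3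

/-- S(b) itself may have norm at least 1, but some power S(b)^n = S(nb) has norm below 1. Then 1 -
S(b)^n is invertible, and 1 - S(b) is one of its two commuting factors. -/
theorem isUnit_one_sub_of_expDecay (hS : IsC0Semigroup S) (hd : ExpDecay S) (hb : 0 < b) :
    IsUnit (1 - S b) := by
  have h3 := hd.tendsto.comp
    (tendsto_natCast_atTop_atTop.atTop_mul_const hb : Tendsto (fun n : ℕ => (n : ℝ) * b) atTop atTop)
  obtain ⟨n, hn⟩ := (h3.eventually_lt_const one_pos).exists
  have h2 : ∀ n : ℕ, S (n * b) = S b ^ n := by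
    intro n
    induction n with
    | zero => simp [hS.map_zero]
    | succ n ih =>
      rw [show ((n + 1 : ℕ) : ℝ) * b = n * b + b by push_cast; ring,
        hS.map_add _ _ (by positivity) hb.le, ih, pow_succ]
      rfl
  simp only [Function.comp, h2] at hn
  have hu := isUnit_one_sub_of_norm_lt_one hn
  have hg : (1 - S b) * ∑ i ∈ Finset.range n, S b ^ i = 1 - S b ^ n := mul_neg_geom_sum _ _
  have hg' : (∑ i ∈ Finset.range n, S b ^ i) * (1 - S b) = 1 - S b ^ n := geom_sum_mul_neg _ _
  have hc : Commute (1 - S b) (∑ i ∈ Finset.range n, S b ^ i) := hg.trans hg'.symm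
  rw [← hg] at hu
  exact (hc.isUnit_mul_iff.1 hu).1

end Mild

/-! ### Uniqueness of extremals and optimality -/

section Periodic

variable {X U V : Type*}
  [NormedAddCommGroup X] [InnerProductSpace ℝ X] [CompleteSpace X]
  [NormedAddCommGroup U] [InnerProductSpace ℝ U] [CompleteSpace U]
  [NormedAddCommGroup V] [InnerProductSpace ℝ V] [CompleteSpace V]
  {T F F' : ℝ → X →L[ℝ] X} {B : U →L[ℝ] X} {C : X →L[ℝ] V} {Q : U →L[ℝ] U}
  {yd : ℝ → X} {ud : ℝ → U} {per : ℝ} {y l y' l' : ℝ → X} {u u' : ℝ → U}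

theorem eq_zero_of_integral_le_zero {φ : ℝ → ℝ} {b : ℝ} (hb : 0 < b)
    (hφ : ContinuousOn φ (Icc 0 b)) (h0 : ∀ s ∈ Icc 0 b, 0 ≤ φ s)
    (hI : ∫ s in (0 : ℝ)..b, φ s ≤ 0) : ∀ s ∈ Icc 0 b, φ s = 0 := by
  intro s hs
  by_contra hne
  have := intervalIntegral.integral_pos hb hφ (fun r hr => h0 r (Ioc_subset_Icc_self hr))
    ⟨s, hs, (h0 s hs).lt_of_ne (Ne.symm hne)⟩
  linarith

theorem eq_zero_of_inner_eq_zero {Q : U →L[ℝ] U} (hQ : Q.IsPositive) (hu : IsUnit Q) {v : U}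
    (h : ⟪Q v, v⟫_ℝ = 0) : v = 0 := by
  have h1 := norm_sq_apply_le hQ v
  rw [h, mul_zero] at h1
  have h2 : Q v = 0 := by
    rw [← norm_eq_zero]
    exact pow_eq_zero_iff two_ne_zero |>.1 (le_antisymm h1 (by positivity))
  have h3 : Ring.inverse Q (Q v) = v := DFunLike.congr_fun (Ring.inverse_mul_cancel Q hu) v
  rw [← h3, h2, map_zero]

theorem intervalIntegrable_of_memLp {b : ℝ} (hb : 0 ≤ b)
    (h : MemLp u 2 (volume.restrict (Ioc 0 b))) : IntervalIntegrable u volume 0 b := by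
  rw [intervalIntegrable_iff_integrableOn_Ioc_of_le hb]
  exact h.integrable one_le_two

/-- The homogeneous periodic extremal system only has the trivial solution. -/
theorem eq_zero_of_homogeneous (hT : IsC0Semigroup T)
    (hF : IsC0Semigroup F) (hFd : ExpDecay F) {H : V →L[ℝ] X} (hFH : IsDuhamel T (H ∘L C) F)
    (hF' : IsC0Semigroup F') (hFd' : ExpDecay F') {K : X →L[ℝ] U} (hFK : IsDuhamel T (B ∘L K) F')
    (hQ : Q.IsPositive) (hu : IsUnit Q) (hper : 0 < per)
    (hyc : ContinuousOn y (Icc 0 per)) (hlc : ContinuousOn l (Icc 0 per))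
    (hy : IsMildSolution T (fun s => BQB B Q (l s)) per y) (hyp : y 0 = y per)
    (hl : IsBackwardMildSolution (fun t => adjoint (T t)) (fun s => CC C (y s)) per l)
    (hlp : l 0 = l per) :
    (∀ t ∈ Icc 0 per, y t = 0) ∧ (∀ t ∈ Icc 0 per, l t = 0) := by
  have hW := isPositive_BQB (B := B) hQ hu
  have hWc : ContinuousOn (fun s => BQB B Q (l s)) (Icc 0 per) :=
    (BQB B Q).continuous.comp_continuousOn hlc
  have hCc : ContinuousOn (fun s => CC C (y s)) (Icc 0 per) :=
    (CC C).continuous.comp_continuousOn hyc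
  have hdual := hy.duality hT hper.le (hWc.intervalIntegrable_of_Icc hper.le) hlc hCc hl
  rw [hyp, hlp] at hdual
  -- Periodicity cancels the boundary terms of the duality identity, so the integral of a sum of two
  -- nonnegative terms vanishes; by continuity so does the sum at every time.
  have hzero := eq_zero_of_integral_le_zero
    (φ := fun s => ⟪l s, BQB B Q (l s)⟫_ℝ + ⟪CC C (y s), y s⟫_ℝ) hper
    ((hlc.inner hWc).add (hCc.inner hyc))
    (fun s _ => add_nonneg (hW.inner_nonneg_right _) ((isPositive_CC C).inner_nonneg_left _))
    (by linarith)
  have hBz : ∀ s ∈ Icc 0 per, adjoint B (l s) = 0 := by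
    intro s hs
    have h1 := hW.inner_nonneg_right (l s)
    have h2 := (isPositive_CC C).inner_nonneg_left (y s)
    have h3 := hzero s hs
    have h4 : ⟪l s, BQB B Q (l s)⟫_ℝ = 0 := by linarith
    have h5 : ⟪l s, B (Ring.inverse Q (adjoint B (l s)))⟫_ℝ = 0 := h4
    rw [← ContinuousLinearMap.adjoint_inner_left, real_inner_comm] at h5
    exact eq_zero_of_inner_eq_zero (isPositive_inverse hQ hu) hu.ringInverse h5
  have hCz : ∀ s ∈ Icc 0 per, C (y s) = 0 := by
    intro s hs
    have h1 := hW.inner_nonneg_right (l s)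
    have h2 := (isPositive_CC C).inner_nonneg_left (y s)
    have h3 := hzero s hs
    have h4 : ⟪CC C (y s), y s⟫_ℝ = 0 := by linarith
    rwa [inner_CC, inner_self_eq_zero] at h4
  have hyT : ∀ t ∈ Icc 0 per, y t = T t (y 0) := by
    intro t ht
    have : ∫ s in (0 : ℝ)..t, T (t - s) (BQB B Q (l s)) = ∫ s in (0 : ℝ)..t, (0 : X) := by
      refine intervalIntegral.integral_congr fun s hs => ?_
      rw [uIcc_of_le ht.1] at hs
      change T (t - s) (B (Ring.inverse Q (adjoint B (l s)))) = 0
      rw [hBz s ⟨hs.1, hs.2.trans ht.2⟩, map_zero, map_zero, map_zero]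
    rw [hy t ht, this, intervalIntegral.integral_zero, add_zero]
  have hlT : ∀ t ∈ Icc 0 per, l t = adjoint (T (per - t)) (l per) := by
    intro t ht
    have : ∫ s in t..per, adjoint (T (s - t)) (CC C (y s)) = ∫ s in t..per, (0 : X) := by
      refine intervalIntegral.integral_congr fun s hs => ?_
      rw [uIcc_of_le ht.2] at hs
      change adjoint (T (s - t)) (adjoint C (C (y s))) = 0
      rw [hCz s ⟨ht.1.trans hs.1, hs.2⟩, map_zero, map_zero]
    rw [hl t ht, this, intervalIntegral.integral_zero, sub_zero]
  have hy0 : y 0 = 0 := by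
    refine eq_zero_of_periodic hT hF hFd hFH hper ?_ fun s hs => ?_
    · rw [← hyT per ⟨hper.le, le_rfl⟩, hyp]
    · rw [← hyT s hs]
      exact hCz s hs
  -- The costate is a free trajectory of T^* in reversed time with B^*l = 0. Dualized, the
  -- stabilizing feedback K becomes an output injection for the pair (A^*, B^*).
  have hFK' := hFK.adjoint hT hF'
  rw [ContinuousLinearMap.adjoint_comp] at hFK'
  have hl0 : l per = 0 := by
    refine eq_zero_of_periodic hT.adjoint hF'.adjoint hFd'.adjoint hFK' hper ?_ fun s hs => ?_
    · have := hlT 0 ⟨le_rfl, hper.le⟩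
      rw [sub_zero, hlp] at this
      exact this.symm
    · have := hlT (per - s) ⟨by linarith [hs.2], by linarith [hs.1]⟩
      rw [sub_sub_cancel] at this
      rw [← this]
      exact hBz (per - s) ⟨by linarith [hs.2], by linarith [hs.1]⟩
  exact ⟨fun t ht => by rw [hyT t ht, hy0, map_zero], fun t ht => by rw [hlT t ht, hl0, map_zero]⟩

theorem IsBackwardMildSolution.sub {g₁ g₂ l₁ l₂ : ℝ → X} (hT : IsC0Semigroup T)
    (hg₁ : IntervalIntegrable g₁ volume 0 per) (hg₂ : IntervalIntegrable g₂ volume 0 per)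
    (h₁ : IsBackwardMildSolution T g₁ per l₁) (h₂ : IsBackwardMildSolution T g₂ per l₂) :
    IsBackwardMildSolution T (fun s => g₁ s - g₂ s) per (fun s => l₁ s - l₂ s) := by
  rw [isBackwardMildSolution_iff] at *
  have := h₁.sub (f₁ := fun s => -g₁ (per - s)) (f₂ := fun s => -g₂ (per - s)) hT
    (intervalIntegrable_reverse hg₁).neg (intervalIntegrable_reverse hg₂).neg h₂
  convert this using 2 with s
  abel

/-- Uniqueness of the periodic extremal triple. -/
theorem IsExtremal.unique (hT : IsC0Semigroup T)
    (hF : IsC0Semigroup F) (hFd : ExpDecay F) {H : V →L[ℝ] X} (hFH : IsDuhamel T (H ∘L C) F)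
    (hF' : IsC0Semigroup F') (hFd' : ExpDecay F') {K : X →L[ℝ] U} (hFK : IsDuhamel T (B ∘L K) F')
    (hQ : Q.IsPositive) (hu : IsUnit Q) (hper : 0 < per) (hyd : ContinuousOn yd (Icc 0 per))
    (hud : IntervalIntegrable ud volume 0 per) (h : IsExtremal T B C Q yd ud per y l u)
    (h' : IsExtremal T B C Q yd ud per y' l' u') :
    (∀ t ∈ Icc 0 per, y' t = y t) ∧ (∀ t ∈ Icc 0 per, l' t = l t) ∧
      (∀ᵐ t ∂(volume.restrict (Icc 0 per)), u' t = u t) := by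
  have hfI : ∀ {l : ℝ → X}, ContinuousOn l (Icc 0 per) →
      IntervalIntegrable (fun s => BQB B Q (l s) + B (ud s)) volume 0 per := fun hl =>
    (((BQB B Q).continuous.comp_continuousOn hl).intervalIntegrable_of_Icc hper.le).add
      (hud.clm_apply B)
  have hgI : ∀ {y : ℝ → X}, ContinuousOn y (Icc 0 per) →
      IntervalIntegrable (fun s => CC C (y s) - CC C (yd s)) volume 0 per := fun hy =>
    (((CC C).continuous.comp_continuousOn hy).sub
      ((CC C).continuous.comp_continuousOn hyd)).intervalIntegrable_of_Icc hper.le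
  have hy : IsMildSolution T (fun s => BQB B Q (l' s - l s)) per (fun s => y' s - y s) := by
    convert h'.state_mild.sub hT (hfI h'.costate_continuousOn) (hfI h.costate_continuousOn)
      h.state_mild using 2 with s
    rw [map_sub]; abel
  have hl : IsBackwardMildSolution (fun t => adjoint (T t)) (fun s => CC C (y' s - y s))
      per (fun s => l' s - l s) := by
    convert h'.costate_mild.sub hT.adjoint (hgI h'.state_continuousOn) (hgI h.state_continuousOn)
      h.costate_mild using 2 with s
    rw [map_sub]; abel
  obtain ⟨h1, h2⟩ := eq_zero_of_homogeneous hT hF hFd hFH hF' hFd' hFK hQ hu hper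
    (h'.state_continuousOn.sub h.state_continuousOn)
    (h'.costate_continuousOn.sub h.costate_continuousOn) hy
    (show y' 0 - y 0 = y' per - y per by rw [h'.state_periodic, h.state_periodic]) hl
    (show l' 0 - l 0 = l' per - l per by rw [h'.costate_periodic, h.costate_periodic])
  refine ⟨fun t ht => sub_eq_zero.1 (h1 t ht), fun t ht => sub_eq_zero.1 (h2 t ht), ?_⟩
  filter_upwards [h.control, h'.control, ae_restrict_mem measurableSet_Icc] with t h3 h4 ht
  rw [h3, h4, sub_eq_zero.1 (h2 t ht)]

theorem integrable_inner_of_memLp {b : ℝ} {w : ℝ → U}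
    (h : MemLp w 2 (volume.restrict (Ioc 0 b))) (Q : U →L[ℝ] U) :
    Integrable (fun s => ⟪Q (w s), w s⟫_ℝ) (volume.restrict (Ioc 0 b)) := by
  have h1 : Integrable (fun s => ‖w s‖ ^ 2) (volume.restrict (Ioc 0 b)) :=
    (memLp_two_iff_integrable_sq_norm h.1).1 h
  refine (h1.const_mul ‖Q‖).mono' ?_ (Eventually.of_forall fun s => ?_)
  · exact (Q.continuous.comp_aestronglyMeasurable h.1).inner h.1
  · rw [pow_two, ← mul_assoc]
    exact (norm_inner_le_norm _ _).trans (by gcongr; exact Q.le_opNorm _)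

/-- The cost of an admissible pair, compared with that of an extremal one. -/
theorem IsExtremal.cost_eq (hT : IsC0Semigroup T) (hQ : Q.IsPositive) (hu : IsUnit Q)
    (hper : 0 < per) (hyd : ContinuousOn yd (Icc 0 per))
    (hud : MemLp ud 2 (volume.restrict (Ioc 0 per))) (h : IsExtremal T B C Q yd ud per y l u)
    (hctrl : ∀ t, u t = ud t + Ring.inverse Q (adjoint B (l t)))
    (hadm : IsAdmissible T B per y u) (h' : IsAdmissible T B per y' u') :
    IntervalIntegrable (fun t => ‖C (y' t - y t)‖ ^ 2 + ⟪Q (u' t - u t), u' t - u t⟫_ℝ)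
      volume 0 per ∧
    cost C Q yd ud per y' u' = cost C Q yd ud per y u + (1 / 2) * ∫ t in (0 : ℝ)..per,
      (‖C (y' t - y t)‖ ^ 2 + ⟪Q (u' t - u t), u' t - u t⟫_ℝ) := by
  have hIu := intervalIntegrable_of_memLp hper.le hadm.memLp
  have hIu' := intervalIntegrable_of_memLp hper.le h'.memLp
  have hy : IsMildSolution T (fun s => B (u' s - u s)) per (fun s => y' s - y s) := by
    simp only [map_sub]
    exact h'.mild.sub hT (hIu'.clm_apply B) (hIu.clm_apply B) hadm.mild
  have hyc : ContinuousOn (fun s => y' s - y s) (Icc 0 per) :=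
    h'.continuousOn.sub hadm.continuousOn
  have hBI := (hIu'.sub hIu).clm_apply B
  have hgc : ContinuousOn (fun s => CC C (y s) - CC C (yd s)) (Icc 0 per) :=
    ((CC C).continuous.comp_continuousOn hadm.continuousOn).sub
      ((CC C).continuous.comp_continuousOn hyd)
  -- After the periodic boundary terms cancel, this says that the first variation of the cost
  -- vanishes in every admissible direction.
  have hdual := hy.duality hT hper.le hBI h.costate_continuousOn hgc h.costate_mild
  rw [h'.periodic, hadm.periodic, h.costate_periodic] at hdual
  have hI1 : IntervalIntegrable (fun t => ‖C (y t - yd t)‖ ^ 2 +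
      ⟪Q (u t - ud t), u t - ud t⟫_ℝ) volume 0 per := by
    refine IntervalIntegrable.add ?_ ?_
    · exact (((C.continuous.comp_continuousOn (hadm.continuousOn.sub hyd)).norm).pow
        2).intervalIntegrable_of_Icc hper.le
    · rw [intervalIntegrable_iff_integrableOn_Ioc_of_le hper.le]
      exact integrable_inner_of_memLp (hadm.memLp.sub hud) Q
  have hI2 : IntervalIntegrable (fun t => ‖C (y' t - y t)‖ ^ 2 +
      ⟪Q (u' t - u t), u' t - u t⟫_ℝ) volume 0 per := by
    refine IntervalIntegrable.add ?_ ?_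
    · exact (((C.continuous.comp_continuousOn hyc).norm).pow 2).intervalIntegrable_of_Icc hper.le
    · rw [intervalIntegrable_iff_integrableOn_Ioc_of_le hper.le]
      exact integrable_inner_of_memLp (h'.memLp.sub hadm.memLp) Q
  have hproj : ∀ s ∈ Icc 0 per, ((projIcc 0 per hper.le s : Icc 0 per) : ℝ) = s := fun s hs => by
    rw [projIcc_of_mem hper.le hs]
  have hI3 : IntervalIntegrable (fun s => ⟪l s, B (u' s - u s)⟫_ℝ +
      ⟪CC C (y s) - CC C (yd s), y' s - y s⟫_ℝ) volume 0 per := by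
    refine IntervalIntegrable.add ?_ ((hgc.inner hyc).intervalIntegrable_of_Icc hper.le)
    have h1 : Continuous fun s : ℝ => l (projIcc 0 per hper.le s) :=
      h.costate_continuousOn.comp_continuous (by fun_prop) fun s => (projIcc 0 per hper.le s).2
    refine (intervalIntegrable_apply_family
      (G := fun s => innerSL ℝ (l (projIcc 0 per hper.le s))) ?_ hBI).congr fun s hs => ?_
    · simp only [innerSL_apply_apply]
      exact (h1.comp continuous_fst).inner continuous_snd
    · rw [uIoc_of_le hper.le] at hs
      simp only [innerSL_apply_apply, hproj s (Ioc_subset_Icc_self hs)]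
  refine ⟨hI2, ?_⟩
  have h1 : ∀ t, ‖C (y' t - yd t)‖ ^ 2 + ⟪Q (u' t - ud t), u' t - ud t⟫_ℝ =
      (‖C (y t - yd t)‖ ^ 2 + ⟪Q (u t - ud t), u t - ud t⟫_ℝ) +
      (2 * (⟪l t, B (u' t - u t)⟫_ℝ + ⟪CC C (y t) - CC C (yd t), y' t - y t⟫_ℝ) +
      (‖C (y' t - y t)‖ ^ 2 + ⟪Q (u' t - u t), u' t - u t⟫_ℝ)) := by
    intro t
    have e1 : ⟪l t, B (u' t - u t)⟫_ℝ = ⟪Q (u t - ud t), u' t - u t⟫_ℝ := by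
      rw [← ContinuousLinearMap.adjoint_inner_left, hctrl t, add_sub_cancel_left]
      have : Q (Ring.inverse Q (adjoint B (l t))) = adjoint B (l t) :=
        DFunLike.congr_fun (Ring.mul_inverse_cancel Q hu) _
      rw [this]
    have e2 : ⟪CC C (y t) - CC C (yd t), y' t - y t⟫_ℝ =
        ⟪C (y t - yd t), C (y' t - y t)⟫_ℝ := by
      rw [← map_sub, inner_CC]
    have e3 : C (y' t - yd t) = C (y t - yd t) + C (y' t - y t) := by
      rw [← map_add]; congr 1; abel
    have e4 : u' t - ud t = (u t - ud t) + (u' t - u t) := by abel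
    rw [e1, e2, e3, e4, norm_add_sq_real, map_add, inner_add_left, inner_add_right,
      inner_add_right, hQ.inner_left_eq_inner_right (u' t - u t) (u t - ud t),
      real_inner_comm (Q (u t - ud t)) (u' t - u t)]
    ring
  unfold cost
  simp only [h1]
  rw [intervalIntegral.integral_add hI1 ((hI3.const_mul 2).add hI2),
    intervalIntegral.integral_add (hI3.const_mul 2) hI2, intervalIntegral.integral_const_mul]
  linarith

theorem IsExtremal.isOptimal (hT : IsC0Semigroup T) (hQ : Q.IsPositive) (hu : IsUnit Q)
    (hper : 0 < per) (hyd : ContinuousOn yd (Icc 0 per))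
    (hud : MemLp ud 2 (volume.restrict (Ioc 0 per))) (h : IsExtremal T B C Q yd ud per y l u)
    (hctrl : ∀ t, u t = ud t + Ring.inverse Q (adjoint B (l t)))
    (hadm : IsAdmissible T B per y u) : IsOptimal T B C Q yd ud per y u := by
  refine ⟨hadm, fun y' u' h' => ?_⟩
  rw [(h.cost_eq hT hQ hu hper hyd hud hctrl hadm h').2]
  have := intervalIntegral.integral_nonneg (μ := volume) hper.le
    (fun t _ => add_nonneg (sq_nonneg ‖C (y' t - y t)‖) (hQ.inner_nonneg_left (u' t - u t)))
  linarith

/-- Uniqueness of the optimal pair. -/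
theorem IsExtremal.optimal_unique (hT : IsC0Semigroup T)
    (hF : IsC0Semigroup F) (hFd : ExpDecay F) {H : V →L[ℝ] X} (hFH : IsDuhamel T (H ∘L C) F)
    (hQ : Q.IsPositive) (hu : IsUnit Q)
    (hper : 0 < per) (hyd : ContinuousOn yd (Icc 0 per))
    (hud : MemLp ud 2 (volume.restrict (Ioc 0 per))) (h : IsExtremal T B C Q yd ud per y l u)
    (hctrl : ∀ t, u t = ud t + Ring.inverse Q (adjoint B (l t)))
    (hadm : IsAdmissible T B per y u) (h' : IsOptimal T B C Q yd ud per y' u') :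
    (∀ t ∈ Icc 0 per, y' t = y t) ∧ (∀ᵐ t ∂(volume.restrict (Icc 0 per)), u' t = u t) := by
  obtain ⟨h', hmin⟩ := h'
  obtain ⟨hI, hc⟩ := h.cost_eq hT hQ hu hper hyd hud hctrl hadm h'
  have hle := hmin y u hadm
  have hyc : ContinuousOn (fun s => y' s - y s) (Icc 0 per) :=
    h'.continuousOn.sub hadm.continuousOn
  have hIC : IntervalIntegrable (fun t => ‖C (y' t - y t)‖ ^ 2) volume 0 per :=
    (((C.continuous.comp_continuousOn hyc).norm).pow 2).intervalIntegrable_of_Icc hper.le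
  have hIQ : Integrable (fun t => ⟪Q (u' t - u t), u' t - u t⟫_ℝ) (volume.restrict (Ioc 0 per)) :=
    integrable_inner_of_memLp (h'.memLp.sub hadm.memLp) Q
  rw [intervalIntegral.integral_add hIC
    ((intervalIntegrable_iff_integrableOn_Ioc_of_le hper.le).2 hIQ)] at hc
  have hn1 : 0 ≤ ∫ t in (0 : ℝ)..per, ‖C (y' t - y t)‖ ^ 2 :=
    intervalIntegral.integral_nonneg hper.le fun t _ => sq_nonneg _
  have hn2 : 0 ≤ ∫ t in (0 : ℝ)..per, ⟪Q (u' t - u t), u' t - u t⟫_ℝ :=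
    intervalIntegral.integral_nonneg hper.le fun t _ => hQ.inner_nonneg_left _
  -- Minimality makes the quadratic remainder vanish. This determines the control but only C y; the
  -- difference of states is then an unobserved free periodic trajectory, which detectability
  -- excludes.
  have hCz := eq_zero_of_integral_le_zero (φ := fun t => ‖C (y' t - y t)‖ ^ 2) hper
    (((C.continuous.comp_continuousOn hyc).norm).pow 2) (fun s _ => sq_nonneg _)
    (by linarith)
  have hCz : ∀ s ∈ Icc 0 per, C (y' s - y s) = 0 := fun s hs => by
    simpa using hCz s hs
  have huz : ∀ᵐ t ∂(volume.restrict (Ioc 0 per)), u' t - u t = 0 := by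
    have h1 : ∫ t in Ioc 0 per, ⟪Q (u' t - u t), u' t - u t⟫_ℝ = 0 := by
      rw [← intervalIntegral.integral_of_le hper.le]
      linarith
    rw [integral_eq_zero_iff_of_nonneg (fun t => hQ.inner_nonneg_left _) hIQ] at h1
    filter_upwards [h1] with t ht
    exact eq_zero_of_inner_eq_zero hQ hu ht
  have hy : IsMildSolution T (fun s => B (u' s - u s)) per (fun s => y' s - y s) := by
    simp only [map_sub]
    exact h'.mild.sub hT ((intervalIntegrable_of_memLp hper.le h'.memLp).clm_apply B)
      ((intervalIntegrable_of_memLp hper.le hadm.memLp).clm_apply B) hadm.mild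
  have hyT : ∀ t ∈ Icc 0 per, y' t - y t = T t (y' 0 - y 0) := by
    intro t ht
    have hyt : y' t - y t = T t (y' 0 - y 0) + ∫ s in (0 : ℝ)..t, T (t - s) (B (u' s - u s)) :=
      hy t ht
    rw [hyt]
    have : ∫ s in (0 : ℝ)..t, T (t - s) (B (u' s - u s)) = 0 := by
      rw [intervalIntegral.integral_of_le ht.1]
      refine integral_eq_zero_of_ae ?_
      filter_upwards [ae_restrict_of_ae_restrict_of_subset (Ioc_subset_Ioc_right ht.2) huz]
        with s hs
      simp [hs]
    rw [this, add_zero]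
  have hy0 : y' 0 - y 0 = 0 := by
    refine eq_zero_of_periodic hT hF hFd hFH hper ?_ fun s hs => ?_
    · rw [← hyT per ⟨hper.le, le_rfl⟩, h'.periodic, hadm.periodic]
    · rw [← hyT s hs]
      exact hCz s hs
  refine ⟨fun t ht => by rw [← sub_eq_zero, hyT t ht, hy0, map_zero], ?_⟩
  rw [restrict_Ioc_eq_restrict_Icc] at huz
  filter_upwards [huz] with t ht using sub_eq_zero.1 ht

end Periodic

/-! ### The explicit periodic solution of the decoupled system -/

section Explicit

variable {X U V : Type*}
  [NormedAddCommGroup X] [InnerProductSpace ℝ X] [CompleteSpace X]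
  [NormedAddCommGroup U] [InnerProductSpace ℝ U] [CompleteSpace U]
  [NormedAddCommGroup V] [InnerProductSpace ℝ V] [CompleteSpace V]
  {T S : ℝ → X →L[ℝ] X} {P E : X →L[ℝ] X} {B : U →L[ℝ] X} {C : X →L[ℝ] V} {Q : U →L[ℝ] U}
  {yd f : ℝ → X} {ud : ℝ → U} {per : ℝ} {y l : ℝ → X} {u : ℝ → U}

/-- The periodic mild solution of `y' = A y + f`. -/
noncomputable def periodicTraj (S : ℝ → X →L[ℝ] X) (f : ℝ → X) (per t : ℝ) : X :=
  S t (Ring.inverse (1 - S per) (∫ r in (0 : ℝ)..per, S (per - r) (f r)))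
    + ∫ r in (0 : ℝ)..t, S (t - r) (f r)

theorem periodicTraj_zero (hS : IsC0Semigroup S) :
    periodicTraj S f per 0 = Ring.inverse (1 - S per) (∫ r in (0 : ℝ)..per, S (per - r) (f r)) := by
  simp [periodicTraj, hS.zero_apply]

theorem isMildSolution_periodicTraj (hS : IsC0Semigroup S) :
    IsMildSolution S f per (periodicTraj S f per) := by
  intro t _
  rw [periodicTraj_zero hS, periodicTraj]

theorem periodicTraj_periodic (hS : IsC0Semigroup S) (hu : IsUnit (1 - S per)) :
    periodicTraj S f per 0 = periodicTraj S f per per := by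
  have h := DFunLike.congr_fun (Ring.mul_inverse_cancel _ hu)
    (∫ r in (0 : ℝ)..per, S (per - r) (f r))
  rw [mul_apply_eq_comp, sub_apply, one_apply_eq_self, one_apply_eq_self] at h
  rw [periodicTraj_zero hS, periodicTraj]
  exact sub_eq_iff_eq_add'.1 h

/-- The sign convention for E and the order of the factors make -E, not E, the Lyapunov operator,
and for the adjoint semigroup. -/
theorem IsLyapunovIntegral.isLyapunov (h : IsLyapunovIntegral S B Q E) :
    IsLyapunov (fun t => adjoint (S t)) (BQB B Q) (-E) := by
  intro x
  simp only [ContinuousLinearMap.adjoint_adjoint, neg_apply]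
  exact ⟨(h x).1, by rw [(h x).2, neg_neg]⟩

theorem exists_isLyapunovIntegral (hS : IsC0Semigroup S) (hSd : ExpDecay S) :
    ∃ E : X →L[ℝ] X, IsLyapunovIntegral S B Q E := by
  obtain ⟨E, hE⟩ := exists_lyapunov hS.adjoint hSd.adjoint (BQB B Q)
  simp only [ContinuousLinearMap.adjoint_adjoint] at hE
  exact ⟨-E, fun x => ⟨(hE x).1, by rw [neg_apply, (hE x).2]⟩⟩

theorem intervalIntegrable_zForcing (hper : 0 < per) (hyd : ContinuousOn yd (Icc 0 per))
    (hud : IntervalIntegrable ud volume 0 per) :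
    IntervalIntegrable (zForcing B C P E yd ud) volume 0 per :=
  ((hud.clm_apply B).clm_apply (1 + E ∘L P)).sub
    (((hyd.intervalIntegrable_of_Icc hper.le).clm_apply (CC C)).clm_apply E)

theorem intervalIntegrable_qForcing (hper : 0 < per) (hyd : ContinuousOn yd (Icc 0 per))
    (hud : IntervalIntegrable ud volume 0 per) :
    IntervalIntegrable (qForcing B C P yd ud per) volume 0 per :=
  (((intervalIntegrable_reverse hud).clm_apply B).clm_apply P).neg.add
    ((intervalIntegrable_reverse (hyd.intervalIntegrable_of_Icc hper.le)).clm_apply (CC C))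

/-- The state part of the decoupled system: `z - E q` solves the state equation. -/
theorem isMildSolution_state (hT : IsC0Semigroup T) (hS : IsC0Semigroup S)
    (hSP : IsDuhamel T (-(BQB B Q ∘L P)) S) (hE : IsLyapunovIntegral S B Q E)
    (hper : 0 < per) (hyd : ContinuousOn yd (Icc 0 per))
    (hud : IntervalIntegrable ud volume 0 per) {z p : ℝ → X}
    (hz : IsMildSolution S (zForcing B C P E yd ud) per z)
    (hp : IsMildSolution (fun t => adjoint (S t)) (qForcing B C P yd ud per) per p) :
    IsMildSolution T
      (fun s => BQB B Q (p (per - s) - P (z s - E (p (per - s)))) + B (ud s)) per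
      (fun t => z t - E (p (per - t))) := by
  have hqI := intervalIntegrable_qForcing (B := B) (C := C) (P := P) hper hyd hud
  have hpc := hp.continuousOn hS.adjoint hqI
  have hWp := (hpc.intervalIntegrable_of_Icc hper.le).clm_apply (BQB B Q)
  -- The Lyapunov equation makes -E carry forward trajectories of S^* to backward trajectories of S.
  -- Since p is q in reversed time, a second reversal makes -E q a forward solution for S.
  have h1 : IsBackwardMildSolution S
      (fun s => (-E) (qForcing B C P yd ud per s) - BQB B Q (p s)) per (fun s => (-E) (p s)) := by
    refine IsMildSolution.intertwine hS.adjoint hS (fun t ht x => ?_) hqI hp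
    have := (hE.isLyapunov.isSylvester hS.adjoint).apply_eq hS.adjoint hS.adjoint ht x
    simpa only [ContinuousLinearMap.adjoint_adjoint] using this
  have h2 := isBackwardMildSolution_iff.1 h1
  have hI : IntervalIntegrable (fun s => -((-E) (qForcing B C P yd ud per (per - s)) -
      BQB B Q (p (per - s)))) volume 0 per :=
    (intervalIntegrable_reverse ((hqI.clm_apply (-E)).sub hWp)).neg
  have h3 := hz.add hS (intervalIntegrable_zForcing hper hyd hud) hI h2
  have h4 : IsMildSolution S (fun s => B (ud s) + BQB B Q (p (per - s))) per
      (fun t => z t - E (p (per - t))) := by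
    -- The E-terms of the two forcings cancel, which is why `zForcing` contains them; B u_d + W q is
    -- what remains.
    convert h3 using 2 with s s
    · simp only [zForcing, qForcing, sub_sub_cancel, add_apply, neg_apply, map_add, map_neg,
        one_apply_eq_self, ContinuousLinearMap.comp_apply]
      abel
    · rw [neg_apply, sub_eq_add_neg]
  have h5 := h4.of_perturbation hT hS hSP ((hud.clm_apply B).add (intervalIntegrable_reverse hWp))
  convert h5 using 2 with s
  simp only [map_sub, neg_apply, ContinuousLinearMap.comp_apply]
  abel

/-- The costate part of the decoupled system: `q - P y` solves the adjoint equation. -/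
theorem isBackwardMildSolution_costate (hT : IsC0Semigroup T) (hS : IsC0Semigroup S)
    (hSP : IsDuhamel T (-(BQB B Q ∘L P)) S) (hQ : Q.IsPositive) (hu : IsUnit Q)
    (hP : P.IsPositive) (hSyl : IsSylvester T T P (CC C - P ∘L BQB B Q ∘L P))
    (hper : 0 < per) (hyd : ContinuousOn yd (Icc 0 per))
    (hud : IntervalIntegrable ud volume 0 per) {p : ℝ → X}
    (hp : IsMildSolution (fun t => adjoint (S t)) (qForcing B C P yd ud per) per p)
    (hy : IsMildSolution T (fun s => BQB B Q (p (per - s) - P (y s)) + B (ud s)) per y)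
    (hyc : ContinuousOn y (Icc 0 per)) :
    IsBackwardMildSolution (fun t => adjoint (T t)) (fun s => CC C (y s) - CC C (yd s)) per
      (fun t => p (per - t) - P (y t)) := by
  have hW := isPositive_BQB (B := B) hQ hu
  have hqI := intervalIntegrable_qForcing (B := B) (C := C) (P := P) hper hyd hud
  have hpc := hp.continuousOn hS.adjoint hqI
  have hpI := intervalIntegrable_reverse (hpc.intervalIntegrable_of_Icc hper.le)
  have hyI := hyc.intervalIntegrable_of_Icc (μ := volume) hper.le
  have hfI : IntervalIntegrable (fun s => BQB B Q (p (per - s) - P (y s)) + B (ud s))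
      volume 0 per :=
    ((hpI.sub (hyI.clm_apply P)).clm_apply (BQB B Q)).add (hud.clm_apply B)
  -- Here P plays the role E had for the state: the Riccati equation makes P y a backward solution
  -- for T^*. It is then subtracted from q, whose equation is also rewritten for T^*.
  have h1 := hy.intertwine hT hT.adjoint
    (fun t ht x => hSyl.apply_eq hT hT ht x) hfI
  have h2 := hp.of_perturbation hT.adjoint hS.adjoint (hSP.adjoint hT hS) hqI
  have h3 : IsBackwardMildSolution (fun t => adjoint (T t))
      (fun s => P (B (ud s)) - CC C (yd s) + P (BQB B Q (p (per - s)))) per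
      (fun t => p (per - t)) := by
    rw [isBackwardMildSolution_iff]
    simp only [sub_sub_cancel]
    convert h2 using 2 with s
    have : adjoint (-(BQB B Q ∘L P)) (p s) = -P (BQB B Q (p s)) := by
      rw [map_neg, ContinuousLinearMap.adjoint_comp, hP.isSelfAdjoint.adjoint_eq,
        hW.isSelfAdjoint.adjoint_eq]
      rfl
    rw [this, qForcing]
    abel
  have h4 := IsBackwardMildSolution.sub hT.adjoint
    ((((hud.clm_apply B).clm_apply P).sub
      ((hyd.intervalIntegrable_of_Icc hper.le).clm_apply (CC C))).add
      ((hpI.clm_apply (BQB B Q)).clm_apply P))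
    ((hfI.clm_apply P).sub (hyI.clm_apply (CC C - P ∘L BQB B Q ∘L P))) h3 h1
  -- All terms containing P cancel: the P W P y from the state equation against the one in the
  -- Riccati source, and P W q, P B u_d against those in the equation of q.
  convert h4 using 2 with s
  simp only [map_sub, map_add, sub_apply, ContinuousLinearMap.comp_apply]
  abel

/-- The costate is continuous, so the control differs from u_d by a function bounded on the period
and is square integrable. -/
theorem isAdmissible_of_isExtremal
    (hud : MemLp ud 2 (volume.restrict (Ioc 0 per))) (h : IsExtremal T B C Q yd ud per y l u)
    (hctrl : ∀ t, u t = ud t + Ring.inverse Q (adjoint B (l t))) :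
    IsAdmissible T B per y u := by
  have hlc : ContinuousOn (fun t => Ring.inverse Q (adjoint B (l t))) (Icc 0 per) :=
    ((Ring.inverse Q).continuous.comp (adjoint B).continuous).comp_continuousOn
      h.costate_continuousOn
  refine ⟨h.state_continuousOn, ?_, ?_, h.state_periodic⟩
  · obtain ⟨M, hM⟩ := isCompact_Icc.exists_bound_of_continuousOn hlc
    rw [show u = ud + fun t => Ring.inverse Q (adjoint B (l t)) from funext hctrl]
    refine hud.add (MemLp.of_bound
      ((hlc.mono Ioc_subset_Icc_self).aestronglyMeasurable measurableSet_Ioc) M ?_)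
    filter_upwards [ae_restrict_mem measurableSet_Ioc] with t ht
    exact hM t (Ioc_subset_Icc_self ht)
  · convert h.state_mild using 2 with s
    rw [hctrl, map_add, add_comm]
    rfl

end Explicit

end LQPeriodic

/-! ### Assembly of the main theorem -/

theorem lemma3p3
    {X U V : Type*}
    [NormedAddCommGroup X] [InnerProductSpace ℝ X] [CompleteSpace X]
    [NormedAddCommGroup U] [InnerProductSpace ℝ U] [CompleteSpace U]
    [NormedAddCommGroup V] [InnerProductSpace ℝ V] [CompleteSpace V]
    -- `A` generates the `C₀` semigroup `T`
    (A : X →ₗ.[ℝ] X) (T : ℝ → X →L[ℝ] X) (hT : IsGeneratorOf A T)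
    (B : U →L[ℝ] X) (C : X →L[ℝ] V)
    (Q : U →L[ℝ] U) (hQpos : Q.IsPositive) (hQinv : IsUnit Q)
    -- the period and the periodic tracking terms
    (per : ℝ) (hper : 0 < per)
    (yd : ℝ → X) (hyd : ContinuousOn yd (Ici 0))
    (hyd_per : ∀ᵐ t ∂(volume.restrict (Ioi (0 : ℝ))), yd (t + per) = yd t)
    (ud : ℝ → U) (hud : ∀ b : ℝ, 0 < b → MemLp ud 2 (volume.restrict (Ioc 0 b)))
    (hud_per : ∀ᵐ t ∂(volume.restrict (Ioi (0 : ℝ))), ud (t + per) = ud t)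
    (hstab : ExpStabilizable A B) (hdet : ExpDetectable A C) :
    ∃ P : X →L[ℝ] X,
      IsRiccatiSolution A B C Q P ∧
      (∀ P' : X →L[ℝ] X, IsRiccatiSolution A B C Q P' → P' = P) ∧
    ∃ S : ℝ → X →L[ℝ] X,
      IsGeneratorOf (closedLoop A B Q P) S ∧ ExpDecay S ∧
      IsUnit (1 - S per) ∧ IsUnit (1 - ContinuousLinearMap.adjoint (S per)) ∧
    ∃ E : X →L[ℝ] X,
      IsLyapunovIntegral S B Q E ∧
    ∃ (z q y l : ℝ → X) (u : ℝ → U),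
      -- the explicit formulas
      (∀ t, z t = zTraj S B C P E yd ud per t) ∧
      (∀ t, q t = qTraj S B C P yd ud per t) ∧
      (∀ t, y t = z t - E (q t)) ∧
      (∀ t, l t = -P (z t) + (1 + P ∘L E) (q t)) ∧
      (∀ t, u t = ud t + Ring.inverse Q (ContinuousLinearMap.adjoint B (l t))) ∧
      -- `z` and `q` are periodic
      z 0 = z per ∧ q 0 = q per ∧
      -- `(y, u)` is the unique optimal pair
      IsOptimal T B C Q yd ud per y u ∧
      (∀ (y' : ℝ → X) (u' : ℝ → U), IsOptimal T B C Q yd ud per y' u' →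
        (∀ t ∈ Icc 0 per, y' t = y t) ∧
        (∀ᵐ t ∂(volume.restrict (Icc 0 per)), u' t = u t)) ∧
      -- `(y, l, u)` is the unique periodic extremal triple
      IsExtremal T B C Q yd ud per y l u ∧
      (∀ (y' l' : ℝ → X) (u' : ℝ → U), IsExtremal T B C Q yd ud per y' l' u' →
        (∀ t ∈ Icc 0 per, y' t = y t) ∧
        (∀ t ∈ Icc 0 per, l' t = l t) ∧
        (∀ᵐ t ∂(volume.restrict (Icc 0 per)), u' t = u t)) := by
  have hT' := hT.semigroup
  obtain ⟨K, F', hF', hFd', hFK⟩ := hstab.exists_duhamel hT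
  obtain ⟨H, F, hF, hFd, hFH⟩ := hdet.exists_duhamel hT
  have hW := isPositive_BQB (B := B) hQpos hQinv
  obtain ⟨P, hP, hSyl⟩ := exists_riccati (B := B) (C := C) (Q := Q) hT' hF hFd hFH hF' hFd' hFK
    hQpos hQinv
  -- Stated for an arbitrary nonnegative solution, viewed as a solution of the Riccati inequality
  -- with residual 0: the uniqueness argument needs the closed loop of a competing solution to be
  -- stable as well.
  have hloop : ∀ P' : X →L[ℝ] X, P'.IsPositive →
      IsSylvester T T P' (CC C - P' ∘L BQB B Q ∘L P') →
      ∃ S', IsC0Semigroup S' ∧ IsDuhamel T (-(BQB B Q ∘L P')) S' ∧ ExpDecay S' := by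
    intro P' hP' hSyl'
    obtain ⟨S', hS', hSP'⟩ := exists_perturbation hT' (-(BQB B Q ∘L P'))
    refine ⟨S', hS', hSP', (expDecay_closedLoop hT' hF hFd hFH hS' hW
      ⟨hP', 0, ContinuousLinearMap.isPositive_zero, ?_⟩ hSP').1⟩
    rwa [add_zero]
  obtain ⟨S, hS, hSP, hSd⟩ := hloop P hP hSyl
  have hunit := isUnit_one_sub_of_expDecay hS hSd hper
  have hunit' := isUnit_one_sub_of_expDecay hS.adjoint hSd.adjoint hper
  obtain ⟨E, hE⟩ := exists_isLyapunovIntegral (B := B) (Q := Q) hS hSd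
  have hyd' : ContinuousOn yd (Icc 0 per) := hyd.mono Icc_subset_Ici_self
  have hudp := hud per hper
  have hudI := intervalIntegrable_of_memLp hper.le hudp
  set z : ℝ → X := periodicTraj S (zForcing B C P E yd ud) per with hz
  -- `p` is q in reversed time, a forward trajectory of the adjoint closed loop; q t unfolds to p
  -- (per - t).
  set p : ℝ → X := periodicTraj (fun t => ContinuousLinearMap.adjoint (S t))
    (qForcing B C P yd ud per) per with hp
  have hzm : IsMildSolution S (zForcing B C P E yd ud) per z := isMildSolution_periodicTraj hS
  have hpm : IsMildSolution (fun t => ContinuousLinearMap.adjoint (S t))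
    (qForcing B C P yd ud per) per p := isMildSolution_periodicTraj hS.adjoint
  have hz0 : z 0 = z per := periodicTraj_periodic hS hunit
  have hp0 : p 0 = p per := periodicTraj_periodic hS.adjoint hunit'
  have hq0 : p (per - 0) = p (per - per) := by rw [sub_zero, sub_self, hp0]
  have hzc : ContinuousOn z (Icc 0 per) :=
    hzm.continuousOn hS (intervalIntegrable_zForcing hper hyd' hudI)
  have hqc : ContinuousOn (fun t => p (per - t)) (Icc 0 per) :=
    (hpm.continuousOn hS.adjoint (intervalIntegrable_qForcing hper hyd' hudI)).comp
      (by fun_prop) fun t ht => ⟨sub_nonneg.2 ht.2, sub_le_self _ ht.1⟩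
  have hyc : ContinuousOn (fun t => z t - E (p (per - t))) (Icc 0 per) :=
    hzc.sub (E.continuous.comp_continuousOn hqc)
  have hym := isMildSolution_state hT' hS hSP hE hper hyd' hudI hzm hpm
  have hlm := isBackwardMildSolution_costate hT' hS hSP hQpos hQinv hP hSyl hper hyd' hudI hpm hym
    hyc
  have hl : ∀ t, p (per - t) - P (z t - E (p (per - t))) =
      -P (z t) + (1 + P ∘L E) (p (per - t)) := fun t => by
    simp only [map_sub, add_apply, one_apply_eq_self, ContinuousLinearMap.comp_apply]
    abel
  have hext : IsExtremal T B C Q yd ud per (fun t => z t - E (p (per - t)))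
      (fun t => p (per - t) - P (z t - E (p (per - t))))
      (fun t => ud t + Ring.inverse Q (ContinuousLinearMap.adjoint B
        (p (per - t) - P (z t - E (p (per - t)))))) :=
    ⟨hyc, hqc.sub (P.continuous.comp_continuousOn hyc), hym, by simp only [hq0, hz0], hlm,
      by simp only [hq0, hz0], ae_of_all _ fun t => rfl⟩
  have hadm := isAdmissible_of_isExtremal hudp hext fun t => rfl
  refine ⟨P, (isRiccatiSolution_iff hT).2 ⟨hP, hSyl⟩, fun P' hP' => ?_, S,
    isGeneratorOf_boundedPerturbation hT hS hSP, hSd, hunit, hunit', E, hE, z,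
    fun t => p (per - t), _, _, _, fun t => rfl, fun t => rfl, fun t => rfl, hl, fun t => rfl,
    hz0, hq0, hext.isOptimal hT' hQpos hQinv hper hyd' hudp (fun t => rfl) hadm,
    fun y' u' h' => hext.optimal_unique hT' hF hFd hFH hQpos hQinv hper hyd' hudp (fun t => rfl)
      hadm h',
    hext, fun y' l' u' h' => hext.unique hT' hF hFd hFH hF' hFd' hFK hQpos hQinv hper hyd' hudI h'⟩
  obtain ⟨hP'p, hSyl'⟩ := (isRiccatiSolution_iff hT).1 hP'
  obtain ⟨S', hS', hSP', hSd'⟩ := hloop P' hP'p hSyl'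
  exact riccati_unique hT' hW hP hP'p hSyl hSyl' hS hSP hSd hS' hSP' hSd'
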